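/- Let $0<q<1$ and $t\in\mathbb R$. Let $U=U_q(\mathfrak{su}(2))$ be the complex unital Hopf $*$-algebra with generators $e,f,k^{\pm1}$, relations $ke=q^2ek$, $kf=q^{-2}fk$, $ef-fe=\frac{k-k^{-1}}{q-q^{-1}}$, involution $e^*=fk$, $f^*=k^{-1}e$, $k^*=k$ and coproduct $\Delta(e)=e\otimes1+k\otimes e$, $\Delta(f)=f\otimes k^{-1}+1\otimes f$, $\Delta(k)=k\otimes k$. Let $A=\mathcal O_q(SU(2))$ be the Hopf $*$-algebra generated by the entries of $u=\begin{pmatrix}\alpha&\beta\\\gamma&\delta\end{pmatrix}$ with relations $\alpha\beta=q\beta\alpha$, $\alpha\gamma=q\gamma\alpha$, $\beta\gamma=\gamma\beta$, $\beta\delta=q\delta\beta$, $\gamma\delta=q\delta\gamma$, $\alpha\delta-q\beta\gamma=1$, $\delta\alpha-q^{-1}\gamma\beta=1$, involution $\alpha^*=\delta$, $\beta^*=-q\gamma$, $\gamma^*=-q^{-1}\beta$, $\delta^*=\alpha$, and coproduct $\Delta(u_{ij})=\sum_l u_{il}\otimes u_{lj}$. Let $\tau:A\otimes U\to\mathbb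 C$ be the unitary pairing (that is, $\tau(a,hk)=\tau(a_{(1)},h)\tau(a_{(2)},k)$, $\tau(ab,h)=\tau(a,h_{(1)})\tau(b,h_{(2)})$, $\tau(1,h)=\varepsilon(h)$, $\tau(a,1)=\varepsilon(a)$, $\tau(a^*,h)=\overline{\tau(a,S(h)^*)}$, $\tau(a,h^*)=\overline{\tau(S(a)^*,h)}$) determined by $\tau(u,e)=\begin{pmatrix}0&q^{1/2}\\0&0\end{pmatrix}$, $\tau(u,f)=\begin{pmatrix}0&0\\q^{-1/2}&0\end{pmatrix}$, $\tau(u,k)=\begin{pmatrix}q&0\\0&q^{-1}\end{pmatrix}$. Let $\mathcal D(A,U)$ be the Drinfeld double, i.e. the unital $*$-algebra generated by copies of $A$ and $U$ with interchange relations \[ ha=\tau(a_{(3)},h_{(1)})\,a_{(2)}h_{(2)}\,\tau(a_{(1)},S^{-1}(h_{(3)})),\qquad ah=\tau(S^{-1}(a_{(3)}),h_{(1)})\,h_{(2)}a_{(2)}\,\tau(a_{(1)},h_{(3)})\qquad(a\in A,\ h\in U). \] Put $B_t=q^{-1/2}(e-fk)-i(q-q^{-1})^{-1}t\,k\in U$,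 and define $X_t,Y_t,Z_t\in A$ by \[ u^*\begin{pmatrix}0&i\\-i&-t\end{pmatrix}u=\begin{pmatrix}q^{-1}Z_t&Y_t\\X_t&-t-qZ_t\end{pmatrix}. \] Let $U_q(\mathfrak k_t)\subseteq U$ be the unital $*$-subalgebra generated by $B_t$, let $U_q(\mathfrak m_t)=\mathcal O_q(S_t^2)\subseteq A$ be the unital $*$-subalgebra generated by the entries of this matrix, and let $U_q(\mathfrak{sl}(2,\mathbb R)_t)\subseteq\mathcal D(A,U)$ be the unital $*$-subalgebra generated by $U_q(\mathfrak k_t)$ and $U_q(\mathfrak m_t)$. Then $U_q(\mathfrak{sl}(2,\mathbb R)_t)$ is the universal unital complex $*$-algebra generated by elements $X_t,Y_t,Z_t,B_t$ subject to the relations \[ B_t^*=-B_t,\qquad X_t^*=Y_t,\qquad Z_t^*=Z_t, \] \[ X_tZ_t=q^2Z_tX_t,\qquad Y_tZ_t=q^{-2}Z_tY_t,\qquad X_tY_t=1-qtZ_t-q^2Z_t^2,\qquad Y_tX_t=1-q^{-1}tZ_t-q^{-2}Z_t^2, \] \[ B_tX_t=q^2X_tB_t+q((q+q^{-1})Z_t+t),\qquad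 B_tY_t=q^{-2}Y_tB_t+q^{-1}((q+q^{-1})Z_t+t),\qquad B_tZ_t=Z_tB_t-(X_t+Y_t). \] That is, these elements satisfy the relations, and for every unital complex $*$-algebra $C$ and all $x,y,z,b\in C$ satisfying the same relations there is a unique unital $*$-homomorphism $U_q(\mathfrak{sl}(2,\mathbb R)_t)\to C$ with $X_t\mapsto x$, $Y_t\mapsto y$, $Z_t\mapsto z$, $B_t\mapsto b$. -/

import Mathlib

open scoped TensorProduct ComplexConjugate
noncomputable section
namespace QSL2

set_option linter.unusedSimpArgs false
set_option linter.unnecessarySeqFocus false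

section StarConstruction

/-- The opposite algebra of `R` with complex-conjugated scalar multiplication: conjugate-linear
anti-multiplicative maps `R → S` are the same as algebra homomorphisms `R → ConjOp S`. -/
def ConjOp (R : Type*) : Type _ := Rᵐᵒᵖ

variable {R : Type*} [Ring R]

instance : Ring (ConjOp R) := inferInstanceAs (Ring Rᵐᵒᵖ)

instance [Algebra ℂ R] : Algebra ℂ (ConjOp R) :=
  RingHom.toAlgebra' ((algebraMap ℂ Rᵐᵒᵖ).comp (starRingEnd ℂ)) fun c x =>
    Algebra.commutes (A := Rᵐᵒᵖ) (conj c) x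

/-- The identity map `R → ConjOp R`, as an additive equivalence. -/
def toConjOp : R ≃+ ConjOp R := MulOpposite.opAddEquiv

theorem toConjOp_mul (x y : R) : toConjOp (x * y) = toConjOp y * toConjOp x := rfl

theorem toConjOp_one : toConjOp (1 : R) = 1 := rfl

theorem toConjOp_smul [Algebra ℂ R] (c : ℂ) (x : R) :
    toConjOp (c • x) = conj c • toConjOp x := by
  have h : toConjOp (algebraMap ℂ R c) = algebraMap ℂ (ConjOp R) (conj c) := by
    change _ = MulOpposite.op (algebraMap ℂ R (conj (conj c)))
    rw [Complex.conj_conj]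
    rfl
  rw [Algebra.smul_def, Algebra.smul_def, toConjOp_mul, h, Algebra.commutes]

theorem symm_mul (x y : ConjOp R) :
    toConjOp.symm (x * y) = toConjOp.symm y * toConjOp.symm x := rfl

theorem symm_smul [Algebra ℂ R] (c : ℂ) (x : ConjOp R) :
    toConjOp.symm (c • x) = conj c • toConjOp.symm x := by
  apply toConjOp.injective
  rw [toConjOp_smul]; simp

variable [Algebra ℂ R]

theorem symm_algebraMap (c : ℂ) :
    toConjOp.symm (algebraMap ℂ (ConjOp R) c) = algebraMap ℂ R (conj c) := rfl

theorem conjOp_invol (σ : R →ₐ[ℂ] ConjOp R) (s : Set R) (hs : Algebra.adjoin ℂ s = ⊤)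
    (h : ∀ x ∈ s, toConjOp.symm (σ (toConjOp.symm (σ x))) = x) (x : R) :
    toConjOp.symm (σ (toConjOp.symm (σ x))) = x := by
  have hx : x ∈ Algebra.adjoin ℂ s := hs ▸ Algebra.mem_top
  induction hx using Algebra.adjoin_induction with
  | mem x hx => exact h x hx
  | algebraMap r => simp [symm_algebraMap]
  | add x y _ _ hx hy => simp [hx, hy]
  | mul x y _ _ hx hy => simp [symm_mul, hx, hy]

/-- The `*`-structure on `R` given by a conjugate-linear anti-homomorphism `σ` which is involutive
on a generating set. -/
abbrev starRingOf (σ : R →ₐ[ℂ] ConjOp R) (s : Set R) (hs : Algebra.adjoin ℂ s = ⊤)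
    (h : ∀ x ∈ s, toConjOp.symm (σ (toConjOp.symm (σ x))) = x) : StarRing R where
  star x := toConjOp.symm (σ x)
  star_involutive := conjOp_invol σ s hs h
  star_mul x y := by simp [symm_mul]
  star_add x y := by simp

theorem starModuleOf (σ : R →ₐ[ℂ] ConjOp R) (s : Set R) (hs : Algebra.adjoin ℂ s = ⊤)
    (h : ∀ x ∈ s, toConjOp.symm (σ (toConjOp.symm (σ x))) = x) :
    letI := starRingOf σ s hs h
    StarModule ℂ R :=
  letI := starRingOf σ s hs h
  { star_smul := fun c x => by
      change toConjOp.symm (σ (c • x)) = conj c • toConjOp.symm (σ x)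
      rw [map_smul, symm_smul] }

theorem adjoin_presented {X : Type*} (r : FreeAlgebra ℂ X → FreeAlgebra ℂ X → Prop) :
    Algebra.adjoin ℂ (Set.range fun x => RingQuot.mkAlgHom ℂ r (FreeAlgebra.ι ℂ x)) = ⊤ := by
  have := congrArg (Subalgebra.map (RingQuot.mkAlgHom ℂ r)) (FreeAlgebra.adjoin_range_ι ℂ X)
  rw [AlgHom.map_adjoin, ← Set.range_comp, Algebra.map_top,
    (AlgHom.range_eq_top _).2 (RingQuot.mkAlgHom_surjective ℂ r)] at this
  exact this

end StarConstruction

section Hopf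

open Coalgebra HopfAlgebra

/-- A Hopf `*`-algebra: a complex Hopf algebra with a `*`-structure for which the coproduct and
counit are `*`-homomorphisms. -/
class HopfStarAlgebra (H : Type*) [Ring H] [HopfAlgebra ℂ H] [StarRing H] [StarModule ℂ H] :
    Prop where
  comul_star : ∀ a : H, comul (R := ℂ) (star a) = star (comul (R := ℂ) a)
  counit_star : ∀ a : H, counit (R := ℂ) (star a) = conj (counit (R := ℂ) a)

/-- A bialgebra is a Hopf algebra as soon as it has an anti-homomorphism satisfying the antipode
identities on a set of algebra generators. -/
abbrev hopfOf {H : Type*} [Ring H] [Bialgebra ℂ H] (S : H →ₐ[ℂ] Hᵐᵒᵖ) (s : Set H)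
    (hs : Algebra.adjoin ℂ s = ⊤)
    (h₁ : ∀ x ∈ s, LinearMap.mul' ℂ H
      (((MulOpposite.opLinearEquiv ℂ).symm.toLinearMap ∘ₗ S.toLinearMap).rTensor H (comul x)) =
        algebraMap ℂ H (counit x))
    (h₂ : ∀ x ∈ s, LinearMap.mul' ℂ H
      (((MulOpposite.opLinearEquiv ℂ).symm.toLinearMap ∘ₗ S.toLinearMap).lTensor H (comul x)) =
        algebraMap ℂ H (counit x)) : HopfAlgebra ℂ H where
  antipode := (MulOpposite.opLinearEquiv ℂ).symm.toLinearMap ∘ₗ S.toLinearMap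
  mul_antipode_rTensor_comul := by
    ext x
    have hx : x ∈ Algebra.adjoin ℂ s := hs ▸ Algebra.mem_top
    simp only [LinearMap.comp_apply, Algebra.linearMap_apply]
    induction hx using Algebra.adjoin_induction with
    | mem x hx => exact h₁ x hx
    | algebraMap r => simp [Algebra.TensorProduct.algebraMap_apply]
    | add x y _ _ hx hy => simp only [map_add, hx, hy]
    | mul x y _ _ hx hy =>
      rw [Bialgebra.comul_mul, Bialgebra.counit_mul, RingHom.map_mul]
      rw [← (ℛ ℂ x).eq] at hx ⊢
      rw [← (ℛ ℂ y).eq] at hy ⊢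
      rw [Finset.sum_mul_sum, Finset.sum_comm, Algebra.commutes]
      simp only [map_sum, LinearMap.rTensor_tmul, LinearMap.mul'_apply,
        Algebra.TensorProduct.tmul_mul_tmul] at hx hy ⊢
      rw [← hy, Finset.sum_mul]
      refine Finset.sum_congr rfl fun j _ => ?_
      rw [mul_assoc, ← Algebra.commutes, ← hx, Finset.sum_mul, Finset.mul_sum]
      refine Finset.sum_congr rfl fun i _ => ?_
      simp [mul_assoc]
  mul_antipode_lTensor_comul := by
    ext x
    have hx : x ∈ Algebra.adjoin ℂ s := hs ▸ Algebra.mem_top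
    simp only [LinearMap.comp_apply, Algebra.linearMap_apply]
    induction hx using Algebra.adjoin_induction with
    | mem x hx => exact h₂ x hx
    | algebraMap r => simp [Algebra.TensorProduct.algebraMap_apply]
    | add x y _ _ hx hy => simp only [map_add, hx, hy]
    | mul x y _ _ hx hy =>
      rw [Bialgebra.comul_mul, Bialgebra.counit_mul, RingHom.map_mul]
      rw [← (ℛ ℂ x).eq] at hx ⊢
      rw [← (ℛ ℂ y).eq] at hy ⊢
      rw [Finset.sum_mul_sum]
      simp only [map_sum, LinearMap.lTensor_tmul, LinearMap.mul'_apply,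
        Algebra.TensorProduct.tmul_mul_tmul] at hx hy ⊢
      rw [← hx, Finset.sum_mul]
      refine Finset.sum_congr rfl fun i _ => ?_
      rw [mul_assoc, ← Algebra.commutes, ← hy, Finset.sum_mul, Finset.mul_sum]
      refine Finset.sum_congr rfl fun j _ => ?_
      simp [mul_assoc]

variable {H : Type*} [Ring H] [HopfAlgebra ℂ H] [StarRing H]

/-- The inverse `h ↦ S(h^*)^*` of the antipode of a Hopf `*`-algebra. -/
def antipodeInv (h : H) : H := star (antipode ℂ (star h))

theorem antipodeInv_star (h : H) : antipodeInv (star h) = star (antipode ℂ h) := by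
  simp [antipodeInv]

variable [StarModule ℂ H] [HopfStarAlgebra H]

/-- `S(S(h^*)^*) = h`. -/
theorem antipode_antipodeInv (h : H) : antipode ℂ (antipodeInv h) = h := by
  have key : ∀ a : H, ∑ i ∈ (ℛ ℂ a).index,
      antipodeInv ((ℛ ℂ a).right i) * (ℛ ℂ a).left i = algebraMap ℂ H (counit a) := fun a => by
    have h := mul_antipode_lTensor_comul_apply (R := ℂ) (star a)
    rw [HopfStarAlgebra.comul_star, HopfStarAlgebra.counit_star, ← (ℛ ℂ a).eq, star_sum] at h
    simp only [TensorProduct.star_tmul, map_sum, LinearMap.lTensor_tmul,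
      LinearMap.mul'_apply] at h
    have h' := congrArg star h
    rw [star_sum, ← algebraMap_star_comm] at h'
    simpa [antipodeInv] using h'
  let T : H →ₗ[ℂ] H :=
    { toFun := fun a => antipode ℂ (antipodeInv a)
      map_add' := by simp [antipodeInv]
      map_smul' := by simp [antipodeInv] }
  have h1 : WithConv.toConv (LinearMap.id : H →ₗ[ℂ] H) * WithConv.toConv (antipode ℂ) = 1 :=
    LinearMap.id_mul_antipode
  have h2 : WithConv.toConv (antipode ℂ : H →ₗ[ℂ] H) * WithConv.toConv T = 1 := by
    ext a
    rw [(ℛ ℂ a).convMul_apply]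
    have := congrArg (antipode ℂ) (key a)
    rw [map_sum, Algebra.algebraMap_eq_smul_one, map_smul, antipode_one] at this
    simp only [HopfAlgebra.antipode_mul_antidistrib] at this
    rw [LinearMap.convOne_apply, Algebra.algebraMap_eq_smul_one]
    exact this
  have := left_inv_eq_right_inv h1 h2
  exact (congrArg (fun f => f.ofConv h) this).symm

theorem antipodeInv_antipode (h : H) : antipodeInv (antipode ℂ h) = h := by
  have := congrArg star (antipode_antipodeInv (star h))
  simpa [antipodeInv] using this

end Hopf
section Parameter

/-- The deformation parameter `0 < q < 1`, as a complex number. -/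
def qc (q : Set.Ioo (0 : ℝ) 1) : ℂ := ((q : ℝ) : ℂ)

/-- The square root `q^{1/2}`, as a complex number. -/
def qs (q : Set.Ioo (0 : ℝ) 1) : ℂ := ((Real.sqrt q : ℝ) : ℂ)

variable (q : Set.Ioo (0 : ℝ) 1)

theorem qc_ne : qc q ≠ 0 := by
  simpa [qc] using q.2.1.ne'

theorem qs_sq : qs q * qs q = qc q := by
  rw [qs, qc, ← Complex.ofReal_mul, Real.mul_self_sqrt q.2.1.le]

theorem qs_ne : qs q ≠ 0 := fun h => qc_ne q (by rw [← qs_sq, h, zero_mul])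

theorem qc_sub_ne : qc q - (qc q)⁻¹ ≠ 0 := by
  rw [qc, ← Complex.ofReal_inv, ← Complex.ofReal_sub, Complex.ofReal_ne_zero]
  have h0 := q.2.1
  have h1 := q.2.2
  have := (one_lt_inv₀ h0).2 h1
  linarith

@[simp] theorem conj_qc : conj (qc q) = qc q := Complex.conj_ofReal _

@[simp] theorem conj_qs : conj (qs q) = qs q := Complex.conj_ofReal _

end Parameter

section Uq

open Coalgebra HopfAlgebra

/-- Generators `e, f, k, k⁻¹` of the quantized enveloping algebra. -/
inductive UqGen
  | e | f | k | kinv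

open FreeAlgebra in
/-- The defining relations of the quantized enveloping algebra. -/
inductive UqRel (q : Set.Ioo (0 : ℝ) 1) : FreeAlgebra ℂ UqGen → FreeAlgebra ℂ UqGen → Prop
  | k_kinv : UqRel q (ι ℂ .k * ι ℂ .kinv) 1
  | kinv_k : UqRel q (ι ℂ .kinv * ι ℂ .k) 1
  | k_e : UqRel q (ι ℂ .k * ι ℂ .e) (qc q ^ 2 • (ι ℂ .e * ι ℂ .k))
  | k_f : UqRel q (ι ℂ .k * ι ℂ .f) ((qc q ^ 2)⁻¹ • (ι ℂ .f * ι ℂ .k))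
  | e_f : UqRel q (ι ℂ .e * ι ℂ .f - ι ℂ .f * ι ℂ .e)
      ((qc q - (qc q)⁻¹)⁻¹ • (ι ℂ .k - ι ℂ .kinv))

/-- The quantized enveloping algebra `U_q(su(2))`. -/
def Uq (q : Set.Ioo (0 : ℝ) 1) : Type := RingQuot (UqRel q)

namespace Uq

variable {q : Set.Ioo (0 : ℝ) 1}

instance : Ring (Uq q) := inferInstanceAs (Ring (RingQuot (UqRel q)))
instance : Algebra ℂ (Uq q) := inferInstanceAs (Algebra ℂ (RingQuot (UqRel q)))

/-- The image of a generator. -/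
def gen (x : UqGen) : Uq q := RingQuot.mkAlgHom ℂ (UqRel q) (FreeAlgebra.ι ℂ x)

/-- The generator `e`. -/
def e : Uq q := gen .e
/-- The generator `f`. -/
def f : Uq q := gen .f
/-- The generator `k`. -/
def k : Uq q := gen .k
/-- The generator `k⁻¹`. -/
def kinv : Uq q := gen .kinv

theorem adjoin_gen : Algebra.adjoin ℂ (Set.range (gen : UqGen → Uq q)) = ⊤ :=
  adjoin_presented (UqRel q)

theorem k_mul_kinv : (k : Uq q) * kinv = 1 := by
  have := RingQuot.mkAlgHom_rel ℂ (UqRel.k_kinv (q := q))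
  rw [map_mul, map_one] at this
  exact this

theorem kinv_mul_k : (kinv : Uq q) * k = 1 := by
  have := RingQuot.mkAlgHom_rel ℂ (UqRel.kinv_k (q := q))
  rw [map_mul, map_one] at this
  exact this

theorem k_mul_e : (k : Uq q) * e = qc q ^ 2 • (e * k) := by
  have := RingQuot.mkAlgHom_rel ℂ (UqRel.k_e (q := q))
  rw [map_smul, map_mul, map_mul] at this
  exact this

theorem k_mul_f : (k : Uq q) * f = (qc q ^ 2)⁻¹ • (f * k) := by
  have := RingQuot.mkAlgHom_rel ℂ (UqRel.k_f (q := q))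
  rw [map_smul, map_mul, map_mul] at this
  exact this

theorem e_mul_f_sub : (e : Uq q) * f - f * e = (qc q - (qc q)⁻¹)⁻¹ • (k - kinv) := by
  have := RingQuot.mkAlgHom_rel ℂ (UqRel.e_f (q := q))
  rw [map_smul, map_sub, map_sub, map_mul, map_mul] at this
  exact this

theorem kinv_mul_e : (kinv : Uq q) * e = (qc q ^ 2)⁻¹ • (e * kinv) := by
  have h : (kinv : Uq q) * (k * e) * kinv = kinv * (qc q ^ 2 • (e * k)) * kinv := by rw [k_mul_e]
  rw [← mul_assoc, kinv_mul_k, one_mul, mul_smul_comm, smul_mul_assoc, mul_assoc, mul_assoc,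
    k_mul_kinv, mul_one] at h
  rw [h, smul_smul, inv_mul_cancel₀ (pow_ne_zero _ (qc_ne q)), one_smul]

theorem kinv_mul_f : (kinv : Uq q) * f = qc q ^ 2 • (f * kinv) := by
  have h : (kinv : Uq q) * (k * f) * kinv = kinv * ((qc q ^ 2)⁻¹ • (f * k)) * kinv := by
    rw [k_mul_f]
  rw [← mul_assoc, kinv_mul_k, one_mul, mul_smul_comm, smul_mul_assoc, mul_assoc, mul_assoc,
    k_mul_kinv, mul_one] at h
  rw [h, smul_smul, mul_inv_cancel₀ (pow_ne_zero _ (qc_ne q)), one_smul]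

theorem e_mul_f : (e : Uq q) * f = f * e + (qc q - (qc q)⁻¹)⁻¹ • (k - kinv) := by
  rw [← e_mul_f_sub]; abel

theorem e_mul_kinv : (e : Uq q) * kinv = qc q ^ 2 • (kinv * e) := by
  rw [kinv_mul_e, smul_smul, mul_inv_cancel₀ (pow_ne_zero _ (qc_ne q)), one_smul]

theorem k_mul_kinv_mul (x : Uq q) : k * (kinv * x) = x := by
  rw [← mul_assoc, k_mul_kinv, one_mul]

theorem kinv_mul_k_mul (x : Uq q) : kinv * (k * x) = x := by
  rw [← mul_assoc, kinv_mul_k, one_mul]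

theorem k_mul_e_mul (x : Uq q) : k * (e * x) = qc q ^ 2 • (e * (k * x)) := by
  rw [← mul_assoc, k_mul_e, smul_mul_assoc, mul_assoc]

theorem k_mul_f_mul (x : Uq q) : k * (f * x) = (qc q ^ 2)⁻¹ • (f * (k * x)) := by
  rw [← mul_assoc, k_mul_f, smul_mul_assoc, mul_assoc]

theorem kinv_mul_e_mul (x : Uq q) : kinv * (e * x) = (qc q ^ 2)⁻¹ • (e * (kinv * x)) := by
  rw [← mul_assoc, kinv_mul_e, smul_mul_assoc, mul_assoc]

theorem kinv_mul_f_mul (x : Uq q) : kinv * (f * x) = qc q ^ 2 • (f * (kinv * x)) := by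
  rw [← mul_assoc, kinv_mul_f, smul_mul_assoc, mul_assoc]

theorem inv_sq_mul_sq : (qc q ^ 2)⁻¹ * qc q ^ 2 = 1 := inv_mul_cancel₀ (pow_ne_zero _ (qc_ne q))

theorem sq_mul_inv_sq : qc q ^ 2 * (qc q ^ 2)⁻¹ = 1 := mul_inv_cancel₀ (pow_ne_zero _ (qc_ne q))

/-- The algebra homomorphism out of `U_q(su(2))` with prescribed values on generators. -/
def lift {R : Type*} [Ring R] [Algebra ℂ R] (g : UqGen → R) (h₁ : g .k * g .kinv = 1)
    (h₂ : g .kinv * g .k = 1) (h₃ : g .k * g .e = qc q ^ 2 • (g .e * g .k))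
    (h₄ : g .k * g .f = (qc q ^ 2)⁻¹ • (g .f * g .k))
    (h₅ : g .e * g .f - g .f * g .e = (qc q - (qc q)⁻¹)⁻¹ • (g .k - g .kinv)) : Uq q →ₐ[ℂ] R :=
  RingQuot.liftAlgHom ℂ ⟨FreeAlgebra.lift ℂ g, by
    rintro _ _ (_ | _ | _ | _ | _) <;>
      simp only [map_mul, map_one, map_smul, map_sub, FreeAlgebra.lift_ι_apply, *]⟩

@[simp] theorem lift_gen {R : Type*} [Ring R] [Algebra ℂ R] (g : UqGen → R)
    (h₁ : g .k * g .kinv = 1)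
    (h₂ : g .kinv * g .k = 1) (h₃ : g .k * g .e = qc q ^ 2 • (g .e * g .k))
    (h₄ : g .k * g .f = (qc q ^ 2)⁻¹ • (g .f * g .k))
    (h₅ : g .e * g .f - g .f * g .e = (qc q - (qc q)⁻¹)⁻¹ • (g .k - g .kinv)) (x : UqGen) :
    lift (q := q) g h₁ h₂ h₃ h₄ h₅ (gen x) = g x := by
  refine (RingQuot.liftAlgHom_mkAlgHom_apply ℂ _ _ _).trans ?_
  simp

theorem hom_ext {R : Type*} [Ring R] [Algebra ℂ R] {φ ψ : Uq q →ₐ[ℂ] R} (he : φ e = ψ e)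
    (hf : φ f = ψ f) (hk : φ k = ψ k) (hi : φ kinv = ψ kinv) : φ = ψ := by
  refine AlgHom.ext_of_adjoin_eq_top adjoin_gen ?_
  rintro _ ⟨x, rfl⟩
  cases x
  exacts [he, hf, hk, hi]

open scoped TensorProduct in
/-- Values of the coproduct on generators. -/
def comulGen : UqGen → Uq q ⊗[ℂ] Uq q
  | .e => e ⊗ₜ 1 + k ⊗ₜ e
  | .f => f ⊗ₜ kinv + 1 ⊗ₜ f
  | .k => k ⊗ₜ k
  | .kinv => kinv ⊗ₜ kinv

/-- Values of the counit on generators. -/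
def counitGen : UqGen → ℂ
  | .e => 0
  | .f => 0
  | .k => 1
  | .kinv => 1

/-- Values of the antipode on generators. -/
def antipodeGen : UqGen → Uq q
  | .e => -(kinv * e)
  | .f => -(f * k)
  | .k => kinv
  | .kinv => k

/-- Values of the involution on generators. -/
def starGen : UqGen → Uq q
  | .e => f * k
  | .f => kinv * e
  | .k => k
  | .kinv => kinv

/-- The coproduct as an algebra homomorphism. -/
def comulHom : Uq q →ₐ[ℂ] Uq q ⊗[ℂ] Uq q :=
  lift comulGen
    (by simp [comulGen, k_mul_kinv, Algebra.TensorProduct.one_def])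
    (by simp [comulGen, kinv_mul_k, Algebra.TensorProduct.one_def])
    (by simp [comulGen, mul_add, add_mul, k_mul_e, TensorProduct.smul_tmul'])
    (by simp [comulGen, mul_add, add_mul, k_mul_f, k_mul_kinv, kinv_mul_k,
          TensorProduct.smul_tmul'])
    (by
      simp only [comulGen, mul_add, add_mul, Algebra.TensorProduct.tmul_mul_tmul, one_mul, mul_one,
        k_mul_f, e_mul_f]
      rw [e_mul_kinv]
      simp only [TensorProduct.add_tmul, TensorProduct.tmul_add, TensorProduct.sub_tmul,
        TensorProduct.tmul_sub, TensorProduct.tmul_smul, ← TensorProduct.smul_tmul', smul_smul,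
        smul_sub, mul_inv_cancel₀ (pow_ne_zero 2 (qc_ne q)), one_smul]
      abel)

/-- The counit as an algebra homomorphism. -/
def counitHom : Uq q →ₐ[ℂ] ℂ :=
  lift counitGen (by simp [counitGen]) (by simp [counitGen]) (by simp [counitGen])
    (by simp [counitGen]) (by simp [counitGen])

@[simp] theorem comulHom_e : comulHom (e : Uq q) = e ⊗ₜ 1 + k ⊗ₜ e := lift_gen _ _ _ _ _ _ .e
@[simp] theorem comulHom_f : comulHom (f : Uq q) = f ⊗ₜ kinv + 1 ⊗ₜ f := lift_gen _ _ _ _ _ _ .f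
@[simp] theorem comulHom_k : comulHom (k : Uq q) = k ⊗ₜ k := lift_gen _ _ _ _ _ _ .k
@[simp] theorem comulHom_kinv : comulHom (kinv : Uq q) = kinv ⊗ₜ kinv :=
  lift_gen _ _ _ _ _ _ .kinv
@[simp] theorem counitHom_e : counitHom (e : Uq q) = 0 := lift_gen _ _ _ _ _ _ .e
@[simp] theorem counitHom_f : counitHom (f : Uq q) = 0 := lift_gen _ _ _ _ _ _ .f
@[simp] theorem counitHom_k : counitHom (k : Uq q) = 1 := lift_gen _ _ _ _ _ _ .k
@[simp] theorem counitHom_kinv : counitHom (kinv : Uq q) = 1 := lift_gen _ _ _ _ _ _ .kinv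

instance : Bialgebra ℂ (Uq q) :=
  Bialgebra.ofAlgHom comulHom counitHom
    (by apply hom_ext <;>
      simp [TensorProduct.add_tmul, TensorProduct.tmul_add, Algebra.TensorProduct.one_def, add_assoc])
    (by apply hom_ext <;> simp)
    (by apply hom_ext <;> simp)

@[simp] theorem comul_e : comul (R := ℂ) (e : Uq q) = e ⊗ₜ 1 + k ⊗ₜ e := comulHom_e
@[simp] theorem comul_f : comul (R := ℂ) (f : Uq q) = f ⊗ₜ kinv + 1 ⊗ₜ f := comulHom_f
@[simp] theorem comul_k : comul (R := ℂ) (k : Uq q) = k ⊗ₜ k := comulHom_k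
@[simp] theorem comul_kinv : comul (R := ℂ) (kinv : Uq q) = kinv ⊗ₜ kinv := comulHom_kinv
@[simp] theorem counit_e : counit (R := ℂ) (e : Uq q) = 0 := counitHom_e
@[simp] theorem counit_f : counit (R := ℂ) (f : Uq q) = 0 := counitHom_f
@[simp] theorem counit_k : counit (R := ℂ) (k : Uq q) = 1 := counitHom_k
@[simp] theorem counit_kinv : counit (R := ℂ) (kinv : Uq q) = 1 := counitHom_kinv

/-- The antipode as an algebra homomorphism into the opposite algebra. -/
def antipodeHom : Uq q →ₐ[ℂ] (Uq q)ᵐᵒᵖ :=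
  lift (fun x => MulOpposite.op (antipodeGen x))
    (by simp [antipodeGen, ← MulOpposite.op_mul, k_mul_kinv])
    (by simp [antipodeGen, ← MulOpposite.op_mul, kinv_mul_k])
    (MulOpposite.unop_injective (by
      simp [antipodeGen, mul_assoc, kinv_mul_e, smul_smul, qc_ne]))
    (MulOpposite.unop_injective (by
      simp [antipodeGen, mul_assoc, kinv_mul_f_mul, kinv_mul_k, k_mul_kinv, smul_smul, qc_ne]))
    (MulOpposite.unop_injective (by
      simp only [antipodeGen, mul_assoc, MulOpposite.unop_sub, MulOpposite.unop_mul,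
        MulOpposite.unop_op, MulOpposite.unop_smul, neg_mul_neg, k_mul_kinv_mul]
      rw [← mul_assoc e, e_mul_f]
      simp only [add_mul, mul_add, smul_mul_assoc, mul_smul_comm, sub_mul, mul_sub, mul_assoc,
        kinv_mul_k, kinv_mul_k_mul, mul_one, kinv_mul_f_mul, kinv_mul_e_mul,
        smul_smul, sq_mul_inv_sq, one_smul, smul_sub]
      abel))

@[simp] theorem antipodeHom_e : antipodeHom (e : Uq q) = MulOpposite.op (-(kinv * e)) :=
  lift_gen _ _ _ _ _ _ .e
@[simp] theorem antipodeHom_f : antipodeHom (f : Uq q) = MulOpposite.op (-(f * k)) :=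
  lift_gen _ _ _ _ _ _ .f
@[simp] theorem antipodeHom_k : antipodeHom (k : Uq q) = MulOpposite.op kinv :=
  lift_gen _ _ _ _ _ _ .k
@[simp] theorem antipodeHom_kinv : antipodeHom (kinv : Uq q) = MulOpposite.op k :=
  lift_gen _ _ _ _ _ _ .kinv

instance : HopfAlgebra ℂ (Uq q) :=
  hopfOf antipodeHom (Set.range gen) adjoin_gen
    (by
      rintro _ ⟨_ | _ | _ | _, rfl⟩
      · rw [show (gen .e : Uq q) = e from rfl, comul_e, counit_e]; simp
      · rw [show (gen .f : Uq q) = f from rfl, comul_f, counit_f]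
        simp [mul_assoc, k_mul_kinv]
      · rw [show (gen .k : Uq q) = k from rfl, comul_k, counit_k]; simp [kinv_mul_k]
      · rw [show (gen .kinv : Uq q) = kinv from rfl, comul_kinv, counit_kinv]; simp [k_mul_kinv])
    (by
      rintro _ ⟨_ | _ | _ | _, rfl⟩
      · rw [show (gen .e : Uq q) = e from rfl, comul_e, counit_e]; simp [k_mul_kinv_mul]
      · rw [show (gen .f : Uq q) = f from rfl, comul_f, counit_f]; simp
      · rw [show (gen .k : Uq q) = k from rfl, comul_k, counit_k]; simp [k_mul_kinv]
      · rw [show (gen .kinv : Uq q) = kinv from rfl, comul_kinv, counit_kinv]; simp [kinv_mul_k])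

theorem antipode_op (x : Uq q) : MulOpposite.op (antipode ℂ x) = antipodeHom x := rfl

@[simp] theorem antipode_e : antipode ℂ (e : Uq q) = -(kinv * e) :=
  MulOpposite.op_injective (lift_gen _ _ _ _ _ _ .e)
@[simp] theorem antipode_f : antipode ℂ (f : Uq q) = -(f * k) :=
  MulOpposite.op_injective (lift_gen _ _ _ _ _ _ .f)
@[simp] theorem antipode_k : antipode ℂ (k : Uq q) = kinv :=
  MulOpposite.op_injective (lift_gen _ _ _ _ _ _ .k)
@[simp] theorem antipode_kinv : antipode ℂ (kinv : Uq q) = k :=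
  MulOpposite.op_injective (lift_gen _ _ _ _ _ _ .kinv)

theorem conjOp_eq {R : Type*} [Ring R] {x y : ConjOp R}
    (h : toConjOp.symm x = toConjOp.symm y) : x = y := toConjOp.symm.injective h

/-- The involution as a conjugate-linear anti-homomorphism. -/
def starHom : Uq q →ₐ[ℂ] ConjOp (Uq q) :=
  lift (fun x => toConjOp (starGen x))
    (conjOp_eq (by simp [symm_mul, starGen, kinv_mul_k]; rfl))
    (conjOp_eq (by simp [symm_mul, starGen, k_mul_kinv]; rfl))
    (conjOp_eq (by simp [symm_mul, symm_smul, starGen, mul_assoc, k_mul_f_mul, smul_smul, qc_ne]))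
    (conjOp_eq (by simp [symm_mul, symm_smul, starGen, mul_assoc, kinv_mul_k,
          kinv_mul_e, k_mul_e_mul, k_mul_kinv, smul_smul, qc_ne]))
    (conjOp_eq (by
      simp only [symm_mul, symm_smul, starGen, map_sub, mul_assoc, AddEquiv.symm_apply_apply,
        k_mul_kinv_mul]
      rw [← mul_assoc e, e_mul_f]
      simp [add_mul, mul_add, sub_mul, mul_sub, mul_assoc,
        kinv_mul_k, kinv_mul_k_mul, mul_one, kinv_mul_f_mul, kinv_mul_e_mul,
        smul_smul, sq_mul_inv_sq, one_smul, smul_sub]))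

@[simp] theorem starHom_e : starHom (e : Uq q) = toConjOp (f * k) := lift_gen _ _ _ _ _ _ .e
@[simp] theorem starHom_f : starHom (f : Uq q) = toConjOp (kinv * e) := lift_gen _ _ _ _ _ _ .f
@[simp] theorem starHom_k : starHom (k : Uq q) = toConjOp k := lift_gen _ _ _ _ _ _ .k
@[simp] theorem starHom_kinv : starHom (kinv : Uq q) = toConjOp kinv :=
  lift_gen _ _ _ _ _ _ .kinv

theorem starHom_invol : ∀ x ∈ Set.range (gen : UqGen → Uq q),
    toConjOp.symm (starHom (toConjOp.symm (starHom x))) = x := by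
  rintro _ ⟨_ | _ | _ | _, rfl⟩
  · change toConjOp.symm (starHom (toConjOp.symm (starHom e))) = e
    simp [symm_mul, k_mul_kinv_mul]
  · change toConjOp.symm (starHom (toConjOp.symm (starHom f))) = f
    simp [symm_mul, mul_assoc, k_mul_kinv]
  · change toConjOp.symm (starHom (toConjOp.symm (starHom k))) = k
    simp
  · change toConjOp.symm (starHom (toConjOp.symm (starHom kinv))) = kinv
    simp

instance : StarRing (Uq q) := starRingOf starHom (Set.range gen) adjoin_gen starHom_invol

instance : StarModule ℂ (Uq q) := starModuleOf starHom (Set.range gen) adjoin_gen starHom_invol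

theorem star_def (x : Uq q) : star x = toConjOp.symm (starHom x) := rfl

@[simp] theorem star_e : star (e : Uq q) = f * k := by simp [star_def]
@[simp] theorem star_f : star (f : Uq q) = kinv * e := by simp [star_def]
@[simp] theorem star_k : star (k : Uq q) = k := by simp [star_def]
@[simp] theorem star_kinv : star (kinv : Uq q) = kinv := by simp [star_def]

/-- Induction on elements of `U_q(su(2))` as an algebra. -/
theorem induction {p : Uq q → Prop} (he : p e) (hf : p f) (hk : p k) (hi : p kinv)
    (hc : ∀ c : ℂ, p (algebraMap ℂ _ c)) (ha : ∀ x y, p x → p y → p (x + y))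
    (hm : ∀ x y, p x → p y → p (x * y)) (x : Uq q) : p x := by
  have hx : x ∈ Algebra.adjoin ℂ (Set.range gen) := adjoin_gen (q := q) ▸ Algebra.mem_top
  induction hx using Algebra.adjoin_induction with
  | mem x hx =>
    obtain ⟨_ | _ | _ | _, rfl⟩ := hx
    exacts [he, hf, hk, hi]
  | algebraMap r => exact hc r
  | add x y _ _ hx hy => exact ha x y hx hy
  | mul x y _ _ hx hy => exact hm x y hx hy

instance : HopfStarAlgebra (Uq q) where
  comul_star x := by
    induction x using Uq.induction with
    | he => simp [Bialgebra.comul_mul, TensorProduct.star_tmul, add_mul, kinv_mul_k]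
    | hf => simp [Bialgebra.comul_mul, TensorProduct.star_tmul, mul_add, kinv_mul_k]
    | hk => simp
    | hi => simp
    | hc c => simp [← algebraMap_star_comm, Algebra.TensorProduct.algebraMap_apply]
    | ha x y hx hy => simp [hx, hy]
    | hm x y hx hy => simp [Bialgebra.comul_mul, hx, hy]
  counit_star x := by
    induction x using Uq.induction with
    | he => simp
    | hf => simp
    | hk => simp
    | hi => simp
    | hc c => simp [← algebraMap_star_comm]
    | ha x y hx hy => simp [hx, hy]
    | hm x y hx hy => simp [hx, hy, mul_comm]

end Uq
end Uq

section Oq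

open Coalgebra HopfAlgebra

/-- Generators `α, β, γ, δ` of the quantized function algebra. -/
inductive OqGen
  | α | β | γ | δ

open FreeAlgebra in
/-- The defining relations of the quantized function algebra. -/
inductive OqRel (q : Set.Ioo (0 : ℝ) 1) : FreeAlgebra ℂ OqGen → FreeAlgebra ℂ OqGen → Prop
  | α_β : OqRel q (ι ℂ .α * ι ℂ .β) (qc q • (ι ℂ .β * ι ℂ .α))
  | α_γ : OqRel q (ι ℂ .α * ι ℂ .γ) (qc q • (ι ℂ .γ * ι ℂ .α))
  | β_γ : OqRel q (ι ℂ .β * ι ℂ .γ) (ι ℂ .γ * ι ℂ .β)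
  | β_δ : OqRel q (ι ℂ .β * ι ℂ .δ) (qc q • (ι ℂ .δ * ι ℂ .β))
  | γ_δ : OqRel q (ι ℂ .γ * ι ℂ .δ) (qc q • (ι ℂ .δ * ι ℂ .γ))
  | α_δ : OqRel q (ι ℂ .α * ι ℂ .δ - qc q • (ι ℂ .β * ι ℂ .γ)) 1
  | δ_α : OqRel q (ι ℂ .δ * ι ℂ .α - (qc q)⁻¹ • (ι ℂ .γ * ι ℂ .β)) 1

/-- The quantized function algebra `O_q(SU(2))`. -/
def Oq (q : Set.Ioo (0 : ℝ) 1) : Type := RingQuot (OqRel q)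

namespace Oq

variable {q : Set.Ioo (0 : ℝ) 1}

instance : Ring (Oq q) := inferInstanceAs (Ring (RingQuot (OqRel q)))
instance : Algebra ℂ (Oq q) := inferInstanceAs (Algebra ℂ (RingQuot (OqRel q)))

/-- The image of a generator. -/
def gen (x : OqGen) : Oq q := RingQuot.mkAlgHom ℂ (OqRel q) (FreeAlgebra.ι ℂ x)

/-- The generator `α`. -/
def α : Oq q := gen .α
/-- The generator `β`. -/
def β : Oq q := gen .β
/-- The generator `γ`. -/
def γ : Oq q := gen .γ
/-- The generator `δ`. -/
def δ : Oq q := gen .δ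

theorem adjoin_gen : Algebra.adjoin ℂ (Set.range (gen : OqGen → Oq q)) = ⊤ :=
  adjoin_presented (OqRel q)

theorem β_mul_α : (β : Oq q) * α = (qc q)⁻¹ • (α * β) := by
  have := RingQuot.mkAlgHom_rel ℂ (OqRel.α_β (q := q))
  rw [map_smul, map_mul, map_mul] at this
  exact (inv_smul_eq_iff₀ (qc_ne q)).2 this |>.symm

theorem γ_mul_α : (γ : Oq q) * α = (qc q)⁻¹ • (α * γ) := by
  have := RingQuot.mkAlgHom_rel ℂ (OqRel.α_γ (q := q))
  rw [map_smul, map_mul, map_mul] at this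
  exact (inv_smul_eq_iff₀ (qc_ne q)).2 this |>.symm

theorem γ_mul_β : (γ : Oq q) * β = β * γ := by
  have := RingQuot.mkAlgHom_rel ℂ (OqRel.β_γ (q := q))
  rw [map_mul, map_mul] at this
  exact this.symm

theorem δ_mul_β : (δ : Oq q) * β = (qc q)⁻¹ • (β * δ) := by
  have := RingQuot.mkAlgHom_rel ℂ (OqRel.β_δ (q := q))
  rw [map_smul, map_mul, map_mul] at this
  exact (inv_smul_eq_iff₀ (qc_ne q)).2 this |>.symm

theorem δ_mul_γ : (δ : Oq q) * γ = (qc q)⁻¹ • (γ * δ) := by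
  have := RingQuot.mkAlgHom_rel ℂ (OqRel.γ_δ (q := q))
  rw [map_smul, map_mul, map_mul] at this
  exact (inv_smul_eq_iff₀ (qc_ne q)).2 this |>.symm

theorem α_mul_δ : (α : Oq q) * δ = 1 + qc q • (β * γ) := by
  have := RingQuot.mkAlgHom_rel ℂ (OqRel.α_δ (q := q))
  rw [map_sub, map_smul, map_mul, map_mul, map_one] at this
  exact sub_eq_iff_eq_add.1 this

theorem δ_mul_α : (δ : Oq q) * α = 1 + (qc q)⁻¹ • (β * γ) := by
  have := RingQuot.mkAlgHom_rel ℂ (OqRel.δ_α (q := q))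
  rw [map_sub, map_smul, map_mul, map_mul, map_one] at this
  rw [← γ_mul_β]
  exact sub_eq_iff_eq_add.1 this

/-- The algebra homomorphism out of `O_q(SU(2))` with prescribed values on generators. -/
def lift {R : Type*} [Ring R] [Algebra ℂ R] (g : OqGen → R)
    (h₁ : g .α * g .β = qc q • (g .β * g .α)) (h₂ : g .α * g .γ = qc q • (g .γ * g .α))
    (h₃ : g .β * g .γ = g .γ * g .β) (h₄ : g .β * g .δ = qc q • (g .δ * g .β))
    (h₅ : g .γ * g .δ = qc q • (g .δ * g .γ)) (h₆ : g .α * g .δ - qc q • (g .β * g .γ) = 1)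
    (h₇ : g .δ * g .α - (qc q)⁻¹ • (g .γ * g .β) = 1) : Oq q →ₐ[ℂ] R :=
  RingQuot.liftAlgHom ℂ ⟨FreeAlgebra.lift ℂ g, by
    rintro _ _ (_ | _ | _ | _ | _ | _ | _) <;>
      simp only [map_mul, map_one, map_smul, map_sub, FreeAlgebra.lift_ι_apply] <;> assumption⟩

theorem lift_gen {R : Type*} [Ring R] [Algebra ℂ R] (g : OqGen → R)
    (h₁ : g .α * g .β = qc q • (g .β * g .α)) (h₂ : g .α * g .γ = qc q • (g .γ * g .α))
    (h₃ : g .β * g .γ = g .γ * g .β) (h₄ : g .β * g .δ = qc q • (g .δ * g .β))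
    (h₅ : g .γ * g .δ = qc q • (g .δ * g .γ)) (h₆ : g .α * g .δ - qc q • (g .β * g .γ) = 1)
    (h₇ : g .δ * g .α - (qc q)⁻¹ • (g .γ * g .β) = 1) (x : OqGen) :
    lift (q := q) g h₁ h₂ h₃ h₄ h₅ h₆ h₇ (gen x) = g x := by
  refine (RingQuot.liftAlgHom_mkAlgHom_apply ℂ _ _ _).trans ?_
  simp

/-- Induction on elements of `O_q(SU(2))` as an algebra. -/
theorem induction {p : Oq q → Prop} (ha : p α) (hb : p β) (hg : p γ) (hd : p δ)
    (hc : ∀ c : ℂ, p (algebraMap ℂ _ c)) (hadd : ∀ x y, p x → p y → p (x + y))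
    (hmul : ∀ x y, p x → p y → p (x * y)) (x : Oq q) : p x := by
  have hx : x ∈ Algebra.adjoin ℂ (Set.range gen) := adjoin_gen (q := q) ▸ Algebra.mem_top
  induction hx using Algebra.adjoin_induction with
  | mem x hx =>
    obtain ⟨_ | _ | _ | _, rfl⟩ := hx
    exacts [ha, hb, hg, hd]
  | algebraMap r => exact hc r
  | add x y _ _ hx hy => exact hadd x y hx hy
  | mul x y _ _ hx hy => exact hmul x y hx hy

theorem hom_ext {R : Type*} [Ring R] [Algebra ℂ R] {φ ψ : Oq q →ₐ[ℂ] R} (ha : φ α = ψ α)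
    (hb : φ β = ψ β) (hg : φ γ = ψ γ) (hd : φ δ = ψ δ) : φ = ψ := by
  refine AlgHom.ext_of_adjoin_eq_top adjoin_gen ?_
  rintro _ ⟨x, rfl⟩
  cases x
  exacts [ha, hb, hg, hd]

/-- Values of the coproduct on generators. -/
def comulGen : OqGen → Oq q ⊗[ℂ] Oq q
  | .α => α ⊗ₜ α + β ⊗ₜ γ
  | .β => α ⊗ₜ β + β ⊗ₜ δ
  | .γ => γ ⊗ₜ α + δ ⊗ₜ γ
  | .δ => γ ⊗ₜ β + δ ⊗ₜ δ

/-- Values of the counit on generators. -/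
def counitGen : OqGen → ℂ
  | .α => 1
  | .β => 0
  | .γ => 0
  | .δ => 1

/-- Values of the antipode on generators. -/
def antipodeGen : OqGen → Oq q
  | .α => δ
  | .β => -((qc q)⁻¹ • β)
  | .γ => -(qc q • γ)
  | .δ => α

/-- Values of the involution on generators. -/
def starGen : OqGen → Oq q
  | .α => δ
  | .β => -(qc q • γ)
  | .γ => -((qc q)⁻¹ • β)
  | .δ => α

theorem q_mul_inv : qc q * (qc q)⁻¹ = 1 := mul_inv_cancel₀ (qc_ne q)
theorem q_inv_mul : (qc q)⁻¹ * qc q = 1 := inv_mul_cancel₀ (qc_ne q)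

/-- The coproduct as an algebra homomorphism. -/
def comulHom : Oq q →ₐ[ℂ] Oq q ⊗[ℂ] Oq q := by
  refine lift comulGen ?_ ?_ ?_ ?_ ?_ ?_ ?_ <;>
  · have h := qc_ne q
    simp only [comulGen, mul_add, add_mul, Algebra.TensorProduct.tmul_mul_tmul, β_mul_α, γ_mul_α,
      γ_mul_β, δ_mul_β, δ_mul_γ, α_mul_δ, δ_mul_α, TensorProduct.add_tmul, TensorProduct.tmul_add,
      TensorProduct.tmul_smul, ← TensorProduct.smul_tmul', Algebra.TensorProduct.one_def]
    match_scalars <;> field_simp <;> ring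

/-- The counit as an algebra homomorphism. -/
def counitHom : Oq q →ₐ[ℂ] ℂ :=
  lift counitGen (by simp [counitGen]) (by simp [counitGen]) (by simp [counitGen])
    (by simp [counitGen]) (by simp [counitGen]) (by simp [counitGen]) (by simp [counitGen])

@[simp] theorem comulHom_α : comulHom (α : Oq q) = α ⊗ₜ α + β ⊗ₜ γ := lift_gen _ _ _ _ _ _ _ _ .α
@[simp] theorem comulHom_β : comulHom (β : Oq q) = α ⊗ₜ β + β ⊗ₜ δ := lift_gen _ _ _ _ _ _ _ _ .β
@[simp] theorem comulHom_γ : comulHom (γ : Oq q) = γ ⊗ₜ α + δ ⊗ₜ γ := lift_gen _ _ _ _ _ _ _ _ .γ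
@[simp] theorem comulHom_δ : comulHom (δ : Oq q) = γ ⊗ₜ β + δ ⊗ₜ δ := lift_gen _ _ _ _ _ _ _ _ .δ
@[simp] theorem counitHom_α : counitHom (α : Oq q) = 1 := lift_gen _ _ _ _ _ _ _ _ .α
@[simp] theorem counitHom_β : counitHom (β : Oq q) = 0 := lift_gen _ _ _ _ _ _ _ _ .β
@[simp] theorem counitHom_γ : counitHom (γ : Oq q) = 0 := lift_gen _ _ _ _ _ _ _ _ .γ
@[simp] theorem counitHom_δ : counitHom (δ : Oq q) = 1 := lift_gen _ _ _ _ _ _ _ _ .δ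

instance : Bialgebra ℂ (Oq q) :=
  Bialgebra.ofAlgHom comulHom counitHom
    (by
      apply hom_ext <;> simp [TensorProduct.add_tmul, TensorProduct.tmul_add] <;> abel)
    (by apply hom_ext <;> simp)
    (by apply hom_ext <;> simp)

@[simp] theorem comul_α : comul (R := ℂ) (α : Oq q) = α ⊗ₜ α + β ⊗ₜ γ := comulHom_α
@[simp] theorem comul_β : comul (R := ℂ) (β : Oq q) = α ⊗ₜ β + β ⊗ₜ δ := comulHom_β
@[simp] theorem comul_γ : comul (R := ℂ) (γ : Oq q) = γ ⊗ₜ α + δ ⊗ₜ γ := comulHom_γ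
@[simp] theorem comul_δ : comul (R := ℂ) (δ : Oq q) = γ ⊗ₜ β + δ ⊗ₜ δ := comulHom_δ
@[simp] theorem counit_α : counit (R := ℂ) (α : Oq q) = 1 := counitHom_α
@[simp] theorem counit_β : counit (R := ℂ) (β : Oq q) = 0 := counitHom_β
@[simp] theorem counit_γ : counit (R := ℂ) (γ : Oq q) = 0 := counitHom_γ
@[simp] theorem counit_δ : counit (R := ℂ) (δ : Oq q) = 1 := counitHom_δ

/-- The antipode as an algebra homomorphism into the opposite algebra. -/
def antipodeHom : Oq q →ₐ[ℂ] (Oq q)ᵐᵒᵖ := by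
  refine lift (fun x => MulOpposite.op (antipodeGen x)) ?_ ?_ ?_ ?_ ?_ ?_ ?_ <;>
  · have h := qc_ne q
    apply MulOpposite.unop_injective
    simp only [antipodeGen, MulOpposite.unop_mul, MulOpposite.unop_op, MulOpposite.unop_smul,
      MulOpposite.unop_sub, MulOpposite.unop_one, neg_mul, mul_neg, smul_mul_assoc, mul_smul_comm,
      β_mul_α, γ_mul_α, γ_mul_β, δ_mul_β, δ_mul_γ, α_mul_δ, δ_mul_α]
    match_scalars <;> field_simp <;> ring

@[simp] theorem antipodeHom_α : antipodeHom (α : Oq q) = MulOpposite.op δ :=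
  lift_gen _ _ _ _ _ _ _ _ .α
@[simp] theorem antipodeHom_β : antipodeHom (β : Oq q) = MulOpposite.op (-((qc q)⁻¹ • β)) :=
  lift_gen _ _ _ _ _ _ _ _ .β
@[simp] theorem antipodeHom_γ : antipodeHom (γ : Oq q) = MulOpposite.op (-(qc q • γ)) :=
  lift_gen _ _ _ _ _ _ _ _ .γ
@[simp] theorem antipodeHom_δ : antipodeHom (δ : Oq q) = MulOpposite.op α :=
  lift_gen _ _ _ _ _ _ _ _ .δ

instance : HopfAlgebra ℂ (Oq q) :=
  hopfOf antipodeHom (Set.range gen) adjoin_gen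
    (by
      rintro _ ⟨_ | _ | _ | _, rfl⟩
      · rw [show (gen .α : Oq q) = α from rfl, comul_α, counit_α]
        simp [δ_mul_α]
      · rw [show (gen .β : Oq q) = β from rfl, comul_β, counit_β]
        simp [δ_mul_β]
      · rw [show (gen .γ : Oq q) = γ from rfl, comul_γ, counit_γ]
        simp [γ_mul_α, smul_smul, q_mul_inv]
      · rw [show (gen .δ : Oq q) = δ from rfl, comul_δ, counit_δ]
        simp [α_mul_δ, γ_mul_β])
    (by
      rintro _ ⟨_ | _ | _ | _, rfl⟩
      · rw [show (gen .α : Oq q) = α from rfl, comul_α, counit_α]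
        simp [α_mul_δ]
      · rw [show (gen .β : Oq q) = β from rfl, comul_β, counit_β]
        simp [β_mul_α]
      · rw [show (gen .γ : Oq q) = γ from rfl, comul_γ, counit_γ]
        simp [δ_mul_γ, smul_smul, q_mul_inv]
      · rw [show (gen .δ : Oq q) = δ from rfl, comul_δ, counit_δ]
        simp [δ_mul_α, γ_mul_β])

@[simp] theorem antipode_α : antipode ℂ (α : Oq q) = δ :=
  MulOpposite.op_injective antipodeHom_α
@[simp] theorem antipode_β : antipode ℂ (β : Oq q) = -((qc q)⁻¹ • β) :=
  MulOpposite.op_injective antipodeHom_β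
@[simp] theorem antipode_γ : antipode ℂ (γ : Oq q) = -(qc q • γ) :=
  MulOpposite.op_injective antipodeHom_γ
@[simp] theorem antipode_δ : antipode ℂ (δ : Oq q) = α :=
  MulOpposite.op_injective antipodeHom_δ

/-- The involution as a conjugate-linear anti-homomorphism. -/
def starHom : Oq q →ₐ[ℂ] ConjOp (Oq q) := by
  refine lift (fun x => toConjOp (starGen x)) ?_ ?_ ?_ ?_ ?_ ?_ ?_ <;>
  · have h := qc_ne q
    apply toConjOp.symm.injective
    have h1 : toConjOp.symm (1 : ConjOp (Oq q)) = 1 := rfl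
    simp only [h1, starGen, symm_mul, symm_smul, map_sub, AddEquiv.symm_apply_apply, neg_mul,
      mul_neg, smul_mul_assoc, mul_smul_comm, map_inv₀, conj_qc,
      β_mul_α, γ_mul_α, γ_mul_β, δ_mul_β, δ_mul_γ, α_mul_δ, δ_mul_α]
    match_scalars <;> field_simp <;> ring

@[simp] theorem starHom_α : starHom (α : Oq q) = toConjOp δ := lift_gen _ _ _ _ _ _ _ _ .α
@[simp] theorem starHom_β : starHom (β : Oq q) = toConjOp (-(qc q • γ)) :=
  lift_gen _ _ _ _ _ _ _ _ .β
@[simp] theorem starHom_γ : starHom (γ : Oq q) = toConjOp (-((qc q)⁻¹ • β)) :=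
  lift_gen _ _ _ _ _ _ _ _ .γ
@[simp] theorem starHom_δ : starHom (δ : Oq q) = toConjOp α := lift_gen _ _ _ _ _ _ _ _ .δ

theorem starHom_invol : ∀ x ∈ Set.range (gen : OqGen → Oq q),
    toConjOp.symm (starHom (toConjOp.symm (starHom x))) = x := by
  rintro _ ⟨_ | _ | _ | _, rfl⟩
  · change toConjOp.symm (starHom (toConjOp.symm (starHom α))) = α
    simp
  · change toConjOp.symm (starHom (toConjOp.symm (starHom β))) = β
    simp [symm_smul, smul_smul, qc_ne]
  · change toConjOp.symm (starHom (toConjOp.symm (starHom γ))) = γ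
    simp [symm_smul, smul_smul, qc_ne]
  · change toConjOp.symm (starHom (toConjOp.symm (starHom δ))) = δ
    simp

instance : StarRing (Oq q) := starRingOf starHom (Set.range gen) adjoin_gen starHom_invol

instance : StarModule ℂ (Oq q) := starModuleOf starHom (Set.range gen) adjoin_gen starHom_invol

theorem star_def (x : Oq q) : star x = toConjOp.symm (starHom x) := rfl

@[simp] theorem star_α : star (α : Oq q) = δ := by simp [star_def]
@[simp] theorem star_β : star (β : Oq q) = -(qc q • γ) := by simp [star_def]
@[simp] theorem star_γ : star (γ : Oq q) = -((qc q)⁻¹ • β) := by simp [star_def]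
@[simp] theorem star_δ : star (δ : Oq q) = α := by simp [star_def]

instance : HopfStarAlgebra (Oq q) where
  comul_star x := by
    induction x using Oq.induction with
    | ha => simp [TensorProduct.star_tmul, ← TensorProduct.smul_tmul', TensorProduct.neg_tmul,
        TensorProduct.tmul_neg, smul_smul, add_comm, qc_ne]
    | hb => simp [TensorProduct.star_tmul, ← TensorProduct.smul_tmul', TensorProduct.neg_tmul,
        TensorProduct.tmul_neg, add_comm]
    | hg => simp [TensorProduct.star_tmul, ← TensorProduct.smul_tmul', TensorProduct.neg_tmul,
        TensorProduct.tmul_neg, add_comm]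
    | hd => simp [TensorProduct.star_tmul, ← TensorProduct.smul_tmul', TensorProduct.neg_tmul,
        TensorProduct.tmul_neg, smul_smul, add_comm, qc_ne]
    | hc c => simp [← algebraMap_star_comm, Algebra.TensorProduct.algebraMap_apply]
    | hadd x y hx hy => simp [hx, hy]
    | hmul x y hx hy => simp [Bialgebra.comul_mul, hx, hy]
  counit_star x := by
    induction x using Oq.induction with
    | ha => simp
    | hb => simp
    | hg => simp
    | hd => simp
    | hc c => simp [← algebraMap_star_comm]
    | hadd x y hx hy => simp [hx, hy]
    | hmul x y hx hy => simp [hx, hy, mul_comm]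

end Oq
end Oq

section Double

open Coalgebra HopfAlgebra

variable {A U : Type*} [Ring A] [HopfAlgebra ℂ A] [StarRing A]
  [Ring U] [HopfAlgebra ℂ U] [StarRing U]

/-- The pairing `(a ⊗ b, h ⊗ k) ↦ τ(a, h) τ(b, k)` of `A ⊗ A` and `U ⊗ U`. -/
def tensorPairing (τ : A →ₗ[ℂ] U →ₗ[ℂ] ℂ) : A ⊗[ℂ] A →ₗ[ℂ] U ⊗[ℂ] U →ₗ[ℂ] ℂ :=
  TensorProduct.dualDistrib ℂ U U ∘ₗ TensorProduct.map τ τ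

variable (A U) in
/-- A unitary pairing of two Hopf `*`-algebras. -/
structure UnitaryPairing where
  /-- The underlying bilinear form. -/
  τ : A →ₗ[ℂ] U →ₗ[ℂ] ℂ
  apply_mul : ∀ (a : A) (h k : U), τ a (h * k) = tensorPairing τ (comul a) (h ⊗ₜ k)
  mul_apply : ∀ (a b : A) (h : U), τ (a * b) h = tensorPairing τ (a ⊗ₜ b) (comul h)
  one_apply : ∀ h : U, τ 1 h = counit h
  apply_one : ∀ a : A, τ a 1 = counit a
  star_apply : ∀ (a : A) (h : U), τ (star a) h = conj (τ a (star (antipode ℂ h)))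
  apply_star : ∀ (a : A) (h : U), τ a (star h) = conj (τ (star (antipode ℂ a)) h)

/-- The iterated coproduct `a ↦ a₍₁₎ ⊗ a₍₂₎ ⊗ a₍₃₎`. -/
def comul₃ {H : Type*} [Ring H] [Bialgebra ℂ H] (a : H) : H ⊗[ℂ] (H ⊗[ℂ] H) :=
  (comul (R := ℂ) (A := H)).lTensor H (comul a)

theorem comul₃_star {H : Type*} [Ring H] [HopfAlgebra ℂ H] [StarRing H] [StarModule ℂ H]
    [HopfStarAlgebra H] (a : H) : comul₃ (star a) = star (comul₃ a) := by
  have key : ∀ x : H ⊗[ℂ] H, (comul (R := ℂ) (A := H)).lTensor H (star x) =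
      star ((comul (R := ℂ) (A := H)).lTensor H x) := fun x => by
    induction x with
    | zero => simp
    | tmul x y => simp [TensorProduct.star_tmul, HopfStarAlgebra.comul_star]
    | add x y hx hy => simp [hx, hy]
  rw [comul₃, comul₃, HopfStarAlgebra.comul_star, key]

/-- The defining relations of the Drinfeld double, on the free algebra on the disjoint union of
`A` and `U`: the inclusions of `A` and `U` are algebra homomorphisms, and the interchange relations
`h a = τ(a₍₃₎, h₍₁₎) a₍₂₎ h₍₂₎ τ(a₍₁₎, S⁻¹(h₍₃₎))` and
`a h = τ(S⁻¹(a₍₃₎), h₍₁₎) h₍₂₎ a₍₂₎ τ(a₍₁₎, h₍₃₎)` hold, for any way of writing the iterated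
coproducts of `a` and `h` as finite sums of elementary tensors. -/
inductive DoubleRel (P : UnitaryPairing A U) :
    FreeAlgebra ℂ (A ⊕ U) → FreeAlgebra ℂ (A ⊕ U) → Prop
  | left_add (a b : A) : DoubleRel P (FreeAlgebra.ι ℂ (.inl (a + b)))
      (FreeAlgebra.ι ℂ (.inl a) + FreeAlgebra.ι ℂ (.inl b))
  | left_smul (c : ℂ) (a : A) : DoubleRel P (FreeAlgebra.ι ℂ (.inl (c • a)))
      (c • FreeAlgebra.ι ℂ (.inl a))
  | left_mul (a b : A) : DoubleRel P (FreeAlgebra.ι ℂ (.inl (a * b)))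
      (FreeAlgebra.ι ℂ (.inl a) * FreeAlgebra.ι ℂ (.inl b))
  | left_one : DoubleRel P (FreeAlgebra.ι ℂ (.inl 1)) 1
  | right_add (h k : U) : DoubleRel P (FreeAlgebra.ι ℂ (.inr (h + k)))
      (FreeAlgebra.ι ℂ (.inr h) + FreeAlgebra.ι ℂ (.inr k))
  | right_smul (c : ℂ) (h : U) : DoubleRel P (FreeAlgebra.ι ℂ (.inr (c • h)))
      (c • FreeAlgebra.ι ℂ (.inr h))
  | right_mul (h k : U) : DoubleRel P (FreeAlgebra.ι ℂ (.inr (h * k)))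
      (FreeAlgebra.ι ℂ (.inr h) * FreeAlgebra.ι ℂ (.inr k))
  | right_one : DoubleRel P (FreeAlgebra.ι ℂ (.inr 1)) 1
  | right_left (a : A) (h : U) {m n : ℕ} (a₁ a₂ a₃ : Fin m → A) (h₁ h₂ h₃ : Fin n → U)
      (ha : comul₃ a = ∑ i, a₁ i ⊗ₜ (a₂ i ⊗ₜ a₃ i)) (hh : comul₃ h = ∑ j, h₁ j ⊗ₜ (h₂ j ⊗ₜ h₃ j)) :
      DoubleRel P (FreeAlgebra.ι ℂ (.inr h) * FreeAlgebra.ι ℂ (.inl a))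
        (∑ i, ∑ j, (P.τ (a₃ i) (h₁ j) * P.τ (a₁ i) (antipodeInv (h₃ j))) •
          (FreeAlgebra.ι ℂ (.inl (a₂ i)) * FreeAlgebra.ι ℂ (.inr (h₂ j))))
  | left_right (a : A) (h : U) {m n : ℕ} (a₁ a₂ a₃ : Fin m → A) (h₁ h₂ h₃ : Fin n → U)
      (ha : comul₃ a = ∑ i, a₁ i ⊗ₜ (a₂ i ⊗ₜ a₃ i)) (hh : comul₃ h = ∑ j, h₁ j ⊗ₜ (h₂ j ⊗ₜ h₃ j)) :
      DoubleRel P (FreeAlgebra.ι ℂ (.inl a) * FreeAlgebra.ι ℂ (.inr h))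
        (∑ i, ∑ j, (P.τ (antipodeInv (a₃ i)) (h₁ j) * P.τ (a₁ i) (h₃ j)) •
          (FreeAlgebra.ι ℂ (.inr (h₂ j)) * FreeAlgebra.ι ℂ (.inl (a₂ i))))

/-- The Drinfeld double `D(A, U)` of two paired Hopf `*`-algebras. -/
def DrinfeldDouble (P : UnitaryPairing A U) : Type _ := RingQuot (DoubleRel P)

namespace DrinfeldDouble

variable (P : UnitaryPairing A U)

instance : Ring (DrinfeldDouble P) := inferInstanceAs (Ring (RingQuot (DoubleRel P)))
instance : Algebra ℂ (DrinfeldDouble P) := inferInstanceAs (Algebra ℂ (RingQuot (DoubleRel P)))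

/-- The image of a generator. -/
def gen (x : A ⊕ U) : DrinfeldDouble P :=
  RingQuot.mkAlgHom ℂ (DoubleRel P) (FreeAlgebra.ι ℂ x)

theorem adjoin_gen : Algebra.adjoin ℂ (Set.range (gen P)) = ⊤ := adjoin_presented (DoubleRel P)

/-- The canonical homomorphism `A → D(A, U)`. -/
def inA : A →ₐ[ℂ] DrinfeldDouble P :=
  AlgHom.ofLinearMap
    { toFun := fun a => gen P (.inl a)
      map_add' := fun a b => by
        have := RingQuot.mkAlgHom_rel ℂ (DoubleRel.left_add (P := P) a b)
        rw [map_add] at this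
        exact this
      map_smul' := fun c a => by
        have := RingQuot.mkAlgHom_rel ℂ (DoubleRel.left_smul (P := P) c a)
        rw [map_smul] at this
        exact this }
    (by
      have := RingQuot.mkAlgHom_rel ℂ (DoubleRel.left_one (P := P))
      rw [map_one] at this
      exact this)
    (fun a b => by
      have := RingQuot.mkAlgHom_rel ℂ (DoubleRel.left_mul (P := P) a b)
      rw [map_mul] at this
      exact this)

/-- The canonical homomorphism `U → D(A, U)`. -/
def inU : U →ₐ[ℂ] DrinfeldDouble P :=
  AlgHom.ofLinearMap
    { toFun := fun h => gen P (.inr h)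
      map_add' := fun a b => by
        have := RingQuot.mkAlgHom_rel ℂ (DoubleRel.right_add (P := P) a b)
        rw [map_add] at this
        exact this
      map_smul' := fun c a => by
        have := RingQuot.mkAlgHom_rel ℂ (DoubleRel.right_smul (P := P) c a)
        rw [map_smul] at this
        exact this }
    (by
      have := RingQuot.mkAlgHom_rel ℂ (DoubleRel.right_one (P := P))
      rw [map_one] at this
      exact this)
    (fun a b => by
      have := RingQuot.mkAlgHom_rel ℂ (DoubleRel.right_mul (P := P) a b)
      rw [map_mul] at this
      exact this)

theorem inU_mul_inA (a : A) (h : U) {m n : ℕ} (a₁ a₂ a₃ : Fin m → A) (h₁ h₂ h₃ : Fin n → U)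
    (ha : comul₃ a = ∑ i, a₁ i ⊗ₜ (a₂ i ⊗ₜ a₃ i)) (hh : comul₃ h = ∑ j, h₁ j ⊗ₜ (h₂ j ⊗ₜ h₃ j)) :
    inU P h * inA P a = ∑ i, ∑ j, (P.τ (a₃ i) (h₁ j) * P.τ (a₁ i) (antipodeInv (h₃ j))) •
      (inA P (a₂ i) * inU P (h₂ j)) := by
  have := RingQuot.mkAlgHom_rel ℂ (DoubleRel.right_left (P := P) a h a₁ a₂ a₃ h₁ h₂ h₃ ha hh)
  simp only [map_mul, map_sum, map_smul] at this
  exact this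

theorem inA_mul_inU (a : A) (h : U) {m n : ℕ} (a₁ a₂ a₃ : Fin m → A) (h₁ h₂ h₃ : Fin n → U)
    (ha : comul₃ a = ∑ i, a₁ i ⊗ₜ (a₂ i ⊗ₜ a₃ i)) (hh : comul₃ h = ∑ j, h₁ j ⊗ₜ (h₂ j ⊗ₜ h₃ j)) :
    inA P a * inU P h = ∑ i, ∑ j, (P.τ (antipodeInv (a₃ i)) (h₁ j) * P.τ (a₁ i) (h₃ j)) •
      (inU P (h₂ j) * inA P (a₂ i)) := by
  have := RingQuot.mkAlgHom_rel ℂ (DoubleRel.left_right (P := P) a h a₁ a₂ a₃ h₁ h₂ h₃ ha hh)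
  simp only [map_mul, map_sum, map_smul] at this
  exact this

variable [StarModule ℂ A] [HopfStarAlgebra A] [StarModule ℂ U] [HopfStarAlgebra U]

/-- The involution of the double, extending those of `A` and `U`, as a conjugate-linear
anti-homomorphism. -/
def starHom : DrinfeldDouble P →ₐ[ℂ] ConjOp (DrinfeldDouble P) :=
  RingQuot.liftAlgHom ℂ ⟨FreeAlgebra.lift ℂ (Sum.elim (fun a => toConjOp (inA P (star a)))
      (fun h => toConjOp (inU P (star h)))), by
    rintro _ _ (_ | _ | _ | _ | _ | _ | _ | _ | ⟨a, h, a₁, a₂, a₃, h₁, h₂, h₃, ha, hh⟩ |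
      ⟨a, h, a₁, a₂, a₃, h₁, h₂, h₃, ha, hh⟩)
    · simp
    · simp [toConjOp_smul]
    · simp [toConjOp_mul]
    · simp [toConjOp_one]
    · simp
    · simp [toConjOp_smul]
    · simp [toConjOp_mul]
    · simp [toConjOp_one]
    · have := inA_mul_inU P (star a) (star h) (star a₁) (star a₂) (star a₃) (star h₁) (star h₂)
        (star h₃) (by rw [comul₃_star, ha]; simp [TensorProduct.star_tmul])
        (by rw [comul₃_star, hh]; simp [TensorProduct.star_tmul])
      simp only [map_mul, map_sum, map_smul, FreeAlgebra.lift_ι_apply, Sum.elim_inl, Sum.elim_inr,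
        ← toConjOp_mul]
      rw [this]
      simp only [map_sum, toConjOp_smul, map_mul, Pi.star_apply]
      refine Finset.sum_congr rfl fun i _ => Finset.sum_congr rfl fun j _ => ?_
      congr 2
      · rw [P.apply_star, antipode_antipodeInv, star_star, Complex.conj_conj]
      · rw [P.star_apply, Complex.conj_conj, antipodeInv]
    · have := inU_mul_inA P (star a) (star h) (star a₁) (star a₂) (star a₃) (star h₁) (star h₂)
        (star h₃) (by rw [comul₃_star, ha]; simp [TensorProduct.star_tmul])
        (by rw [comul₃_star, hh]; simp [TensorProduct.star_tmul])
      simp only [map_mul, map_sum, map_smul, FreeAlgebra.lift_ι_apply, Sum.elim_inl, Sum.elim_inr,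
        ← toConjOp_mul]
      rw [this]
      simp only [map_sum, toConjOp_smul, map_mul, Pi.star_apply]
      refine Finset.sum_congr rfl fun i _ => Finset.sum_congr rfl fun j _ => ?_
      congr 2
      · rw [P.apply_star, Complex.conj_conj, antipodeInv]
      · rw [P.star_apply, antipode_antipodeInv, star_star, Complex.conj_conj]⟩

theorem starHom_inA (a : A) : starHom P (inA P a) = toConjOp (inA P (star a)) := by
  refine (RingQuot.liftAlgHom_mkAlgHom_apply ℂ _ _ _).trans ?_
  simp

theorem starHom_inU (h : U) : starHom P (inU P h) = toConjOp (inU P (star h)) := by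
  refine (RingQuot.liftAlgHom_mkAlgHom_apply ℂ _ _ _).trans ?_
  simp

theorem starHom_invol : ∀ x ∈ Set.range (gen P),
    toConjOp.symm (starHom P (toConjOp.symm (starHom P x))) = x := by
  rintro _ ⟨a | h, rfl⟩
  · change toConjOp.symm (starHom P (toConjOp.symm (starHom P (inA P a)))) = inA P a
    simp [starHom_inA]
  · change toConjOp.symm (starHom P (toConjOp.symm (starHom P (inU P h)))) = inU P h
    simp [starHom_inU]

instance : StarRing (DrinfeldDouble P) :=
  starRingOf (starHom P) (Set.range (gen P)) (adjoin_gen P) (starHom_invol P)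

instance : StarModule ℂ (DrinfeldDouble P) :=
  starModuleOf (starHom P) (Set.range (gen P)) (adjoin_gen P) (starHom_invol P)

theorem star_inA (a : A) : star (inA P a) = inA P (star a) :=
  congrArg toConjOp.symm (starHom_inA P a)

theorem star_inU (h : U) : star (inU P h) = inU P (star h) :=
  congrArg toConjOp.symm (starHom_inU P h)

/-- The Drinfeld double `D(J, I)` of coideals: the unital `*`-subalgebra of `D(A, U)` generated by
`J ⊆ A` and `I ⊆ U`. -/
def coidealDouble (J : StarSubalgebra ℂ A) (I : StarSubalgebra ℂ U) :
    StarSubalgebra ℂ (DrinfeldDouble P) :=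
  StarAlgebra.adjoin ℂ (inA P '' J ∪ inU P '' I)

end DrinfeldDouble

end Double

section Pairing

open Coalgebra HopfAlgebra

namespace Uq

variable {q : Set.Ioo (0 : ℝ) 1}

/-- Values of the spin `1/2` representation on generators. -/
def spinGen (q : Set.Ioo (0 : ℝ) 1) : UqGen → Matrix (Fin 2) (Fin 2) ℂ
  | .e => !![0, qs q; 0, 0]
  | .f => !![0, 0; (qs q)⁻¹, 0]
  | .k => !![qc q, 0; 0, (qc q)⁻¹]
  | .kinv => !![(qc q)⁻¹, 0; 0, qc q]

theorem qc_sq_sub_ne : qc q ^ 2 - 1 ≠ 0 := fun h0 => by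
  have h := qc_ne q
  refine qc_sub_ne q ?_
  field_simp
  simpa using h0

/-- The spin `1/2` representation of `U_q(su(2))`. -/
def spin : Uq q →ₐ[ℂ] Matrix (Fin 2) (Fin 2) ℂ :=
  lift (spinGen q)
    (by ext i j; fin_cases i <;> fin_cases j <;> simp [spinGen, Matrix.mul_apply, qc_ne q])
    (by ext i j; fin_cases i <;> fin_cases j <;> simp [spinGen, Matrix.mul_apply, qc_ne q])
    (by
      have h := qc_ne q
      ext i j; fin_cases i <;> fin_cases j <;> simp [spinGen, Matrix.mul_apply]
      field_simp)
    (by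
      have h := qc_ne q
      ext i j; fin_cases i <;> fin_cases j <;> simp [spinGen, Matrix.mul_apply]
      field_simp)
    (by
      have h := qc_ne q
      have h' := qs_ne q
      have h'' := qc_sq_sub_ne (q := q)
      ext i j
      fin_cases i <;> fin_cases j <;> simp [spinGen, h'] <;> field_simp
      ring)

@[simp] theorem spin_e : spin (e : Uq q) = !![0, qs q; 0, 0] := lift_gen _ _ _ _ _ _ .e
@[simp] theorem spin_f : spin (f : Uq q) = !![0, 0; (qs q)⁻¹, 0] := lift_gen _ _ _ _ _ _ .f
@[simp] theorem spin_k : spin (k : Uq q) = !![qc q, 0; 0, (qc q)⁻¹] := lift_gen _ _ _ _ _ _ .k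
@[simp] theorem spin_kinv : spin (kinv : Uq q) = !![(qc q)⁻¹, 0; 0, qc q] :=
  lift_gen _ _ _ _ _ _ .kinv

/-- The matrix coefficients of the spin `1/2` representation. -/
def coeff (i j : Fin 2) : Uq q →ₗ[ℂ] ℂ where
  toFun h := spin h i j
  map_add' := by simp
  map_smul' := by simp

theorem coeff_apply (i j : Fin 2) (h : Uq q) : coeff i j h = spin h i j := rfl

theorem coeff_mul (i j : Fin 2) (h h' : Uq q) :
    coeff i j (h * h') = coeff i 0 h * coeff 0 j h' + coeff i 1 h * coeff 1 j h' := by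
  simp [coeff_apply, Matrix.mul_apply]

theorem coeff_one (i j : Fin 2) : coeff i j (1 : Uq q) = if i = j then 1 else 0 := by
  simp [coeff_apply, Matrix.one_apply]

/-- The product of two matrix coefficients in the dual algebra. -/
def coeff₂ (i j k l : Fin 2) : Uq q →ₗ[ℂ] ℂ :=
  TensorProduct.dualDistrib ℂ (Uq q) (Uq q) (coeff i j ⊗ₜ coeff k l) ∘ₗ comul

theorem coeff₂_mul (i j k l : Fin 2) (h h' : Uq q) :
    coeff₂ i j k l (h * h') = ∑ p, ∑ r, coeff₂ i p k r h * coeff₂ p j r l h' := by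
  have key : ∀ x y : Uq q ⊗[ℂ] Uq q,
      TensorProduct.dualDistrib ℂ (Uq q) (Uq q) (coeff i j ⊗ₜ coeff k l) (x * y) =
      ∑ p, ∑ r, TensorProduct.dualDistrib ℂ (Uq q) (Uq q) (coeff i p ⊗ₜ coeff k r) x *
        TensorProduct.dualDistrib ℂ (Uq q) (Uq q) (coeff p j ⊗ₜ coeff r l) y := by
    intro x y
    induction x with
    | zero => simp
    | add x x' hx hx' => simp only [add_mul, map_add, hx, hx', Finset.sum_add_distrib]
    | tmul a b =>
      induction y with
      | zero => simp
      | add x x' hx hx' => simp only [mul_add, map_add, hx, hx', Finset.sum_add_distrib]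
      | tmul c d =>
        simp only [Algebra.TensorProduct.tmul_mul_tmul, TensorProduct.dualDistrib_apply, coeff_mul,
          Fin.sum_univ_two]
        ring
  simp only [coeff₂, LinearMap.comp_apply, Bialgebra.comul_mul, key]

theorem coeff₂_algebraMap (i j k l : Fin 2) (c : ℂ) :
    coeff₂ i j k l (algebraMap ℂ (Uq q) c) =
      c * ((if i = j then 1 else 0) * (if k = l then 1 else 0)) := by
  rw [Algebra.algebraMap_eq_smul_one, map_smul]
  simp [coeff₂, Algebra.TensorProduct.one_def, coeff_one]

/-- The vector `ξ₀ ⊗ ξ₁ - q ξ₁ ⊗ ξ₀`, which is invariant in the tensor square of the spin `1/2`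
representation. -/
def inv₂ (q : Set.Ioo (0 : ℝ) 1) (i k : Fin 2) : ℂ := !![0, 1; -qc q, 0] i k

theorem coeff₂_col (h : Uq q) : ∀ i k : Fin 2,
    coeff₂ i 0 k 1 h - qc q * coeff₂ i 1 k 0 h = counit (R := ℂ) h * inv₂ q i k := by
  have h0 := qc_ne q
  have h1 := qs_ne q
  have h2 := qs_sq q
  induction h using Uq.induction with
  | he =>
    intro i k; fin_cases i <;> fin_cases k <;> simp [coeff₂, coeff_apply, inv₂, h0]
  | hf =>
    intro i k; fin_cases i <;> fin_cases k <;> simp [coeff₂, coeff_apply, inv₂, h0, mul_comm]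
  | hk =>
    intro i k; fin_cases i <;> fin_cases k <;> simp [coeff₂, coeff_apply, inv₂, h0]
  | hi =>
    intro i k; fin_cases i <;> fin_cases k <;> simp [coeff₂, coeff_apply, inv₂, h0]
  | hc c =>
    intro i k; fin_cases i <;> fin_cases k <;>
      simp [coeff₂_algebraMap, inv₂, Bialgebra.counit_algebraMap, mul_comm]
  | ha x y hx hy =>
    intro i k
    simp only [map_add]
    linear_combination hx i k + hy i k
  | hm x y hx hy =>
    intro i k
    simp only [coeff₂_mul, Fin.sum_univ_two, Bialgebra.counit_mul]
    have h00 := hy 0 0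
    have h01 := hy 0 1
    have h10 := hy 1 0
    have h11 := hy 1 1
    have hh := hx i k
    simp [inv₂] at h00 h01 h10 h11
    linear_combination coeff₂ i 0 k 0 x * h00 + coeff₂ i 0 k 1 x * h01 + coeff₂ i 1 k 0 x * h10 +
      coeff₂ i 1 k 1 x * h11 + counit (R := ℂ) y * hh

theorem coeff₂_row (h : Uq q) : ∀ j l : Fin 2,
    coeff₂ 0 j 1 l h - qc q * coeff₂ 1 j 0 l h = counit (R := ℂ) h * inv₂ q j l := by
  have h0 := qc_ne q
  have h1 := qs_ne q
  have h2 := qs_sq q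
  induction h using Uq.induction with
  | he =>
    intro i k; fin_cases i <;> fin_cases k <;> simp [coeff₂, coeff_apply, inv₂, h0]
  | hf =>
    intro i k; fin_cases i <;> fin_cases k <;> simp [coeff₂, coeff_apply, inv₂, h0]
    field_simp; simp
  | hk =>
    intro i k; fin_cases i <;> fin_cases k <;> simp [coeff₂, coeff_apply, inv₂, h0]
  | hi =>
    intro i k; fin_cases i <;> fin_cases k <;> simp [coeff₂, coeff_apply, inv₂, h0]
  | hc c =>
    intro i k; fin_cases i <;> fin_cases k <;>
      simp [coeff₂_algebraMap, inv₂, Bialgebra.counit_algebraMap, mul_comm]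
  | ha x y hx hy =>
    intro i k
    simp only [map_add]
    linear_combination hx i k + hy i k
  | hm x y hx hy =>
    intro i k
    simp only [coeff₂_mul, Fin.sum_univ_two, Bialgebra.counit_mul]
    have h00 := hx 0 0
    have h01 := hx 0 1
    have h10 := hx 1 0
    have h11 := hx 1 1
    have hh := hy i k
    simp [inv₂] at h00 h01 h10 h11
    linear_combination coeff₂ 0 i 0 k y * h00 + coeff₂ 0 i 1 k y * h01 + coeff₂ 1 i 0 k y * h10 +
      coeff₂ 1 i 1 k y * h11 + counit (R := ℂ) x * hh

/-- The matrix of the antipode: `π(S(h)) = (π₁₁, -q⁻¹ π₀₁; -q π₁₀, π₀₀)(h)`. -/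
theorem spin_antipode (h : Uq q) : spin (antipode ℂ h) =
    !![spin h 1 1, -((qc q)⁻¹ * spin h 0 1); -(qc q * spin h 1 0), spin h 0 0] := by
  have h0 := qc_ne q
  induction h using Uq.induction with
  | he => ext i j; fin_cases i <;> fin_cases j <;> simp
  | hf => ext i j; fin_cases i <;> fin_cases j <;> simp [mul_comm]
  | hk => ext i j; fin_cases i <;> fin_cases j <;> simp
  | hi => ext i j; fin_cases i <;> fin_cases j <;> simp
  | hc c =>
    rw [Algebra.algebraMap_eq_smul_one, map_smul, antipode_one]
    ext i j; fin_cases i <;> fin_cases j <;> simp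
  | ha x y hx hy =>
    rw [map_add, map_add, hx, hy, map_add]
    ext i j; fin_cases i <;> fin_cases j <;> simp <;> ring
  | hm x y hx hy =>
    rw [HopfAlgebra.antipode_mul_antidistrib, map_mul, map_mul, hx, hy]
    ext i j; fin_cases i <;> fin_cases j <;> simp [Matrix.mul_apply] <;> field_simp <;> ring

theorem spin_star (h : Uq q) : spin (star h) = (spin h).conjTranspose := by
  have h0 := qc_ne q
  have h1 := qs_ne q
  have h2 := qs_sq q
  have c1 : (starRingEnd ℂ) (qc q) = qc q := conj_qc q
  have c2 : (starRingEnd ℂ) (qs q) = qs q := conj_qs q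
  induction h using Uq.induction with
  | he =>
    ext i j; fin_cases i <;> fin_cases j <;>
      simp [Matrix.mul_apply, Matrix.conjTranspose_apply] <;> field_simp <;> simp [← h2, pow_two]
  | hf =>
    ext i j; fin_cases i <;> fin_cases j <;>
      simp [Matrix.mul_apply, Matrix.conjTranspose_apply] <;> field_simp <;> simp [← h2, pow_two]
  | hk => ext i j; fin_cases i <;> fin_cases j <;> simp [Matrix.conjTranspose_apply]
  | hi => ext i j; fin_cases i <;> fin_cases j <;> simp [Matrix.conjTranspose_apply]
  | hc c =>
    rw [← algebraMap_star_comm, AlgHom.commutes, AlgHom.commutes, Algebra.algebraMap_eq_smul_one,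
      Algebra.algebraMap_eq_smul_one, Matrix.conjTranspose_smul, Matrix.conjTranspose_one]
  | ha x y hx hy => rw [star_add, map_add, map_add, hx, hy, Matrix.conjTranspose_add]
  | hm x y hx hy => rw [star_mul, map_mul, map_mul, hx, hy, Matrix.conjTranspose_mul]

/-- The antipode reverses the coproduct. -/
theorem comul_antipode (h : Uq q) : comul (R := ℂ) (antipode ℂ h) =
    TensorProduct.comm ℂ (Uq q) (Uq q)
      (TensorProduct.map (antipode ℂ) (antipode ℂ) (comul (R := ℂ) h)) := by
  induction h using Uq.induction with
  | he =>
    simp [Bialgebra.comul_mul, mul_add, kinv_mul_k, TensorProduct.neg_tmul, TensorProduct.tmul_neg,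
      add_comm]
  | hf =>
    simp [Bialgebra.comul_mul, add_mul, kinv_mul_k, TensorProduct.neg_tmul, TensorProduct.tmul_neg,
      add_comm]
  | hk => simp
  | hi => simp
  | hc c =>
    rw [Algebra.algebraMap_eq_smul_one]
    simp [Algebra.TensorProduct.one_def]
  | ha x y hx hy => simp only [map_add, hx, hy]
  | hm x y hx hy =>
    have key : ∀ a b : Uq q ⊗[ℂ] Uq q,
        TensorProduct.comm ℂ (Uq q) (Uq q) (TensorProduct.map (antipode ℂ) (antipode ℂ) (a * b)) =
        TensorProduct.comm ℂ (Uq q) (Uq q) (TensorProduct.map (antipode ℂ) (antipode ℂ) b) *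
        TensorProduct.comm ℂ (Uq q) (Uq q) (TensorProduct.map (antipode ℂ) (antipode ℂ) a) := by
      intro a b
      induction a with
      | zero => simp
      | add x x' hx hx' => simp only [add_mul, mul_add, map_add, hx, hx']
      | tmul a a' =>
        induction b with
        | zero => simp
        | add x x' hx hx' => simp only [add_mul, mul_add, map_add, hx, hx']
        | tmul b b' => simp [HopfAlgebra.antipode_mul_antidistrib]
    rw [HopfAlgebra.antipode_mul_antidistrib, Bialgebra.comul_mul, hx, hy, Bialgebra.comul_mul, key]

end Uq

namespace Oq

open Uq (coeff coeff₂ coeff₂_col coeff₂_row spin_antipode spin_star coeff_apply)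

variable {q : Set.Ioo (0 : ℝ) 1}

theorem conv_apply (x y : Uq q →ₗ[ℂ] ℂ) (h : Uq q) :
    (WithConv.toConv x * WithConv.toConv y).ofConv h =
      TensorProduct.dualDistrib ℂ (Uq q) (Uq q) (x ⊗ₜ y) (comul h) := by
  rw [LinearMap.convMul_apply]
  generalize (comul (R := ℂ) h) = z
  induction z with
  | zero => simp
  | add a b ha hb => simp only [map_add, ha, hb]
  | tmul a b => simp

theorem conv_coeff_apply (i j k l : Fin 2) (h : Uq q) :
    (WithConv.toConv (coeff i j) * WithConv.toConv (coeff k l) : WithConv (Uq q →ₗ[ℂ] ℂ)).ofConv h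
      = coeff₂ i j k l h := conv_apply _ _ h

/-- The functionals on `U_q(su(2))` given by the generators: the matrix coefficients of the spin
`1/2` representation. -/
def pairGen : OqGen → WithConv (Uq q →ₗ[ℂ] ℂ)
  | .α => WithConv.toConv (coeff 0 0)
  | .β => WithConv.toConv (coeff 0 1)
  | .γ => WithConv.toConv (coeff 1 0)
  | .δ => WithConv.toConv (coeff 1 1)

/-- The pairing as an algebra homomorphism from `O_q(SU(2))` to the dual of `U_q(su(2))` with the
convolution product. -/
def pairHom : Oq q →ₐ[ℂ] WithConv (Uq q →ₗ[ℂ] ℂ) :=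
  lift pairGen
    (by
      ext h
      have := coeff₂_col h 0 0
      simp [Uq.inv₂] at this
      simp only [pairGen, WithConv.ofConv_smul, WithConv.ofConv_sub, LinearMap.smul_apply,
        LinearMap.sub_apply, conv_coeff_apply, smul_eq_mul, LinearMap.convOne_apply,
        Algebra.algebraMap_self, RingHom.id_apply]
      linear_combination this)
    (by
      ext h
      have := coeff₂_row h 0 0
      simp [Uq.inv₂] at this
      simp only [pairGen, WithConv.ofConv_smul, WithConv.ofConv_sub, LinearMap.smul_apply,
        LinearMap.sub_apply, conv_coeff_apply, smul_eq_mul, LinearMap.convOne_apply,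
        Algebra.algebraMap_self, RingHom.id_apply]
      linear_combination this)
    (by
      ext h
      have h1 := coeff₂_row h 0 1
      have h2 := coeff₂_col h 0 1
      simp [Uq.inv₂] at h1 h2
      simp only [pairGen, conv_coeff_apply]
      refine mul_left_cancel₀ (qc_ne q) ?_
      linear_combination h1 - h2)
    (by
      ext h
      have := coeff₂_row h 1 1
      simp [Uq.inv₂] at this
      simp only [pairGen, WithConv.ofConv_smul, WithConv.ofConv_sub, LinearMap.smul_apply,
        LinearMap.sub_apply, conv_coeff_apply, smul_eq_mul, LinearMap.convOne_apply,
        Algebra.algebraMap_self, RingHom.id_apply]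
      linear_combination this)
    (by
      ext h
      have := coeff₂_col h 1 1
      simp [Uq.inv₂] at this
      simp only [pairGen, WithConv.ofConv_smul, WithConv.ofConv_sub, LinearMap.smul_apply,
        LinearMap.sub_apply, conv_coeff_apply, smul_eq_mul, LinearMap.convOne_apply,
        Algebra.algebraMap_self, RingHom.id_apply]
      linear_combination this)
    (by
      ext h
      have := coeff₂_col h 0 1
      simp [Uq.inv₂] at this
      simp only [pairGen, WithConv.ofConv_smul, WithConv.ofConv_sub, LinearMap.smul_apply,
        LinearMap.sub_apply, conv_coeff_apply, smul_eq_mul, LinearMap.convOne_apply,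
        Algebra.algebraMap_self, RingHom.id_apply]
      linear_combination this)
    (by
      ext h
      have := coeff₂_col h 1 0
      simp [Uq.inv₂] at this
      simp only [pairGen, WithConv.ofConv_smul, WithConv.ofConv_sub, LinearMap.smul_apply,
        LinearMap.sub_apply, conv_coeff_apply, smul_eq_mul, LinearMap.convOne_apply,
        Algebra.algebraMap_self, RingHom.id_apply]
      refine mul_left_cancel₀ (qc_ne q) ?_
      rw [mul_sub, ← mul_assoc, q_mul_inv]
      linear_combination -this)

/-- The bilinear form of the pairing of `O_q(SU(2))` and `U_q(su(2))`. -/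
def form : Oq q →ₗ[ℂ] Uq q →ₗ[ℂ] ℂ :=
  (WithConv.linearEquiv ℂ (Uq q →ₗ[ℂ] ℂ)).toLinearMap ∘ₗ pairHom.toLinearMap

theorem form_def (a : Oq q) : form a = (pairHom a).ofConv := rfl

@[simp] theorem form_α (h : Uq q) : form α h = Uq.spin h 0 0 :=
  LinearMap.congr_fun (congrArg WithConv.ofConv (lift_gen (q := q) _ _ _ _ _ _ _ _ .α)) h
@[simp] theorem form_β (h : Uq q) : form β h = Uq.spin h 0 1 :=
  LinearMap.congr_fun (congrArg WithConv.ofConv (lift_gen (q := q) _ _ _ _ _ _ _ _ .β)) h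
@[simp] theorem form_γ (h : Uq q) : form γ h = Uq.spin h 1 0 :=
  LinearMap.congr_fun (congrArg WithConv.ofConv (lift_gen (q := q) _ _ _ _ _ _ _ _ .γ)) h
@[simp] theorem form_δ (h : Uq q) : form δ h = Uq.spin h 1 1 :=
  LinearMap.congr_fun (congrArg WithConv.ofConv (lift_gen (q := q) _ _ _ _ _ _ _ _ .δ)) h

theorem tensorPairing_tmul (a b : Oq q) (h k : Uq q) :
    tensorPairing form (a ⊗ₜ b) (h ⊗ₜ k) = form a h * form b k := rfl

theorem form_mul (a b : Oq q) (h : Uq q) :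
    form (a * b) h = tensorPairing form (a ⊗ₜ b) (comul h) := by
  rw [form_def, map_mul]
  exact conv_apply _ _ h

theorem form_one (h : Uq q) : form (1 : Oq q) h = counit (R := ℂ) h := by
  rw [form_def, map_one]
  simp

theorem form_algebraMap (c : ℂ) (h : Uq q) :
    form (algebraMap ℂ (Oq q) c) h = c * counit (R := ℂ) h := by
  rw [Algebra.algebraMap_eq_smul_one, map_smul, LinearMap.smul_apply, form_one, smul_eq_mul]

theorem form_mul_sum (a b : Oq q) (h : Uq q) : form (a * b) h =
    ∑ i ∈ (ℛ ℂ h).index, form a ((ℛ ℂ h).left i) * form b ((ℛ ℂ h).right i) := by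
  rw [form_mul, ← (ℛ ℂ h).eq]
  simp only [map_sum, tensorPairing_tmul]

theorem form_apply_one (a : Oq q) : form a 1 = counit (R := ℂ) a := by
  induction a using Oq.induction with
  | ha => simp
  | hb => simp
  | hg => simp
  | hd => simp
  | hc c => simp [form_algebraMap]
  | hadd x y hx hy => simp [hx, hy]
  | hmul x y hx hy =>
    rw [form_mul, Bialgebra.comul_one, Algebra.TensorProduct.one_def, tensorPairing_tmul, hx, hy,
      Bialgebra.counit_mul]

theorem tensorPairing_mul (X Y : Oq q ⊗[ℂ] Oq q) (h k : Uq q) :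
    tensorPairing form (X * Y) (h ⊗ₜ k) = ∑ i ∈ (ℛ ℂ h).index, ∑ j ∈ (ℛ ℂ k).index,
      tensorPairing form X ((ℛ ℂ h).left i ⊗ₜ (ℛ ℂ k).left j) *
      tensorPairing form Y ((ℛ ℂ h).right i ⊗ₜ (ℛ ℂ k).right j) := by
  induction X with
  | zero => simp
  | add x x' hx hx' =>
    simp only [add_mul, map_add, hx, hx', Finset.sum_add_distrib, LinearMap.add_apply]
  | tmul a b =>
    induction Y with
    | zero => simp
    | add x x' hx hx' =>
      simp only [mul_add, map_add, hx, hx', Finset.sum_add_distrib, LinearMap.add_apply]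
    | tmul c d =>
      simp only [Algebra.TensorProduct.tmul_mul_tmul, tensorPairing_tmul, form_mul_sum,
        Finset.sum_mul_sum]
      exact Finset.sum_congr rfl fun i _ => Finset.sum_congr rfl fun j _ => by ring

theorem form_apply_mul (a : Oq q) : ∀ h k : Uq q,
    form a (h * k) = tensorPairing form (comul a) (h ⊗ₜ k) := by
  induction a using Oq.induction with
  | ha => intro h k; simp [tensorPairing_tmul, Matrix.mul_apply]
  | hb => intro h k; simp [tensorPairing_tmul, Matrix.mul_apply]
  | hg => intro h k; simp [tensorPairing_tmul, Matrix.mul_apply]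
  | hd => intro h k; simp [tensorPairing_tmul, Matrix.mul_apply]
  | hc c =>
    intro h k
    rw [Bialgebra.comul_algebraMap, Algebra.TensorProduct.algebraMap_apply, tensorPairing_tmul,
      form_algebraMap, form_algebraMap, form_one, Bialgebra.counit_mul]
    ring
  | hadd x y hx hy => intro h k; simp [hx, hy]
  | hmul x y hx hy =>
    intro h k
    rw [form_mul, Bialgebra.comul_mul, Bialgebra.comul_mul, tensorPairing_mul]
    conv_lhs => rw [← (ℛ ℂ h).eq, ← (ℛ ℂ k).eq, Finset.sum_mul_sum]
    simp only [map_sum, Algebra.TensorProduct.tmul_mul_tmul, tensorPairing_tmul, hx, hy]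

theorem comul_antipode_sum (h : Uq q) : comul (R := ℂ) (antipode ℂ h) =
    ∑ i ∈ (ℛ ℂ h).index, antipode ℂ ((ℛ ℂ h).right i) ⊗ₜ antipode ℂ ((ℛ ℂ h).left i) := by
  rw [Uq.comul_antipode]
  conv_lhs => rw [← (ℛ ℂ h).eq]
  simp

theorem form_star (a : Oq q) : ∀ h : Uq q,
    form (star a) h = conj (form a (star (antipode ℂ h))) := by
  have h0 := qc_ne q
  induction a using Oq.induction with
  | ha => intro h; simp [spin_star, spin_antipode, Matrix.conjTranspose_apply]
  | hb => intro h; simp [spin_star, spin_antipode, Matrix.conjTranspose_apply]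
  | hg => intro h; simp [spin_star, spin_antipode, Matrix.conjTranspose_apply]
  | hd => intro h; simp [spin_star, spin_antipode, Matrix.conjTranspose_apply]
  | hc c =>
    intro h
    rw [← algebraMap_star_comm, form_algebraMap, form_algebraMap, HopfStarAlgebra.counit_star,
      counit_antipode]
    simp
  | hadd x y hx hy => intro h; simp [hx, hy]
  | hmul x y hx hy =>
    intro h
    rw [star_mul, form_mul_sum, form_mul, HopfStarAlgebra.comul_star, comul_antipode_sum]
    simp only [star_sum, map_sum, TensorProduct.star_tmul, tensorPairing_tmul, map_mul, hx, hy]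
    exact Finset.sum_congr rfl fun i _ => mul_comm _ _

theorem form_antipode (a : Oq q) : ∀ h : Uq q,
    form (antipode ℂ a) h = form a (antipode ℂ h) := by
  induction a using Oq.induction with
  | ha => intro h; simp [spin_antipode]
  | hb => intro h; simp [spin_antipode]
  | hg => intro h; simp [spin_antipode]
  | hd => intro h; simp [spin_antipode]
  | hc c =>
    intro h
    rw [Algebra.algebraMap_eq_smul_one]
    simp [form_one]
  | hadd x y hx hy => intro h; simp [hx, hy]
  | hmul x y hx hy =>
    intro h
    rw [HopfAlgebra.antipode_mul_antidistrib, form_mul_sum, form_mul, comul_antipode_sum]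
    simp only [map_sum, tensorPairing_tmul, hx, hy]
    exact Finset.sum_congr rfl fun i _ => mul_comm _ _

end Oq

/-- The unitary pairing of `O_q(SU(2))` and `U_q(su(2))` for which the matrix `(α, β; γ, δ)` is
paired with `U_q(su(2))` through the spin `1/2` representation. -/
def su2Pairing (q : Set.Ioo (0 : ℝ) 1) : UnitaryPairing (Oq q) (Uq q) where
  τ := Oq.form
  apply_mul := Oq.form_apply_mul
  mul_apply := Oq.form_mul
  one_apply := Oq.form_one
  apply_one := Oq.form_apply_one
  star_apply := Oq.form_star
  apply_star a h := by
    rw [Oq.form_star, Complex.conj_conj, Oq.form_antipode]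
    have := antipode_antipodeInv (star h)
    rw [antipodeInv_star] at this
    rw [this]

end Pairing

section Main

/-- The quantization `U_q(sl(2, ℂ)_ℝ)`, the Drinfeld double of `O_q(SU(2))` and `U_q(su(2))`. -/
abbrev UqSL2C (q : Set.Ioo (0 : ℝ) 1) : Type := DrinfeldDouble (su2Pairing q)

/-- The element `B_t = q^{-1/2}(e - fk) - i(q - q⁻¹)⁻¹ t k` of `U_q(su(2))`. -/
def elemB (q : Set.Ioo (0 : ℝ) 1) (t : ℝ) : Uq q :=
  (qs q)⁻¹ • (Uq.e - Uq.f * Uq.k) - (Complex.I * (qc q - (qc q)⁻¹)⁻¹ * (t : ℂ)) • Uq.k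

/-- The `*`-subalgebra `U_q(𝔨_t)` of `U_q(su(2))` generated by `B_t`. -/
def UqK (q : Set.Ioo (0 : ℝ) 1) (t : ℝ) : StarSubalgebra ℂ (Uq q) :=
  StarAlgebra.adjoin ℂ {elemB q t}

/-- The matrix `U = (α, β; γ, δ)` generating `O_q(SU(2))`. -/
def matU (q : Set.Ioo (0 : ℝ) 1) : Matrix (Fin 2) (Fin 2) (Oq q) :=
  !![Oq.α, Oq.β; Oq.γ, Oq.δ]

/-- The matrix `L_t = (0, i; -i, -t)`. -/
def matL (t : ℝ) : Matrix (Fin 2) (Fin 2) ℂ :=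
  !![0, Complex.I; -Complex.I, -(t : ℂ)]

/-- The matrix `E_t = U^* L_t U`. -/
def matE (q : Set.Ioo (0 : ℝ) 1) (t : ℝ) : Matrix (Fin 2) (Fin 2) (Oq q) :=
  (matU q).conjTranspose * (matL t).map (algebraMap ℂ (Oq q)) * matU q

/-- The Podleś sphere `*`-algebra `O_q(S_t²) = U_q(𝔪_t)`, generated by the entries of `E_t`. -/
def UqM (q : Set.Ioo (0 : ℝ) 1) (t : ℝ) : StarSubalgebra ℂ (Oq q) :=
  StarAlgebra.adjoin ℂ (Set.range fun ij : Fin 2 × Fin 2 => matE q t ij.1 ij.2)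

/-- The element `X_t` of `O_q(SU(2))`, with `E_t = (q⁻¹ Z_t, Y_t; X_t, -t - q Z_t)`. -/
def elemX (q : Set.Ioo (0 : ℝ) 1) (t : ℝ) : Oq q := matE q t 1 0

/-- The element `Y_t` of `O_q(SU(2))`, with `E_t = (q⁻¹ Z_t, Y_t; X_t, -t - q Z_t)`. -/
def elemY (q : Set.Ioo (0 : ℝ) 1) (t : ℝ) : Oq q := matE q t 0 1

/-- The element `Z_t` of `O_q(SU(2))`, with `E_t = (q⁻¹ Z_t, Y_t; X_t, -t - q Z_t)`. -/
def elemZ (q : Set.Ioo (0 : ℝ) 1) (t : ℝ) : Oq q := qc q • matE q t 0 0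

/-- The matrix `E_t` has the form `(q⁻¹ Z_t, Y_t; X_t, -t - q Z_t)`. -/
theorem matE_eq (q : Set.Ioo (0 : ℝ) 1) (t : ℝ) : matE q t =
    !![(qc q)⁻¹ • elemZ q t, elemY q t;
      elemX q t, -algebraMap ℂ (Oq q) t - qc q • elemZ q t] := by
  have h := qc_ne q
  ext i j
  fin_cases i <;> fin_cases j
  · simp [elemZ, smul_smul, h]
  · simp [elemY]
  · simp [elemX]
  · simp [elemZ, matE, matU, matL, Matrix.mul_apply, Fin.sum_univ_two,
      Matrix.conjTranspose_apply]
    simp only [Algebra.algebraMap_eq_smul_one, mul_add, add_mul, smul_mul_assoc, mul_smul_comm,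
      mul_one, neg_mul, mul_neg, Oq.β_mul_α, Oq.δ_mul_γ, Oq.α_mul_δ, Oq.γ_mul_β, smul_smul]
    match_scalars <;> field_simp

theorem entry_mem (q : Set.Ioo (0 : ℝ) 1) (t : ℝ) (i j : Fin 2) : matE q t i j ∈ UqM q t :=
  StarAlgebra.subset_adjoin ℂ _ ⟨(i, j), rfl⟩

/-- The coideal `*`-algebra `U_q(sl(2, ℝ)_t)`, the Drinfeld double of `U_q(𝔪_t)` and
`U_q(𝔨_t)`. -/
def UqSL2R (q : Set.Ioo (0 : ℝ) 1) (t : ℝ) : StarSubalgebra ℂ (UqSL2C q) :=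
  DrinfeldDouble.coidealDouble (su2Pairing q) (UqM q t) (UqK q t)

theorem inA_mem {q : Set.Ioo (0 : ℝ) 1} {t : ℝ} {a : Oq q} (ha : a ∈ UqM q t) :
    DrinfeldDouble.inA (su2Pairing q) a ∈ UqSL2R q t :=
  StarAlgebra.subset_adjoin ℂ _ (.inl ⟨a, ha, rfl⟩)

theorem inU_mem {q : Set.Ioo (0 : ℝ) 1} {t : ℝ} {h : Uq q} (hh : h ∈ UqK q t) :
    DrinfeldDouble.inU (su2Pairing q) h ∈ UqSL2R q t :=
  StarAlgebra.subset_adjoin ℂ _ (.inr ⟨h, hh, rfl⟩)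

namespace UqSL2R

variable (q : Set.Ioo (0 : ℝ) 1) (t : ℝ)

/-- The element `X_t` of `U_q(sl(2, ℝ)_t)`. -/
def X : UqSL2R q t := ⟨DrinfeldDouble.inA _ (elemX q t), inA_mem (entry_mem q t 1 0)⟩

/-- The element `Y_t` of `U_q(sl(2, ℝ)_t)`. -/
def Y : UqSL2R q t := ⟨DrinfeldDouble.inA _ (elemY q t), inA_mem (entry_mem q t 0 1)⟩

/-- The element `Z_t` of `U_q(sl(2, ℝ)_t)`. -/
def Z : UqSL2R q t :=
  ⟨DrinfeldDouble.inA _ (elemZ q t), inA_mem (SMulMemClass.smul_mem _ (entry_mem q t 0 0))⟩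

/-- The element `B_t` of `U_q(sl(2, ℝ)_t)`. -/
def B : UqSL2R q t :=
  ⟨DrinfeldDouble.inU _ (elemB q t), inU_mem (StarAlgebra.subset_adjoin ℂ _ rfl)⟩

end UqSL2R

/-- The defining relations of `U_q(sl(2, ℝ)_t)`, for elements `x, y, z, b` of a unital complex
`*`-algebra. -/
structure SL2RRelations (q t : ℝ) {C : Type*} [Ring C] [StarRing C] [Algebra ℂ C]
    (x y z b : C) : Prop where
  star_b : star b = -b
  star_x : star x = y
  star_z : star z = z
  x_z : x * z = (q : ℂ) ^ 2 • (z * x)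
  y_z : y * z = ((q : ℂ) ^ 2)⁻¹ • (z * y)
  x_y : x * y = 1 - ((q : ℂ) * (t : ℂ)) • z - (q : ℂ) ^ 2 • z ^ 2
  y_x : y * x = 1 - ((q : ℂ)⁻¹ * (t : ℂ)) • z - ((q : ℂ) ^ 2)⁻¹ • z ^ 2
  b_x : b * x = (q : ℂ) ^ 2 • (x * b) +
    (q : ℂ) • (((q : ℂ) + (q : ℂ)⁻¹) • z + algebraMap ℂ C (t : ℂ))
  b_y : b * y = ((q : ℂ) ^ 2)⁻¹ • (y * b) +
    (q : ℂ)⁻¹ • (((q : ℂ) + (q : ℂ)⁻¹) • z + algebraMap ℂ C (t : ℂ))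
  b_z : b * z = z * b - (x + y)

end Main

end QSL2

end

open QSL2

open scoped TensorProduct ComplexConjugate

noncomputable section

namespace QSL2

set_option linter.unusedSimpArgs false
set_option linter.unnecessarySeqFocus false

/-! The relations have only finitely many monomials to offer: they allow every word in `x, y, z, b`
to be reordered into a combination of `z ^ j * x ^ m * b ^ n` and `z ^ j * y ^ m * b ^ n`. The
relations `xz`, `yz`, `bx`, `by`, `bz` move `z` to the left and `b` to the right, and `xy`, `yx`
remove every product in which both `x` and `y` occur. So these ordered monomials span any
`*`-algebra generated by elements satisfying the relations
(`SL2RRelations.mem_span_monomial_of_mem_starAdjoin`). The theorem follows once the relations are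
verified in the double and the ordered monomials in `X, Y, Z, B` are shown to be linearly
independent there.

Independence has three ingredients. (1) In the Drinfeld double the products `a h` are as independent
as the tensors `a ⊗ h`. This is `DrinfeldDouble.toTensor_inA_mul_inU`: the double is represented in
`End(A) ⊗ U`, with `A` acting by left multiplication and `h` acting as `a ↦ τ(a₍₃₎, h₍₁₎) τ(a₍₁₎,
S⁻¹(h₍₃₎)) a₍₂₎` tensored with `h₍₂₎`; evaluating the first leg at `1` sends `a h` to `a ⊗ h`. (2)
The monomials `Z ^ j X ^ m`, `Z ^ j Y ^ m` are independent in `O_q(SU(2))`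
(`Oq.linearIndependent_monomials`), seen in a family of representations killing `γ` and depending on
a parameter `s`: the power of `Z` is read off from a filtration and the power of `X` or `Y` from the
power of `s`. (3) The powers of `B_t` are independent in `U_q(su(2))`
(`Uq.linearIndependent_pow_elemB`), since they act triangularly on the highest weight vector of a
Verma module.

For the universal property, given `x, y, z, b` in `C`, the `*`-subalgebra `S` of the product
generated by `(X, x), (Y, y), (Z, z), (B, b)` again satisfies the relations, so it is spanned by
ordered monomials. Its projection to the first factor is onto, and injective because those monomials
stay independent. Hence `S` is the graph of the required homomorphism. -/

open Coalgebra HopfAlgebra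

/-! ### The convolution algebra of linear maps from a bialgebra to an algebra. -/

section Convolution

variable {H E : Type*} [Ring H] [Bialgebra ℂ H] [Ring E] [Algebra ℂ E]

/-- The convolution product of two algebra homomorphisms with commuting images. -/
def convHom (f g : H →ₐ[ℂ] E) (h : ∀ x y, Commute (f x) (g y)) : H →ₐ[ℂ] E :=
  (Algebra.TensorProduct.lift f g h).comp (Bialgebra.comulAlgHom ℂ H)

theorem toConv_convHom (f g : H →ₐ[ℂ] E) (h : ∀ x y, Commute (f x) (g y)) :
    WithConv.toConv (convHom f g h).toLinearMap =
      WithConv.toConv f.toLinearMap * WithConv.toConv g.toLinearMap := by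
  ext x
  rw [(ℛ ℂ x).convMul_apply]
  simp only [AlgHom.toLinearMap_apply, convHom, AlgHom.comp_apply, Bialgebra.comulAlgHom_apply]
  conv_lhs => rw [← (ℛ ℂ x).eq]
  simp

theorem convHom_apply (f g : H →ₐ[ℂ] E) (h : ∀ x y, Commute (f x) (g y)) (x : H) :
    convHom f g h x = ∑ i ∈ (ℛ ℂ x).index, f ((ℛ ℂ x).left i) * g ((ℛ ℂ x).right i) := by
  simp only [convHom, AlgHom.comp_apply, Bialgebra.comulAlgHom_apply]
  conv_lhs => rw [← (ℛ ℂ x).eq]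
  simp

variable (H) in
/-- The element of the convolution algebra given by `h ↦ ε(h) x`. -/
def constConv (x : E) : WithConv (H →ₗ[ℂ] E) := WithConv.toConv ((counit (R := ℂ)).smulRight x)

theorem constConv_apply (x : E) (h : H) : constConv H x h = counit (R := ℂ) h • x := rfl

/-- The counit axiom collapses the coproduct. Thus convolving with a constant is ordinary
multiplication in `E`, and identities in the convolution algebra can be evaluated at `h` to give
identities in `E`. -/
theorem constConv_mul_apply (x : E) (f : WithConv (H →ₗ[ℂ] E)) (h : H) :
    (constConv H x * f) h = x * f h := by
  rw [(ℛ ℂ h).convMul_apply]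
  simp only [constConv_apply, smul_mul_assoc, ← mul_smul_comm, ← Finset.mul_sum]
  congr 1
  have := congrArg f.ofConv (Coalgebra.sum_counit_smul (ℛ ℂ h))
  simpa using this

theorem mul_constConv_apply (x : E) (f : WithConv (H →ₗ[ℂ] E)) (h : H) :
    (f * constConv H x) h = f h * x := by
  rw [(ℛ ℂ h).convMul_apply]
  simp only [constConv_apply, mul_smul_comm, ← smul_mul_assoc, ← Finset.sum_mul]
  congr 1
  have h1 := congrArg (TensorProduct.rid ℂ H) (Coalgebra.sum_tmul_counit_eq (ℛ ℂ h))
  simp only [map_sum, TensorProduct.rid_tmul, one_smul] at h1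
  have := congrArg f.ofConv h1
  simpa using this

/-- Links convolution products to `DoubleRel`, whose interchange relations quantify over all
decompositions of the iterated coproduct as finite sums of elementary tensors. -/
theorem convMul_convMul_apply (f g k : WithConv (H →ₗ[ℂ] E)) (h : H) {n : ℕ} (h₁ h₂ h₃ : Fin n → H)
    (hh : comul₃ h = ∑ j, h₁ j ⊗ₜ (h₂ j ⊗ₜ h₃ j)) :
    (f * (g * k)) h = ∑ j, f (h₁ j) * (g (h₂ j) * k (h₃ j)) := by
  have key : (f * (g * k)) h = LinearMap.mul' ℂ E (TensorProduct.map f.ofConv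
      (LinearMap.mul' ℂ E ∘ₗ TensorProduct.map g.ofConv k.ofConv) (comul₃ h)) := by
    rw [LinearMap.convMul_apply, comul₃]
    generalize (comul (R := ℂ) h) = z
    induction z with
    | zero => simp
    | add a b ha hb => simp only [map_add, ha, hb]
    | tmul a b => simp
  rw [key, hh]
  simp

end Convolution

/-! ### Sweedler calculus by means of trilinear maps. -/

section Trilinear

variable {H M : Type*} [AddCommGroup H] [Module ℂ H] [AddCommGroup M] [Module ℂ M]

/-- The linear map on the triple tensor product given by a trilinear map. -/
def triLift (T : H →ₗ[ℂ] H →ₗ[ℂ] H →ₗ[ℂ] M) : H ⊗[ℂ] (H ⊗[ℂ] H) →ₗ[ℂ] M :=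
  TensorProduct.lift ((TensorProduct.lift.equiv (.id ℂ) H H M).toLinearMap ∘ₗ T)

theorem triLift_tmul (T : H →ₗ[ℂ] H →ₗ[ℂ] H →ₗ[ℂ] M) (x y z : H) :
    triLift T (x ⊗ₜ (y ⊗ₜ z)) = T x y z := by
  simp [triLift]

/-- A trilinear map from its values. -/
def triMk (T : H → H → H → M) (h₁ : ∀ x x' y z, T (x + x') y z = T x y z + T x' y z)
    (h₂ : ∀ x y y' z, T x (y + y') z = T x y z + T x y' z)
    (h₃ : ∀ x y z z', T x y (z + z') = T x y z + T x y z')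
    (k₁ : ∀ (c : ℂ) x y z, T (c • x) y z = c • T x y z)
    (k₂ : ∀ (c : ℂ) x y z, T x (c • y) z = c • T x y z)
    (k₃ : ∀ (c : ℂ) x y z, T x y (c • z) = c • T x y z) : H →ₗ[ℂ] H →ₗ[ℂ] H →ₗ[ℂ] M :=
  LinearMap.mk₂ ℂ (fun x y => { toFun := T x y, map_add' := h₃ x y, map_smul' := fun c => k₃ c x y })
    (fun x x' y => by ext z; exact h₁ x x' y z) (fun c x y => by ext z; exact k₁ c x y z)
    (fun x y y' => by ext z; exact h₂ x y y' z) (fun c x y => by ext z; exact k₂ c x y z)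

theorem triMk_apply (T : H → H → H → M) (h₁ : ∀ x x' y z, T (x + x') y z = T x y z + T x' y z)
    (h₂ : ∀ x y y' z, T x (y + y') z = T x y z + T x y' z)
    (h₃ : ∀ x y z z', T x y (z + z') = T x y z + T x y z')
    (k₁ : ∀ (c : ℂ) x y z, T (c • x) y z = c • T x y z)
    (k₂ : ∀ (c : ℂ) x y z, T x (c • y) z = c • T x y z)
    (k₃ : ∀ (c : ℂ) x y z, T x y (c • z) = c • T x y z) (x y z : H) :
    triMk T h₁ h₂ h₃ k₁ k₂ k₃ x y z = T x y z := rfl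

end Trilinear

section Coassoc

variable {H M : Type*} [AddCommGroup M] [Module ℂ M] [Ring H] [Bialgebra ℂ H]

theorem triLift_comul₃ (T : H →ₗ[ℂ] H →ₗ[ℂ] H →ₗ[ℂ] M) {a : H} {ι κ : Type*}
    (r : Coalgebra.Repr ℂ a ι) (s : ∀ i, Coalgebra.Repr ℂ (r.right i) κ) :
    triLift T (comul₃ a) = ∑ i ∈ r.index, ∑ j ∈ (s i).index,
      T (r.left i) ((s i).left j) ((s i).right j) := by
  simp only [comul₃, ← r.eq, map_sum, LinearMap.lTensor_tmul]
  refine Finset.sum_congr rfl fun i _ => ?_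
  rw [← (s i).eq]
  simp only [TensorProduct.tmul_sum, map_sum, triLift_tmul]

theorem triLift_comul₃' (T : H →ₗ[ℂ] H →ₗ[ℂ] H →ₗ[ℂ] M) {a : H}
    (r : Coalgebra.Repr ℂ a (H × H)) (s : ∀ i, Coalgebra.Repr ℂ (r.left i) (H × H)) :
    triLift T (comul₃ a) = ∑ i ∈ r.index, ∑ j ∈ (s i).index,
      T ((s i).left j) ((s i).right j) (r.right i) := by
  rw [triLift_comul₃ T r (fun i => ℛ ℂ _)]
  have := congrArg (triLift T) (sum_tmul_tmul_eq r s (fun i => ℛ ℂ _))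
  simp only [map_sum, triLift_tmul] at this
  exact this.symm

/-- Coassociativity in usable form: both sides are the value of `T` on `comul₃ a`, so a Sweedler
expression may be re-bracketed as soon as it is trilinear in its three legs. -/
theorem sum_sum_coassoc (T : H →ₗ[ℂ] H →ₗ[ℂ] H →ₗ[ℂ] M) (a : H) :
    ∑ i ∈ (ℛ ℂ a).index, ∑ j ∈ (ℛ ℂ ((ℛ ℂ a).left i)).index,
      T ((ℛ ℂ ((ℛ ℂ a).left i)).left j) ((ℛ ℂ ((ℛ ℂ a).left i)).right j) ((ℛ ℂ a).right i) =
    ∑ i ∈ (ℛ ℂ a).index, ∑ j ∈ (ℛ ℂ ((ℛ ℂ a).right i)).index,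
      T ((ℛ ℂ a).left i) ((ℛ ℂ ((ℛ ℂ a).right i)).left j) ((ℛ ℂ ((ℛ ℂ a).right i)).right j) := by
  rw [← triLift_comul₃ T (ℛ ℂ a) (fun i => ℛ ℂ _), ← triLift_comul₃' T (ℛ ℂ a) (fun i => ℛ ℂ _)]

end Coassoc

/-! ### The inverse antipode of a Hopf `*`-algebra. -/

section HopfStar

variable {H : Type*} [Ring H] [HopfAlgebra ℂ H] [StarRing H]

theorem antipodeInv_mul (a b : H) : antipodeInv (a * b) = antipodeInv b * antipodeInv a := by
  simp [antipodeInv, HopfAlgebra.antipode_mul_antidistrib]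

theorem antipodeInv_one : antipodeInv (1 : H) = 1 := by
  simp [antipodeInv]

variable [StarModule ℂ H]

variable (H) in
/-- The inverse of the antipode as a linear map. -/
def antipodeInvₗ : H →ₗ[ℂ] H where
  toFun := antipodeInv
  map_add' := by simp [antipodeInv]
  map_smul' := by simp [antipodeInv]

theorem antipodeInvₗ_apply (a : H) : antipodeInvₗ H a = antipodeInv a := rfl

theorem antipodeInv_add (a b : H) : antipodeInv (a + b) = antipodeInv a + antipodeInv b :=
  map_add (antipodeInvₗ H) a b

theorem antipodeInv_smul (c : ℂ) (a : H) : antipodeInv (c • a) = c • antipodeInv a :=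
  map_smul (antipodeInvₗ H) c a

variable [HopfStarAlgebra H]

/-- This is the star of the antipode axiom at `a^*`. The star reverses the product, which is why
`S⁻¹` meets the legs in the opposite order. -/
theorem sum_antipodeInv_right_mul_left {a : H} {ι : Type*} (r : Coalgebra.Repr ℂ a ι) :
    ∑ i ∈ r.index, antipodeInv (r.right i) * r.left i = algebraMap ℂ H (counit a) := by
  have h := mul_antipode_lTensor_comul_apply (R := ℂ) (star a)
  rw [HopfStarAlgebra.comul_star, HopfStarAlgebra.counit_star, ← r.eq, star_sum] at h
  simp only [TensorProduct.star_tmul, map_sum, LinearMap.lTensor_tmul,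
    LinearMap.mul'_apply] at h
  have h' := congrArg star h
  rw [star_sum, ← algebraMap_star_comm] at h'
  simpa [antipodeInv] using h'

end HopfStar

theorem sum_counit_right_smul_left {H : Type*} [Ring H] [Bialgebra ℂ H] {a : H} {ι : Type*}
    (r : Coalgebra.Repr ℂ a ι) : ∑ i ∈ r.index, counit (R := ℂ) (r.right i) • r.left i = a := by
  have h := congrArg (TensorProduct.rid ℂ H) (Coalgebra.sum_tmul_counit_eq r)
  simpa only [map_sum, TensorProduct.rid_tmul, one_smul] using h

/-! ### Interchange relations, derived abstractly for a triple product `l * m * r`. -/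

section Interchange

variable {A R : Type*} [Ring A] [HopfAlgebra ℂ A] [StarRing A] [StarModule ℂ A]
  [Ring R] [Algebra ℂ R] {c p : A →ₐ[ℂ] R}

/-- In the application `R` is the convolution algebra, `c` is left multiplication by elements of
`A`, `p` is the pairing, and `l`, `m`, `r` are the factors of the action of `U`. Splitting the
action this way reduces the interchange relation of the double to one simple rule for each factor.
-/
theorem right_left_interchange {l m r : R} (hl : ∀ a, l * c a =
      ∑ i ∈ (ℛ ℂ a).index, c ((ℛ ℂ a).left i) * p ((ℛ ℂ a).right i) * l)
    (hm : ∀ a, Commute (c a) m) (hr : ∀ a, r * c a =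
      ∑ i ∈ (ℛ ℂ a).index, c ((ℛ ℂ a).right i) * r * p (antipodeInv ((ℛ ℂ a).left i)))
    (a : A) {n : ℕ} (a₁ a₂ a₃ : Fin n → A) (ha : comul₃ a = ∑ i, a₁ i ⊗ₜ (a₂ i ⊗ₜ a₃ i)) :
    l * m * r * c a = ∑ i, c (a₂ i) * p (a₃ i) * (l * m * r) * p (antipodeInv (a₁ i)) := by
  have key := congrArg (triLift (triMk
    (fun x y z => c y * p z * (l * m * r) * p (antipodeInv x))
    (by intros; simp [mul_add, antipodeInv_add]) (by intros; simp [add_mul])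
    (by intros; simp [add_mul, mul_add]) (by intros; simp [antipodeInv_smul])
    (by intros; simp) (by intros; simp))) ha
  rw [triLift_comul₃ _ (ℛ ℂ a) (fun i => ℛ ℂ _)] at key
  simp only [map_sum, triLift_tmul, triMk_apply] at key
  -- Carry `c` leftwards: past `r` it splits off the first leg of `a`, past `m` nothing happens,
  -- past `l` it splits off the last leg.
  rw [← key, mul_assoc _ r, hr, Finset.mul_sum]
  refine Finset.sum_congr rfl fun i _ => ?_
  rw [mul_assoc (c _), ← mul_assoc _ (c _), mul_assoc l, ← (hm _).eq, ← mul_assoc l, hl]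
  simp only [Finset.sum_mul, mul_assoc]

variable [HopfStarAlgebra A]

/-- The rule for `l` solved for `c a * l`: expanding the right-hand side by `hl` gives `c(a₍₁₎)
p(S⁻¹(a₍₃₎) a₍₂₎) l`, and `S⁻¹(a₍₃₎) a₍₂₎` collapses to the counit. -/
theorem sum_left_interchange (hcp : ∀ a b, Commute (c a) (p b)) {l : R}
    (hl : ∀ a, l * c a =
      ∑ i ∈ (ℛ ℂ a).index, c ((ℛ ℂ a).left i) * p ((ℛ ℂ a).right i) * l) (a : A) :
    c a * l = ∑ i ∈ (ℛ ℂ a).index, p (antipodeInv ((ℛ ℂ a).right i)) * l * c ((ℛ ℂ a).left i) := by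
  have key := sum_sum_coassoc (triMk (fun x y z => p (antipodeInv z) * (c x * p y * l))
    (by intros; simp [add_mul, mul_add]) (by intros; simp [add_mul, mul_add])
    (by intros; simp [add_mul, antipodeInv_add]) (by intros; simp) (by intros; simp)
    (by intros; simp [antipodeInv_smul])) a
  simp only [triMk_apply] at key
  simp only [mul_assoc _ l, hl]
  simp only [Finset.mul_sum]
  rw [key]
  simp only [← mul_assoc, ← (hcp _ _).eq]
  simp only [mul_assoc (c _), ← map_mul p, ← Finset.mul_sum, ← Finset.sum_mul, ← map_sum p]
  simp only [sum_antipodeInv_right_mul_left, AlgHom.commutes]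
  simp only [Algebra.algebraMap_eq_smul_one, smul_mul_assoc, one_mul, mul_smul_comm]
  conv_lhs => rw [← sum_counit_right_smul_left (ℛ ℂ a), map_sum, Finset.sum_mul]
  simp only [map_smul, smul_mul_assoc]

/-- Mirror image of `sum_left_interchange`: here `S⁻¹(a₍₂₎) a₍₁₎` collapses. -/
theorem sum_right_interchange (hcp : ∀ a b, Commute (c a) (p b)) {r : R}
    (hr : ∀ a, r * c a =
      ∑ i ∈ (ℛ ℂ a).index, c ((ℛ ℂ a).right i) * r * p (antipodeInv ((ℛ ℂ a).left i))) (a : A) :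
    c a * r = ∑ i ∈ (ℛ ℂ a).index, r * p ((ℛ ℂ a).left i) * c ((ℛ ℂ a).right i) := by
  have key := sum_sum_coassoc (triMk (fun x y z => c z * r * p (antipodeInv y) * p x)
    (by intros; simp [mul_add]) (by intros; simp [add_mul, mul_add, antipodeInv_add])
    (by intros; simp [add_mul]) (by intros; simp)
    (by intros; simp [antipodeInv_smul]) (by intros; simp)) a
  simp only [triMk_apply] at key
  simp only [mul_assoc r, ← (hcp _ _).eq]
  simp only [← mul_assoc r, hr]
  simp only [Finset.sum_mul]
  rw [← key]
  simp only [mul_assoc (_ * r), ← map_mul p, ← Finset.mul_sum, ← map_sum p]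
  simp only [sum_antipodeInv_right_mul_left, AlgHom.commutes]
  simp only [Algebra.algebraMap_eq_smul_one, mul_smul_comm, mul_one]
  conv_lhs => rw [← Coalgebra.sum_counit_smul (ℛ ℂ a), map_sum, Finset.sum_mul]
  simp only [map_smul, smul_mul_assoc]

/-- The second interchange relation is the first one solved for the opposite order, so it needs no
further hypothesis on `l`, `m`, `r`: `c` is carried rightwards by the two inverted rules. -/
theorem left_right_interchange (hcp : ∀ a b, Commute (c a) (p b)) {l m r : R}
    (hl : ∀ a, l * c a =
      ∑ i ∈ (ℛ ℂ a).index, c ((ℛ ℂ a).left i) * p ((ℛ ℂ a).right i) * l)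
    (hm : ∀ a, Commute (c a) m) (hr : ∀ a, r * c a =
      ∑ i ∈ (ℛ ℂ a).index, c ((ℛ ℂ a).right i) * r * p (antipodeInv ((ℛ ℂ a).left i)))
    (a : A) {n : ℕ} (a₁ a₂ a₃ : Fin n → A) (ha : comul₃ a = ∑ i, a₁ i ⊗ₜ (a₂ i ⊗ₜ a₃ i)) :
    c a * (l * m * r) = ∑ i, p (antipodeInv (a₃ i)) * (l * m * r) * p (a₁ i) * c (a₂ i) := by
  have key := congrArg (triLift (triMk
    (fun x y z => p (antipodeInv z) * (l * m * r) * p x * c y)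
    (by intros; simp [add_mul, mul_add]) (by intros; simp [mul_add])
    (by intros; simp [add_mul, antipodeInv_add]) (by intros; simp)
    (by intros; simp) (by intros; simp [antipodeInv_smul]))) ha
  rw [triLift_comul₃' _ (ℛ ℂ a) (fun i => ℛ ℂ _)] at key
  simp only [map_sum, triLift_tmul, triMk_apply] at key
  rw [← key, mul_assoc l, ← mul_assoc, sum_left_interchange hcp hl, Finset.sum_mul]
  refine Finset.sum_congr rfl fun i _ => ?_
  rw [mul_assoc _ (c _), ← mul_assoc (c _), (hm _).eq, mul_assoc m, sum_right_interchange hcp hr]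
  simp only [Finset.mul_sum, mul_assoc]

end Interchange

/-! ### Two commuting actions of `U` on `A`. -/

section Represent

variable {A U : Type*} [Ring A] [HopfAlgebra ℂ A] [StarRing A]
  [Ring U] [HopfAlgebra ℂ U] [StarRing U] (P : UnitaryPairing A U)

/-- Both sides are the conjugate of `τ(a^*, h^*)`, computed once by moving the star of `U` and once
by moving the star of `A`. -/
theorem UnitaryPairing.τ_antipodeInv (a : A) (h : U) :
    P.τ (antipodeInv a) h = P.τ a (antipodeInv h) := by
  have h1 := P.apply_star (star a) h
  have h2 := P.star_apply a (star h)
  rw [antipodeInv, antipodeInv]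
  exact star_injective (h1.symm.trans h2)

theorem UnitaryPairing.apply_mul_sum {a : A} {ι : Type*} (r : Coalgebra.Repr ℂ a ι) (h k : U) :
    P.τ a (h * k) = ∑ i ∈ r.index, P.τ (r.left i) h * P.τ (r.right i) k := by
  rw [P.apply_mul, ← r.eq]
  simp [tensorPairing]

theorem UnitaryPairing.mul_apply_sum {h : U} {ι : Type*} (r : Coalgebra.Repr ℂ h ι) (a b : A) :
    P.τ (a * b) h = ∑ i ∈ r.index, P.τ a (r.left i) * P.τ b (r.right i) := by
  rw [P.mul_apply, ← r.eq]
  simp [tensorPairing]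

/-- The linear maps `a ↦ a₍₁₎ τ(a₍₂₎, h)` of `A`. -/
def leftActₗ : U →ₗ[ℂ] Module.End ℂ A where
  toFun h := (TensorProduct.rid ℂ A).toLinearMap ∘ₗ (P.τ.flip h).lTensor A ∘ₗ comul
  map_add' := by intros; ext; simp [LinearMap.lTensor_add]
  map_smul' := by intros; ext; simp [LinearMap.lTensor_smul]

theorem leftActₗ_apply (h : U) {a : A} {ι : Type*} (r : Coalgebra.Repr ℂ a ι) :
    leftActₗ P h a = ∑ i ∈ r.index, P.τ (r.right i) h • r.left i := by
  simp only [leftActₗ, LinearMap.coe_mk, AddHom.coe_mk, LinearMap.comp_apply]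
  rw [← r.eq]
  simp

/-- The left action of `U` on `A` by `h ⊳ a = a₍₁₎ τ(a₍₂₎, h)`. -/
def leftAct : U →ₐ[ℂ] Module.End ℂ A :=
  AlgHom.ofLinearMap (leftActₗ P)
    (by
      ext a
      rw [leftActₗ_apply P 1 (ℛ ℂ a)]
      simp only [P.apply_one]
      exact sum_counit_right_smul_left _)
    (fun h k => by
      ext a
      rw [Module.End.mul_apply, leftActₗ_apply P _ (ℛ ℂ a), leftActₗ_apply P k (ℛ ℂ a)]
      have key := sum_sum_coassoc (triMk (fun x y z => (P.τ z k * P.τ y h) • x)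
        (by intros; simp) (by intros; simp [mul_add, add_smul])
        (by intros; simp [add_mul, add_smul]) (by intros; simp [smul_smul, mul_comm])
        (by intros; simp [smul_smul, mul_left_comm]) (by intros; simp [smul_smul, mul_assoc])) a
      simp only [triMk_apply] at key
      simp only [map_sum, map_smul]
      simp only [leftActₗ_apply P h (ℛ ℂ ((ℛ ℂ a).left _)), Finset.smul_sum, smul_smul]
      rw [key]
      refine Finset.sum_congr rfl fun i _ => ?_
      rw [P.apply_mul_sum (ℛ ℂ _), Finset.sum_smul]
      simp only [mul_comm])

theorem leftAct_apply (h : U) {a : A} {ι : Type*} (r : Coalgebra.Repr ℂ a ι) :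
    leftAct P h a = ∑ i ∈ r.index, P.τ (r.right i) h • r.left i := leftActₗ_apply P h r

theorem leftAct_apply_one (h : U) : leftAct P h 1 = counit (R := ℂ) h • (1 : A) := by
  have : leftAct P h 1 = (TensorProduct.rid ℂ A) ((P.τ.flip h).lTensor A (comul 1)) := rfl
  rw [this, Bialgebra.comul_one, Algebra.TensorProduct.one_def]
  simp [P.one_apply]

/-- The product of two decompositions of coproducts is a decomposition of the coproduct of the
product. -/
def reprMul {H : Type*} [Ring H] [Bialgebra ℂ H] {a b : H} {ι κ : Type*}
    (r : Coalgebra.Repr ℂ a ι) (s : Coalgebra.Repr ℂ b κ) : Coalgebra.Repr ℂ (a * b) (ι × κ) where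
  index := r.index ×ˢ s.index
  left i := r.left i.1 * s.left i.2
  right i := r.right i.1 * s.right i.2
  eq := by
    rw [Finset.sum_product]
    rw [Bialgebra.comul_mul]
    conv_rhs => rw [← r.eq, ← s.eq, Finset.sum_mul_sum]
    simp only [Algebra.TensorProduct.tmul_mul_tmul]

/-- The action makes `A` a module algebra, so `h` passes a multiplication operator through its
coproduct: the first leg of `h` is spent on `a`, the second keeps acting. -/
theorem leftAct_mul_lmul (h : U) (a : A) :
    leftAct P h * Algebra.lmul ℂ A a = ∑ i ∈ (ℛ ℂ a).index, ∑ k ∈ (ℛ ℂ h).index,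
      P.τ ((ℛ ℂ a).right i) ((ℛ ℂ h).left k) •
        (Algebra.lmul ℂ A ((ℛ ℂ a).left i) * leftAct P ((ℛ ℂ h).right k)) := by
  ext b
  simp only [LinearMap.sum_apply, LinearMap.smul_apply, Module.End.mul_apply,
    Algebra.coe_lmul_eq_mul, LinearMap.mul_apply']
  rw [leftAct_apply P h (reprMul (ℛ ℂ a) (ℛ ℂ b))]
  simp only [reprMul, Finset.sum_product, leftAct_apply P _ (ℛ ℂ b), P.mul_apply_sum (ℛ ℂ h),
    Finset.mul_sum, Finset.sum_smul, Finset.smul_sum, mul_smul_comm, smul_smul]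
  exact Finset.sum_congr rfl fun i _ => Finset.sum_comm

variable [StarModule ℂ U]

/-- The linear maps `a ↦ τ(a₍₁₎, S⁻¹(h)) a₍₂₎` of `A`. -/
def rightActₗ : U →ₗ[ℂ] Module.End ℂ A where
  toFun h := (TensorProduct.lid ℂ A).toLinearMap ∘ₗ (P.τ.flip (antipodeInvₗ U h)).rTensor A ∘ₗ comul
  map_add' := by intros; ext; simp [LinearMap.rTensor_add]
  map_smul' := by intros; ext; simp [LinearMap.rTensor_smul]

theorem rightActₗ_apply (h : U) {a : A} {ι : Type*} (r : Coalgebra.Repr ℂ a ι) :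
    rightActₗ P h a = ∑ i ∈ r.index, P.τ (r.left i) (antipodeInv h) • r.right i := by
  simp only [rightActₗ, LinearMap.coe_mk, AddHom.coe_mk, LinearMap.comp_apply]
  rw [← r.eq]
  simp [antipodeInvₗ_apply]

/-- The left action of `U` on `A` by `h • a = τ(a₍₁₎, S⁻¹(h)) a₍₂₎`. -/
def rightAct : U →ₐ[ℂ] Module.End ℂ A :=
  AlgHom.ofLinearMap (rightActₗ P)
    (by
      ext a
      rw [rightActₗ_apply P 1 (ℛ ℂ a)]
      simp only [antipodeInv_one, P.apply_one]
      exact Coalgebra.sum_counit_smul _)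
    (fun h k => by
      ext a
      rw [Module.End.mul_apply, rightActₗ_apply P _ (ℛ ℂ a), rightActₗ_apply P k (ℛ ℂ a)]
      have key := sum_sum_coassoc
        (triMk (fun x y z => (P.τ x (antipodeInv k) * P.τ y (antipodeInv h)) • z)
        (by intros; simp [add_mul, add_smul]) (by intros; simp [mul_add, add_smul])
        (by intros; simp) (by intros; simp [smul_smul, mul_assoc])
        (by intros; simp [smul_smul, mul_left_comm]) (by intros; simp [smul_smul, mul_comm])) a
      simp only [triMk_apply] at key
      simp only [map_sum, map_smul]
      simp only [rightActₗ_apply P h (ℛ ℂ ((ℛ ℂ a).right _)), Finset.smul_sum, smul_smul]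
      rw [← key]
      refine Finset.sum_congr rfl fun i _ => ?_
      rw [antipodeInv_mul, P.apply_mul_sum (ℛ ℂ _), Finset.sum_smul])

theorem rightAct_apply (h : U) {a : A} {ι : Type*} (r : Coalgebra.Repr ℂ a ι) :
    rightAct P h a = ∑ i ∈ r.index, P.τ (r.left i) (antipodeInv h) • r.right i :=
  rightActₗ_apply P h r

/-- The two actions consume opposite outer legs of the coproduct of `A`, so this is coassociativity.
-/
theorem leftAct_commute_rightAct (h k : U) : Commute (leftAct P h) (rightAct P k) := by
  ext a
  rw [Module.End.mul_apply, Module.End.mul_apply, rightAct_apply P k (ℛ ℂ a),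
    leftAct_apply P h (ℛ ℂ a)]
  have key := sum_sum_coassoc
    (triMk (fun x y z => (P.τ x (antipodeInv k) * P.τ z h) • y)
    (by intros; simp [add_mul, add_smul]) (by intros; simp)
    (by intros; simp [mul_add, add_smul]) (by intros; simp [smul_smul, mul_assoc])
    (by intros; simp [smul_smul, mul_comm]) (by intros; simp [smul_smul, mul_left_comm])) a
  simp only [triMk_apply] at key
  simp only [map_sum, map_smul]
  simp only [rightAct_apply P k (ℛ ℂ ((ℛ ℂ a).left _)),
    leftAct_apply P h (ℛ ℂ ((ℛ ℂ a).right _)), Finset.smul_sum, smul_smul]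
  rw [← key]
  simp only [mul_comm]

theorem rightAct_apply_one [HopfStarAlgebra U] (h : U) :
    rightAct P h 1 = counit (R := ℂ) h • (1 : A) := by
  have : rightAct P h 1 = (TensorProduct.lid ℂ A)
    ((P.τ.flip (antipodeInvₗ U h)).rTensor A (comul 1)) := rfl
  rw [this, Bialgebra.comul_one, Algebra.TensorProduct.one_def]
  simp [P.one_apply, antipodeInvₗ_apply, antipodeInv, HopfStarAlgebra.counit_star]

/-- Moving `S⁻¹` from `U` to `A` avoids the coproduct of `S⁻¹(h)`. Since `S⁻¹` reverses products in
`A`, it is now the second leg of `h` that is spent on `a`. -/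
theorem rightAct_mul_lmul (h : U) (a : A) :
    rightAct P h * Algebra.lmul ℂ A a = ∑ i ∈ (ℛ ℂ a).index, ∑ k ∈ (ℛ ℂ h).index,
      P.τ (antipodeInv ((ℛ ℂ a).left i)) ((ℛ ℂ h).right k) •
        (Algebra.lmul ℂ A ((ℛ ℂ a).right i) * rightAct P ((ℛ ℂ h).left k)) := by
  ext b
  simp only [LinearMap.sum_apply, LinearMap.smul_apply, Module.End.mul_apply,
    Algebra.coe_lmul_eq_mul, LinearMap.mul_apply']
  rw [rightAct_apply P h (reprMul (ℛ ℂ a) (ℛ ℂ b))]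
  simp only [reprMul, Finset.sum_product, rightAct_apply P _ (ℛ ℂ b), ← P.τ_antipodeInv,
    antipodeInv_mul, P.mul_apply_sum (ℛ ℂ h),
    Finset.mul_sum, Finset.sum_smul, Finset.smul_sum, mul_smul_comm, smul_smul]
  refine Finset.sum_congr rfl fun i _ => Finset.sum_comm.trans ?_
  simp only [mul_comm]

end Represent

/-! ### Multiplication operators and the pairing inside the convolution algebra. -/

section ConvolutionHoms

variable {A U E : Type*} [Ring A] [HopfAlgebra ℂ A] [Ring U] [HopfAlgebra ℂ U]
  [Ring E] [Algebra ℂ E]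

theorem constConv_mul (x y : E) : constConv U (x * y) = constConv U x * constConv U y := by
  ext h
  refine Eq.trans ?_ (constConv_mul_apply x (constConv U y) h).symm
  rw [constConv_apply, constConv_apply, mul_smul_comm]

variable (U) in
/-- Constants in the convolution algebra. -/
def constConvHom (f : A →ₐ[ℂ] E) : A →ₐ[ℂ] WithConv (U →ₗ[ℂ] E) :=
  AlgHom.ofLinearMap
    { toFun := fun a => constConv U (f a)
      map_add' := fun a b => by
        ext h
        exact (congrArg _ (map_add f a b)).trans (smul_add _ _ _)
      map_smul' := fun c a => by
        ext h
        exact (congrArg _ (map_smul f c a)).trans (smul_comm _ _ _) }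
    (by ext h; simp [constConv_apply, Algebra.algebraMap_eq_smul_one])
    (fun a b => (congrArg _ (map_mul f a b)).trans (constConv_mul _ _))

theorem constConvHom_apply (f : A →ₐ[ℂ] E) (a : A) :
    constConvHom U f a = constConv U (f a) := rfl

variable [StarRing A] [StarRing U] (P : UnitaryPairing A U)

variable (E) in
/-- The algebra homomorphism from `A` to the convolution algebra given by the pairing. -/
def pairConv : A →ₐ[ℂ] WithConv (U →ₗ[ℂ] E) :=
  AlgHom.ofLinearMap
    { toFun := fun a => WithConv.toConv (Algebra.linearMap ℂ E ∘ₗ P.τ a)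
      map_add' := by intros; ext; simp
      map_smul' := by intros; ext; simp [Algebra.algebraMap_eq_smul_one, smul_smul] }
    (by ext h; simp [P.one_apply])
    (fun a b => by
      ext h
      rw [(ℛ ℂ h).convMul_apply]
      simp [P.mul_apply_sum (ℛ ℂ h)])

theorem pairConv_apply (a : A) (h : U) : pairConv E P a h = algebraMap ℂ E (P.τ a h) := rfl

/-- The pairing takes scalar values and constants multiply pointwise, so they commute even if the
convolution algebra is not commutative. -/
theorem constConvHom_commute_pairConv (f : A →ₐ[ℂ] E) (a b : A) :
    Commute (constConvHom U f a) (pairConv E P b) := by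
  ext h
  refine (constConv_mul_apply _ _ _).trans (Eq.trans ?_ (mul_constConv_apply _ _ _).symm)
  rw [pairConv_apply, Algebra.commutes]

end ConvolutionHoms

/-! ### The representation of the double, assembled as a convolution product of three homomorphisms.
-/

section Represent

variable {A U E : Type*} [Ring A] [HopfAlgebra ℂ A] [Ring U] [HopfAlgebra ℂ U] [Ring E]
  [Algebra ℂ E] (i : Module.End ℂ A →ₐ[ℂ] E) (j : U →ₐ[ℂ] E)

/-- The homomorphism from `A` to an algebra over `End(A)` by left multiplication. -/
def mulHom : A →ₐ[ℂ] E := i.comp (Algebra.lmul ℂ A)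

theorem constConvHom_commute_toConv (hij : ∀ x y, Commute (i x) (j y)) (a : A) :
    Commute (constConvHom U (mulHom i) a) (WithConv.toConv j.toLinearMap) := by
  ext h
  refine (constConv_mul_apply _ _ _).trans (Eq.trans ?_ (mul_constConv_apply _ _ _).symm)
  exact hij _ _

variable [StarRing A] [StarRing U] (P : UnitaryPairing A U)

theorem comp_leftAct_commute
    (hij : ∀ x y, Commute (i x) (j y)) (h k : U) : Commute (i.comp (leftAct P) h) (j k) := hij _ _

/-- `leftAct_mul_lmul` rewritten as an identity in the convolution algebra; it is the hypothesis on
`l` in the abstract interchange lemmas. -/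
theorem leftAct_interchange (a : A) :
    WithConv.toConv (i.comp (leftAct P)).toLinearMap * constConvHom U (mulHom i) a =
      ∑ n ∈ (ℛ ℂ a).index, constConvHom U (mulHom i) ((ℛ ℂ a).left n) *
        pairConv E P ((ℛ ℂ a).right n) * WithConv.toConv (i.comp (leftAct P)).toLinearMap := by
  ext h
  refine (mul_constConv_apply _ _ _).trans ?_
  simp only [WithConv.ofConv_sum, LinearMap.sum_apply, mul_assoc]
  simp only [constConvHom_apply]
  refine Eq.trans ?_ (Finset.sum_congr rfl fun i _ => (constConv_mul_apply _ _ _).symm)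
  simp only [(ℛ ℂ h).convMul_apply, pairConv_apply]
  have key := congrArg i (leftAct_mul_lmul P h a)
  simp only [map_mul, map_sum, map_smul] at key
  refine key.trans ?_
  simp only [mulHom, AlgHom.comp_apply, Finset.mul_sum, Algebra.algebraMap_eq_smul_one,
    smul_mul_assoc, one_mul, mul_smul_comm]
  rfl

variable [StarModule ℂ U] (hij : ∀ x y, Commute (i x) (j y))

theorem comp_rightAct_commute (hij : ∀ x y, Commute (i x) (j y)) (h k : U) :
    Commute (convHom (i.comp (leftAct P)) j (comp_leftAct_commute i j P hij) h) (i.comp (rightAct P) k) := by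
  rw [convHom_apply]
  refine Commute.sum_left _ _ _ fun _ _ => ?_
  exact ((leftAct_commute_rightAct P _ _).map i).mul_left (hij _ _).symm

/-- The homomorphism `h ↦ (a ↦ τ(a₍₁₎, S⁻¹(h₍₃₎)) a₍₂₎ τ(a₍₃₎, h₍₁₎)) ⊗ h₍₂₎` from `U` to
an algebra over `End(A) ⊗ U`. -/
def actHom : U →ₐ[ℂ] E :=
  convHom (convHom (i.comp (leftAct P)) j (comp_leftAct_commute i j P hij))
    (i.comp (rightAct P)) (comp_rightAct_commute i j P hij)

theorem toConv_actHom : WithConv.toConv (actHom i j P hij).toLinearMap =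
    WithConv.toConv (i.comp (leftAct P)).toLinearMap * WithConv.toConv j.toLinearMap *
      WithConv.toConv (i.comp (rightAct P)).toLinearMap := by
  rw [actHom, toConv_convHom, toConv_convHom]

/-- `rightAct_mul_lmul` in the convolution algebra; it is the hypothesis on `r`. -/
theorem rightAct_interchange (a : A) :
    WithConv.toConv (i.comp (rightAct P)).toLinearMap * constConvHom U (mulHom i) a =
      ∑ n ∈ (ℛ ℂ a).index, constConvHom U (mulHom i) ((ℛ ℂ a).right n) *
        WithConv.toConv (i.comp (rightAct P)).toLinearMap *
        pairConv E P (antipodeInv ((ℛ ℂ a).left n)) := by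
  ext h
  refine (mul_constConv_apply _ _ _).trans ?_
  simp only [WithConv.ofConv_sum, LinearMap.sum_apply, mul_assoc]
  simp only [constConvHom_apply]
  refine Eq.trans ?_ (Finset.sum_congr rfl fun i _ => (constConv_mul_apply _ _ _).symm)
  simp only [(ℛ ℂ h).convMul_apply, pairConv_apply]
  have key := congrArg i (rightAct_mul_lmul P h a)
  simp only [map_mul, map_sum, map_smul] at key
  refine key.trans ?_
  simp only [mulHom, AlgHom.comp_apply, Finset.mul_sum, Algebra.algebraMap_eq_smul_one,
    mul_one, mul_smul_comm]
  rfl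

section

variable [StarModule ℂ A]

theorem actHom_mul_mulHom (a : A) (h : U) {m n : ℕ} (a₁ a₂ a₃ : Fin m → A) (h₁ h₂ h₃ : Fin n → U)
    (ha : comul₃ a = ∑ i, a₁ i ⊗ₜ (a₂ i ⊗ₜ a₃ i)) (hh : comul₃ h = ∑ j, h₁ j ⊗ₜ (h₂ j ⊗ₜ h₃ j)) :
    actHom i j P hij h * mulHom i a =
      ∑ s, ∑ r, (P.τ (a₃ s) (h₁ r) * P.τ (a₁ s) (antipodeInv (h₃ r))) •
        (mulHom i (a₂ s) * actHom i j P hij (h₂ r)) := by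
  have key := right_left_interchange (leftAct_interchange i P)
    (constConvHom_commute_toConv i j hij) (rightAct_interchange i P) a a₁ a₂ a₃ ha
  rw [← toConv_actHom i j P hij] at key
  -- The identity of the convolution algebra is evaluated at `h`; constant factors on the outside
  -- become multiplication by elements of `A`, and the remaining triple convolution unfolds along
  -- `h₁`, `h₂`, `h₃`.
  have key' := congrArg (fun f => f.ofConv h) key
  refine (mul_constConv_apply _ _ _).symm.trans (key'.trans ?_)
  simp only [WithConv.ofConv_sum, LinearMap.sum_apply, mul_assoc, constConvHom_apply]
  refine Finset.sum_congr rfl fun s _ => (constConv_mul_apply _ _ _).trans ?_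
  rw [convMul_convMul_apply _ _ _ h h₁ h₂ h₃ hh, Finset.mul_sum]
  refine Finset.sum_congr rfl fun r _ => ?_
  simp only [pairConv_apply, P.τ_antipodeInv, Algebra.algebraMap_eq_smul_one, smul_mul_assoc,
    mul_smul_comm, one_mul, mul_one, smul_smul]
  rw [mul_comm (P.τ (a₁ s) _)]
  rfl

theorem mulHom_mul_actHom [HopfStarAlgebra A] (a : A) (h : U) {m n : ℕ} (a₁ a₂ a₃ : Fin m → A)
    (h₁ h₂ h₃ : Fin n → U)
    (ha : comul₃ a = ∑ i, a₁ i ⊗ₜ (a₂ i ⊗ₜ a₃ i)) (hh : comul₃ h = ∑ j, h₁ j ⊗ₜ (h₂ j ⊗ₜ h₃ j)) :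
    mulHom i a * actHom i j P hij h =
      ∑ s, ∑ r, (P.τ (antipodeInv (a₃ s)) (h₁ r) * P.τ (a₁ s) (h₃ r)) •
        (actHom i j P hij (h₂ r) * mulHom i (a₂ s)) := by
  have key := left_right_interchange (constConvHom_commute_pairConv P (mulHom i))
    (leftAct_interchange i P) (constConvHom_commute_toConv i j hij)
    (rightAct_interchange i P) a a₁ a₂ a₃ ha
  rw [← toConv_actHom i j P hij] at key
  have key' := congrArg (fun f => f.ofConv h) key
  refine (constConv_mul_apply _ _ _).symm.trans (key'.trans ?_)
  simp only [WithConv.ofConv_sum, LinearMap.sum_apply, constConvHom_apply]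
  refine Finset.sum_congr rfl fun s _ => (mul_constConv_apply _ _ _).trans ?_
  rw [mul_assoc (pairConv E P _), convMul_convMul_apply _ _ _ h h₁ h₂ h₃ hh, Finset.sum_mul]
  refine Finset.sum_congr rfl fun r _ => ?_
  simp only [pairConv_apply, Algebra.algebraMap_eq_smul_one, smul_mul_assoc,
    mul_smul_comm, one_mul, mul_one, smul_smul]
  rw [mul_comm (P.τ (a₁ s) _)]
  rfl

end

/-- The unit of `A` is invariant up to the counit under both actions, so on it the outer factors of
`actHom` contribute `ε(h₍₁₎) ε(h₍₃₎)` and only `h` itself remains. This is the computation showing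
that `h` acts on `1 ⊗ 1` as `1 ⊗ h`. -/
theorem map_actHom [HopfStarAlgebra U] {M : Type*} [AddCommGroup M] [Module ℂ M] (φ : E →ₗ[ℂ] M)
    (ψ : U →ₗ[ℂ] M) (h : U) (hφ : ∀ (x : Module.End ℂ A) (c : ℂ) (k : U), x 1 = c • (1 : A) →
      φ (i x * j k) = c • ψ k) : φ (actHom i j P hij h) = ψ h := by
  have e1 : ∀ k : U, φ (i.comp (leftAct P) k) = counit (R := ℂ) k • ψ 1 := fun k => by
    have := hφ _ _ 1 (leftAct_apply_one P k)
    rwa [map_one, mul_one] at this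
  rw [actHom, convHom_apply]
  have e2 : ∀ k l : U, φ (convHom (i.comp (leftAct P)) j (comp_leftAct_commute i j P hij) k *
      i.comp (rightAct P) l) = counit (R := ℂ) l • ψ k := fun k l => by
    rw [convHom_apply, Finset.sum_mul, map_sum]
    have e3 : ∀ x y : U, φ (i.comp (leftAct P) x * j y * i.comp (rightAct P) l) =
        counit (R := ℂ) x • counit (R := ℂ) l • ψ y := fun x y => by
      -- `j y` is moved out from between the two actions, so that their composite is a single
      -- endomorphism of `A` and `hφ` applies with the scalar `ε(x) ε(l)`.
      rw [AlgHom.comp_apply, AlgHom.comp_apply, mul_assoc, ← (hij _ y).eq, ← mul_assoc, ← map_mul,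
        hφ _ (counit (R := ℂ) x * counit (R := ℂ) l) y, mul_smul]
      rw [Module.End.mul_apply, rightAct_apply_one, map_smul, leftAct_apply_one, smul_smul,
        mul_comm]
    simp only [e3, smul_comm _ (counit (R := ℂ) l), ← Finset.smul_sum]
    congr 1
    conv_rhs => rw [← Coalgebra.sum_counit_smul (ℛ ℂ k)]
    simp only [map_sum, map_smul]
  simp only [map_sum, e2]
  conv_rhs => rw [← sum_counit_right_smul_left (ℛ ℂ h)]
  simp only [map_sum, map_smul]

end Represent

/-! ### Separating the factors `A` and `U` inside the Drinfeld double. -/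

namespace DrinfeldDouble

variable {A U : Type*} [Ring A] [HopfAlgebra ℂ A] [Ring U] [HopfAlgebra ℂ U]

theorem includeLeft_commute_includeRight (x : Module.End ℂ A) (y : U) :
    Commute (Algebra.TensorProduct.includeLeft (R := ℂ) (S := ℂ) (B := U) x)
      (Algebra.TensorProduct.includeRight y) := by
  simp [commute_iff_eq]

variable (A U) in
/-- The linear map `T ⊗ h ↦ T(1) ⊗ h`. -/
def evalOne : Module.End ℂ A ⊗[ℂ] U →ₗ[ℂ] A ⊗[ℂ] U := (LinearMap.applyₗ (1 : A)).rTensor U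

theorem evalOne_tmul (x : Module.End ℂ A) (h : U) : evalOne A U (x ⊗ₜ h) = x 1 ⊗ₜ h := rfl

variable [StarRing A] [StarRing U] [StarModule ℂ U] (P : UnitaryPairing A U)

theorem evalOne_actHom [HopfStarAlgebra U] (h : U) :
    evalOne A U (actHom (E := Module.End ℂ A ⊗[ℂ] U) Algebra.TensorProduct.includeLeft
      Algebra.TensorProduct.includeRight P includeLeft_commute_includeRight h) = 1 ⊗ₜ h :=
  map_actHom (E := Module.End ℂ A ⊗[ℂ] U) _ _ P _ (evalOne A U) (TensorProduct.mk ℂ A U 1) h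
    (fun x c k hx => by simp [hx, TensorProduct.smul_tmul', evalOne_tmul])

variable [StarModule ℂ A] [HopfStarAlgebra A]

/-- The representation of the Drinfeld double by an algebra over `End(A) ⊗ U`. -/
def lift {E : Type*} [Ring E] [Algebra ℂ E] (i : Module.End ℂ A →ₐ[ℂ] E) (j : U →ₐ[ℂ] E)
    (hij : ∀ x y, Commute (i x) (j y)) : DrinfeldDouble P →ₐ[ℂ] E :=
  RingQuot.liftAlgHom ℂ ⟨FreeAlgebra.lift ℂ (Sum.elim (mulHom i) (actHom i j P hij)), by
    rintro _ _ (_ | _ | _ | _ | _ | _ | _ | _ | ⟨a, h, a₁, a₂, a₃, h₁, h₂, h₃, ha, hh⟩ |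
      ⟨a, h, a₁, a₂, a₃, h₁, h₂, h₃, ha, hh⟩)
    · simp
    · simp
    · simp
    · simp
    · simp
    · simp
    · simp
    · simp
    · simpa using actHom_mul_mulHom i j P hij a h a₁ a₂ a₃ h₁ h₂ h₃ ha hh
    · simpa using mulHom_mul_actHom i j P hij a h a₁ a₂ a₃ h₁ h₂ h₃ ha hh⟩

theorem lift_inA {E : Type*} [Ring E] [Algebra ℂ E] (i : Module.End ℂ A →ₐ[ℂ] E) (j : U →ₐ[ℂ] E)
    (hij : ∀ x y, Commute (i x) (j y)) (a : A) : lift P i j hij (inA P a) = mulHom i a := by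
  refine (RingQuot.liftAlgHom_mkAlgHom_apply ℂ _ _ _).trans ?_
  simp

theorem lift_inU {E : Type*} [Ring E] [Algebra ℂ E] (i : Module.End ℂ A →ₐ[ℂ] E) (j : U →ₐ[ℂ] E)
    (hij : ∀ x y, Commute (i x) (j y)) (h : U) : lift P i j hij (inU P h) = actHom i j P hij h := by
  refine (RingQuot.liftAlgHom_mkAlgHom_apply ℂ _ _ _).trans ?_
  simp

/-- The linear map from the Drinfeld double to `A ⊗ U` which maps `a h` to `a ⊗ h`. -/
def toTensor : DrinfeldDouble P →ₗ[ℂ] A ⊗[ℂ] U :=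
  evalOne A U ∘ₗ (lift P (E := Module.End ℂ A ⊗[ℂ] U) Algebra.TensorProduct.includeLeft
      Algebra.TensorProduct.includeRight includeLeft_commute_includeRight).toLinearMap

/-- The multiplication map from `A ⊗ U` to the double has a left inverse, hence is injective; this
is the half of the triangular decomposition that linear independence needs. -/
theorem toTensor_inA_mul_inU [HopfStarAlgebra U] (a : A) (h : U) :
    toTensor P (inA P a * inU P h) = a ⊗ₜ h := by
  -- Evaluation at `1` intertwines left multiplication by `a` in `End(A)` with left multiplication
  -- in `A`, so the factor `a` can be pulled out in front of the action of `h`.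
  have key : ∀ x : Module.End ℂ A ⊗[ℂ] U, evalOne A U
      (mulHom (E := Module.End ℂ A ⊗[ℂ] U) Algebra.TensorProduct.includeLeft a * x) =
        (LinearMap.mulLeft ℂ a).rTensor U (evalOne A U x) := fun x => by
    induction x with
    | zero => simp
    | add x y hx hy => simp only [mul_add, map_add, hx, hy]
    | tmul x y => simp [mulHom, evalOne_tmul]
  rw [toTensor, LinearMap.comp_apply, AlgHom.toLinearMap_apply, map_mul, lift_inA, lift_inU, key,
    evalOne_actHom]
  simp

end DrinfeldDouble

/-! ### Operators on sequences used for the concrete representations. -/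

section Operators

/-- Diagonal operators on sequences. -/
def diagOp (d : ℕ → ℂ) : Module.End ℂ (ℕ → ℂ) where
  toFun p n := d n * p n
  map_add' p r := by ext n; simp [mul_add]
  map_smul' c p := by ext n; simp [mul_left_comm]

/-- The right shift on sequences. -/
def shiftOp : Module.End ℂ (ℕ → ℂ) where
  toFun p
    | 0 => 0
    | n + 1 => p n
  map_add' p r := by ext (_ | n) <;> simp
  map_smul' c p := by ext (_ | n) <;> simp

/-- Weighted left shifts on sequences. -/
def lowerOp (c : ℕ → ℂ) : Module.End ℂ (ℕ → ℂ) where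
  toFun p n := c (n + 1) * p (n + 1)
  map_add' p r := by ext n; simp [mul_add]
  map_smul' c p := by ext n; simp [mul_left_comm]

@[simp] theorem diagOp_apply (d p : ℕ → ℂ) (n : ℕ) : diagOp d p n = d n * p n := rfl
@[simp] theorem shiftOp_apply_zero (p : ℕ → ℂ) : shiftOp p 0 = 0 := rfl
@[simp] theorem shiftOp_apply_succ (p : ℕ → ℂ) (n : ℕ) : shiftOp p (n + 1) = p n := rfl
@[simp] theorem lowerOp_apply (c p : ℕ → ℂ) (n : ℕ) : lowerOp c p n = c (n + 1) * p (n + 1) := rfl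

theorem linearIndependent_of_triangular {v : ℕ → ℕ → ℂ} (h₀ : ∀ n m, n < m → v n m = 0)
    (h₁ : ∀ n, v n n ≠ 0) : LinearIndependent ℂ v := by
  rw [linearIndependent_iff']
  intro s g hg i hi
  by_contra hne
  -- At the largest index `j` with nonzero coefficient, coordinate `j` of the relation sees only the
  -- vector `v j`.
  obtain ⟨j, hj, hmax⟩ := (s.filter (fun i => g i ≠ 0)).exists_max_image id
    ⟨i, Finset.mem_filter.2 ⟨hi, hne⟩⟩
  rw [Finset.mem_filter] at hj
  have := congrFun hg j
  rw [Finset.sum_apply, Finset.sum_eq_single_of_mem j hj.1] at this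
  · exact mul_ne_zero hj.2 (h₁ j) (by simpa using this)
  · intro k hk hkj
    by_cases hgk : g k = 0
    · simp [hgk]
    · have : k ≤ j := hmax k (Finset.mem_filter.2 ⟨hk, hgk⟩)
      simp [h₀ k j (lt_of_le_of_ne this hkj)]

end Operators

/-! ### Independence of the powers of `B_t`, via a Verma module. -/

namespace Uq

variable (q : Set.Ioo (0 : ℝ) 1)

/-- The coefficients of the action of `e` on the Verma module of highest weight zero. -/
def vermaCoeff (n : ℕ) : ℂ :=
  ∑ m ∈ Finset.range n, (qc q - (qc q)⁻¹)⁻¹ * (((qc q ^ 2)⁻¹) ^ m - (qc q ^ 2) ^ m)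

/-- The action of the generators on the Verma module of highest weight zero. -/
def vermaGen : UqGen → Module.End ℂ (ℕ → ℂ)
  | .e => lowerOp (vermaCoeff q)
  | .f => shiftOp
  | .k => diagOp fun n => ((qc q ^ 2)⁻¹) ^ n
  | .kinv => diagOp fun n => (qc q ^ 2) ^ n

/-- The Verma module of highest weight zero. -/
def verma : Uq q →ₐ[ℂ] Module.End ℂ (ℕ → ℂ) :=
  lift (vermaGen q)
    (by ext p n; simp [vermaGen, qc_ne q])
    (by ext p n; simp [vermaGen, qc_ne q])
    (by
      have h := qc_ne q
      ext p n
      simp [vermaGen]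
      field_simp
      ring)
    (by
      have h := qc_ne q
      ext p (_ | n)
      · simp [vermaGen]
      · simp [vermaGen]
        field_simp
        ring)
    (by
      ext p (_ | n)
      · simp [vermaGen, vermaCoeff]
      -- Consecutive values of `vermaCoeff` differ by the eigenvalue of `(q - q⁻¹)⁻¹ (k - k⁻¹)`,
      -- which is what the commutator of `e` and `f` requires.
      · simp [vermaGen, vermaCoeff, Finset.sum_range_succ]
        ring)

@[simp] theorem verma_e : verma q e = lowerOp (vermaCoeff q) := lift_gen _ _ _ _ _ _ .e
@[simp] theorem verma_f : verma q f = shiftOp := lift_gen _ _ _ _ _ _ .f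
@[simp] theorem verma_k : verma q k = diagOp fun n => ((qc q ^ 2)⁻¹) ^ n :=
  lift_gen _ _ _ _ _ _ .k

/-- On the highest weight vector, `fk` raises the degree by one with nonzero weight, while `e`
lowers it and `k` preserves it. Hence `B_t ^ n` applied to that vector has degree exactly `n`, for
every `t`. -/
theorem linearIndependent_pow_elemB (t : ℝ) :
    LinearIndependent ℂ fun n : ℕ => elemB q t ^ n := by
  -- Only positive coordinates are needed: in the induction below the coordinates examined are `n +
  -- 1` and beyond.
  have hs : ∀ (p : ℕ → ℂ) (n : ℕ), verma q (elemB q t) p (n + 1) =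
      (qs q)⁻¹ * (vermaCoeff q (n + 2) * p (n + 2) - ((qc q ^ 2)⁻¹) ^ n * p n) -
        Complex.I * (qc q - (qc q)⁻¹)⁻¹ * (t : ℂ) * (((qc q ^ 2)⁻¹) ^ (n + 1) * p (n + 1)) := by
    intro p n
    simp [elemB]
  have key : ∀ n : ℕ, (∀ m, n < m → verma q (elemB q t ^ n) (Pi.single 0 1) m = 0) ∧
      verma q (elemB q t ^ n) (Pi.single 0 1) n ≠ 0 := by
    intro n
    induction n with
    | zero => exact ⟨fun m hm => by simp [hm.ne'], by simp⟩
    | succ n ih =>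
      rw [pow_succ', map_mul]
      constructor
      · rintro (_ | m) hm
        · omega
        · rw [Module.End.mul_apply, hs, ih.1 m (by omega), ih.1 (m + 1) (by omega),
            ih.1 (m + 2) (by omega)]
          simp
      · rw [Module.End.mul_apply, hs, ih.1 (n + 1) (by omega), ih.1 (n + 2) (by omega)]
        -- The new top coefficient is the old one times `-q^{-1/2} q^{-2n}`.
        simpa [qs_ne, qc_ne] using ih.2
  refine LinearIndependent.of_comp
    (LinearMap.applyₗ (Pi.single 0 1 : ℕ → ℂ) ∘ₗ (verma q).toLinearMap) ?_
  exact linearIndependent_of_triangular (fun n => (key n).1) (fun n => (key n).2)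

end Uq

section Monomials

/-- The powers of `x` and of `y`, indexed by the integers. -/
def signedPow {C : Type*} [Monoid C] (x y : C) : ℤ → C
  | .ofNat n => x ^ n
  | .negSucc n => y ^ (n + 1)

theorem map_signedPow {C D : Type*} [Monoid C] [Monoid D] {F : Type*} [FunLike F C D]
    [MonoidHomClass F C D] (φ : F) (x y : C) (m : ℤ) :
    φ (signedPow x y m) = signedPow (φ x) (φ y) m := by
  cases m <;> simp [signedPow]

end Monomials

/-! ### Independence of the monomials of the Podleś sphere in `O_q(SU(2))`. -/

namespace Oq

variable (q : Set.Ioo (0 : ℝ) 1)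

theorem elemX_eq (t : ℝ) : elemX q t =
    -((Complex.I * qc q) • (γ * γ)) - Complex.I • (α * α) - (t : ℂ) • (α * γ) := by
  simp [-Complex.coe_smul, elemX, matE, matU, matL, Matrix.mul_apply, Fin.sum_univ_two,
      Matrix.conjTranspose_apply]
  simp only [Algebra.algebraMap_eq_smul_one, add_mul, smul_mul_assoc, mul_smul_comm,
      mul_one, neg_mul]
  match_scalars <;> ring

theorem elemY_eq (t : ℝ) : elemY q t =
    Complex.I • (δ * δ) + (Complex.I * (qc q)⁻¹) • (β * β) + ((qc q)⁻¹ * (t : ℂ)) • (β * δ) := by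
  have h := qc_ne q
  simp [-Complex.coe_smul, elemY, matE, matU, matL, Matrix.mul_apply, Fin.sum_univ_two,
      Matrix.conjTranspose_apply]
  simp only [Algebra.algebraMap_eq_smul_one, add_mul, smul_mul_assoc, mul_smul_comm, mul_one]
  match_scalars <;> field_simp

theorem elemZ_eq (t : ℝ) : elemZ q t =
    Complex.I • (γ * δ) + Complex.I • (β * α) + (t : ℂ) • (β * γ) := by
  have h := qc_ne q
  simp [-Complex.coe_smul, elemZ, matE, matU, matL, Matrix.mul_apply, Fin.sum_univ_two,
      Matrix.conjTranspose_apply]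
  simp only [Algebra.algebraMap_eq_smul_one, add_mul, smul_mul_assoc, mul_smul_comm, mul_one,
      δ_mul_γ]
  match_scalars <;> field_simp

/-- The action of the generators in the representations which vanish on `γ`. -/
def borelGen (s : ℂ) : OqGen → Module.End ℂ (ℕ → ℂ)
  | .α => diagOp fun n => s * qc q ^ n
  | .β => shiftOp
  | .γ => 0
  | .δ => diagOp fun n => s⁻¹ * (qc q ^ n)⁻¹

/-- The representations which vanish on `γ`. -/
def borel (s : ℂˣ) : Oq q →ₐ[ℂ] Module.End ℂ (ℕ → ℂ) := by
  refine lift (borelGen q s) ?_ ?_ ?_ ?_ ?_ ?_ ?_ <;>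
  · have h := qc_ne q
    have h' := s.ne_zero
    ext p (_ | n) <;> simp [borelGen] <;> field_simp <;> ring

@[simp] theorem borel_α (s : ℂˣ) : borel q s α = diagOp fun n => s * qc q ^ n :=
  lift_gen _ _ _ _ _ _ _ _ .α
@[simp] theorem borel_β (s : ℂˣ) : borel q s β = shiftOp := lift_gen _ _ _ _ _ _ _ _ .β
@[simp] theorem borel_γ (s : ℂˣ) : borel q s γ = 0 := lift_gen _ _ _ _ _ _ _ _ .γ
@[simp] theorem borel_δ (s : ℂˣ) : borel q s δ = diagOp fun n => (s : ℂ)⁻¹ * (qc q ^ n)⁻¹ :=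
  lift_gen _ _ _ _ _ _ _ _ .δ

/-- With `γ = 0` only the term `-i α²` of `X_t` survives. -/
theorem borel_elemX (s : ℂˣ) (t : ℝ) :
    borel q s (elemX q t) = diagOp fun n => -(Complex.I * (s * qc q ^ n) ^ 2) := by
  ext p n
  simp [-Complex.coe_smul, elemX_eq]
  ring

/-- Besides `i δ²`, every term of `Y_t` begins with `β`, which acts as a right shift and so does not
reach coordinate `0`. -/
theorem borel_elemY_pow (s : ℂˣ) (t : ℝ) (n : ℕ) :
    borel q s (elemY q t ^ n) (Pi.single 0 1) 0 = (Complex.I * (s : ℂ)⁻¹ ^ 2) ^ n := by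
  induction n with
  | zero => simp
  | succ n ih =>
    rw [pow_succ', map_mul, Module.End.mul_apply, pow_succ', ← ih]
    simp [-Complex.coe_smul, elemY_eq]
    ring

theorem borel_elemX_pow (s : ℂˣ) (t : ℝ) (n : ℕ) :
    borel q s (elemX q t ^ n) (Pi.single 0 1) 0 = (-(Complex.I * (s : ℂ) ^ 2)) ^ n := by
  induction n with
  | zero => simp
  | succ n ih =>
    rw [pow_succ', map_mul, Module.End.mul_apply, pow_succ', ← ih, borel_elemX]
    simp

/-- On coordinate `0` the scalars given by `X_t` and `Y_t`, namely `-i s²` and `i s⁻²`, are mutually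
inverse, so both kinds of powers fit one integer exponent. -/
theorem borel_signedPow (s : ℂˣ) (t : ℝ) (m : ℤ) :
    borel q s (signedPow (elemX q t) (elemY q t) m) (Pi.single 0 1) 0 =
      (-(Complex.I * (s : ℂ) ^ 2)) ^ m := by
  cases m with
  | ofNat n => exact (borel_elemX_pow q s t n).trans (by simp)
  | negSucc n =>
    refine (borel_elemY_pow q s t (n + 1)).trans ?_
    rw [zpow_negSucc, ← inv_pow]
    congr 1
    rw [inv_neg, mul_inv, Complex.inv_I, inv_pow]
    ring

theorem borel_elemZ (s : ℂˣ) (t : ℝ) :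
    borel q s (elemZ q t) = Complex.I • (shiftOp * diagOp fun n => s * qc q ^ n) := by
  simp [-Complex.coe_smul, elemZ_eq]

/-- `Z_t` acts as a weighted right shift, so `Z_t ^ j` pushes everything to coordinates at least
`j`. Together with `borel_elemZ_pow_self` this lets coordinates detect the power of `Z_t`. -/
theorem borel_elemZ_pow_of_lt (s : ℂˣ) (t : ℝ) (p : ℕ → ℂ) (j : ℕ) : ∀ n < j,
    borel q s (elemZ q t ^ j) p n = 0 := by
  induction j with
  | zero => simp
  | succ j ih =>
    rw [pow_succ', map_mul, borel_elemZ]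
    rintro (_ | n) hn
    · simp
    · rw [Module.End.mul_apply]
      simp only [LinearMap.smul_apply, Pi.smul_apply, Module.End.mul_apply, shiftOp_apply_succ,
        diagOp_apply, ih n (by omega), mul_zero, smul_zero]

theorem borel_elemZ_pow_self (t : ℝ) (j : ℕ) : ∃ c : ℂ, c ≠ 0 ∧ ∀ (s : ℂˣ) (p : ℕ → ℂ),
    borel q s (elemZ q t ^ j) p j = c * (s : ℂ) ^ j * p 0 := by
  induction j with
  | zero => exact ⟨1, by simp⟩
  | succ j ih =>
    obtain ⟨c, hc, h⟩ := ih
    -- One more factor `Z_t` first scales coordinate `j` by `s q ^ j`, then shifts it to `j + 1` and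
    -- multiplies by `i`. The constant must not depend on `s`, so the power of `s` is kept apart.
    refine ⟨Complex.I * qc q ^ j * c, by simp [hc, qc_ne], fun s p => ?_⟩
    rw [pow_succ', map_mul, borel_elemZ, Module.End.mul_apply]
    simp only [LinearMap.smul_apply, Pi.smul_apply, Module.End.mul_apply, shiftOp_apply_succ,
      diagOp_apply, h, smul_eq_mul]
    ring

/-- Dedekind's independence of characters of the group `ℂˣ`; the characters `s ↦ s ^ m` are told
apart by the absolute value at `s = 2`. -/
theorem linearIndependent_units_zpow : LinearIndependent ℂ fun (m : ℤ) (s : ℂˣ) => (s : ℂ) ^ m := by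
  have h := (linearIndependent_monoidHom ℂˣ ℂ).comp
    (fun m : ℤ => (Units.coeHom ℂ).comp (zpowGroupHom m)) (fun m n hmn => by
      have := DFunLike.congr_fun hmn (Units.mk0 (2 : ℂ) two_ne_zero)
      simp only [MonoidHom.comp_apply, zpowGroupHom_apply, Units.coeHom_apply,
        Units.val_zpow_eq_zpow_val, Units.val_mk0] at this
      have h2 := congrArg norm this
      simp only [norm_zpow, Complex.norm_ofNat] at h2
      exact zpow_right_injective₀ (by norm_num) (by norm_num) h2)
  have e : (fun (m : ℤ) (s : ℂˣ) => (s : ℂ) ^ m) = (fun f : ℂˣ →* ℂ => (f : ℂˣ → ℂ)) ∘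
      fun m : ℤ => (Units.coeHom ℂ).comp (zpowGroupHom m) := by
    ext m s
    simp
  rw [e]
  exact h

/-- In a linear relation take the lowest power `j` of `Z_t` that occurs. Coordinate `j` of the
relation, applied to the basis vector at `0`, is a nonzero multiple of `s ^ j` times a Laurent
polynomial in `s²` that vanishes for all `s`, so its coefficients vanish. -/
theorem linearIndependent_monomials (t : ℝ) : LinearIndependent ℂ fun i : ℕ × ℤ =>
    elemZ q t ^ i.1 * signedPow (elemX q t) (elemY q t) i.2 := by
  rw [linearIndependent_iff']
  intro S g hg i hi
  by_contra hne
  obtain ⟨⟨j, m⟩, hj, hmin⟩ := (S.filter (fun i => g i ≠ 0)).exists_min_image Prod.fst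
    ⟨i, Finset.mem_filter.2 ⟨hi, hne⟩⟩
  rw [Finset.mem_filter] at hj
  obtain ⟨c, hc, hcs⟩ := borel_elemZ_pow_self q t j
  -- Coordinate `j` of the relation after division by `c * s ^ j`: terms with a higher power of
  -- `Z_t` vanish there, terms with a lower power have zero coefficient by the choice of `j`.
  have key : ∀ s : ℂˣ, ∑ i ∈ S, (if i.1 = j then g i * (-Complex.I) ^ i.2 else 0) *
      ((s : ℂ) ^ (2 * i.2)) = 0 := by
    intro s
    have h := congrFun (LinearMap.congr_fun (congrArg (borel q s) hg) (Pi.single 0 1)) j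
    simp only [map_sum, LinearMap.sum_apply, Finset.sum_apply, map_smul, map_mul, map_zero,
      LinearMap.smul_apply, Pi.smul_apply, LinearMap.zero_apply, Pi.zero_apply] at h
    have hcj : c * (s : ℂ) ^ j ≠ 0 := mul_ne_zero hc (pow_ne_zero _ s.ne_zero)
    refine (mul_eq_zero.1 ?_).resolve_left hcj
    rw [Finset.mul_sum]
    refine Eq.trans ?_ h
    refine Finset.sum_congr rfl fun i hi => ?_
    by_cases hgi : g i = 0
    · simp [hgi]
    have hle : j ≤ i.1 := hmin i (Finset.mem_filter.2 ⟨hi, hgi⟩)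
    rw [Module.End.mul_apply]
    split_ifs with hij
    · rw [hij, hcs, borel_signedPow, smul_eq_mul, neg_mul_eq_neg_mul, mul_zpow, zpow_mul]
      norm_cast
      ring
    · rw [borel_elemZ_pow_of_lt _ _ _ _ _ _ (lt_of_le_of_ne hle (Ne.symm hij))]
      simp
  have hli := linearIndependent_units_zpow.comp (fun m : ℤ => 2 * m)
    (fun a b h => by simpa using h)
  have hinj : Set.InjOn Prod.snd (S.filter (fun i => i.1 = j) : Set (ℕ × ℤ)) := by
    rintro ⟨a, b⟩ ha ⟨a', b'⟩ ha' h
    simp only [Finset.coe_filter, Set.mem_ofPred_eq] at ha ha' h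
    rw [ha.2, ha'.2, h]
  -- Re-index the surviving terms by the exponent of `X_t` or `Y_t` alone, giving a relation between
  -- the functions `s ↦ s ^ (2 n)`.
  have hfib : ∑ n ∈ (S.filter (fun i => i.1 = j)).image Prod.snd, (g (j, n) * (-Complex.I) ^ n) •
      (fun s : ℂˣ => (s : ℂ) ^ (2 * n)) = 0 := by
    ext s
    rw [Finset.sum_apply, Pi.zero_apply, ← key s, Finset.sum_image hinj, Finset.sum_filter]
    refine Finset.sum_congr rfl fun i _ => ?_
    split_ifs with hij
    · rw [← hij]; rfl
    · simp
  have := (linearIndependent_iff'.1 hli) _ _ hfib m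
    (Finset.mem_image.2 ⟨(j, m), Finset.mem_filter.2 ⟨hj.1, rfl⟩, rfl⟩)
  exact mul_ne_zero hj.2 (zpow_ne_zero _ (neg_ne_zero.2 Complex.I_ne_zero)) this

end Oq

/-! ### Relations inside `O_q(SU(2))`, by normal ordering. -/

/-- Lets a two-letter rewriting rule act at the head of a right-associated word. -/
theorem assoc_of_eq {R : Type*} [Ring R] {a b c : R} (h : a * b = c) (x : R) :
    a * (b * x) = c * x := by
  rw [← mul_assoc, h]

namespace Oq

variable (q : Set.Ioo (0 : ℝ) 1)

theorem α_mul_β : (α : Oq q) * β = qc q • (β * α) := by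
  rw [β_mul_α, smul_smul, q_mul_inv, one_smul]

theorem α_mul_γ : (α : Oq q) * γ = qc q • (γ * α) := by
  rw [γ_mul_α, smul_smul, q_mul_inv, one_smul]

theorem star_elemX (t : ℝ) : star (elemX q t) = elemY q t := by
  have h := qc_ne q
  simp [-Complex.coe_smul, elemX_eq, elemY_eq, smul_smul]
  match_scalars <;> field_simp

theorem star_elemZ (t : ℝ) : star (elemZ q t) = elemZ q t := by
  have h := qc_ne q
  simp [-Complex.coe_smul, elemZ_eq, α_mul_β, δ_mul_γ, γ_mul_β, smul_smul]
  match_scalars <;> field_simp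

theorem elemX_mul_elemZ (t : ℝ) : elemX q t * elemZ q t = qc q ^ 2 • (elemZ q t * elemX q t) := by
  have h := qc_ne q
  -- The rules order every word as powers of `β`, then `γ`, then of `α` or of `δ` alone; afterwards
  -- the two sides are compared coefficient by coefficient.
  simp only [elemX_eq, elemZ_eq, mul_add, add_mul, mul_sub, sub_mul, neg_mul, mul_neg,
    smul_mul_assoc, mul_smul_comm, mul_assoc, α_mul_β, α_mul_γ, γ_mul_β, δ_mul_β, δ_mul_γ, α_mul_δ,
    δ_mul_α, assoc_of_eq (α_mul_β q), assoc_of_eq (α_mul_γ q), assoc_of_eq (γ_mul_β (q := q)),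
    assoc_of_eq (δ_mul_β (q := q)), assoc_of_eq (δ_mul_γ (q := q)), assoc_of_eq (α_mul_δ (q := q)),
    assoc_of_eq (δ_mul_α (q := q)), one_mul, mul_one]
  match_scalars <;> field_simp <;> ring

theorem elemX_mul_elemY (t : ℝ) : elemX q t * elemY q t =
    1 - (qc q * (t : ℂ)) • elemZ q t - qc q ^ 2 • (elemZ q t * elemZ q t) := by
  have h := qc_ne q
  simp only [elemX_eq, elemY_eq, elemZ_eq, mul_add, add_mul, mul_sub, sub_mul, neg_mul, mul_neg,
    smul_mul_assoc, mul_smul_comm, mul_assoc, α_mul_β, α_mul_γ, γ_mul_β, δ_mul_β, δ_mul_γ, α_mul_δ,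
    δ_mul_α, assoc_of_eq (α_mul_β q), assoc_of_eq (α_mul_γ q), assoc_of_eq (γ_mul_β (q := q)),
    assoc_of_eq (δ_mul_β (q := q)), assoc_of_eq (δ_mul_γ (q := q)), assoc_of_eq (α_mul_δ (q := q)),
    assoc_of_eq (δ_mul_α (q := q)), one_mul, mul_one]
  match_scalars <;> field_simp <;> ring_nf <;> simp only [Complex.I_sq] <;> ring

theorem elemY_mul_elemX (t : ℝ) : elemY q t * elemX q t =
    1 - ((qc q)⁻¹ * (t : ℂ)) • elemZ q t - (qc q ^ 2)⁻¹ • (elemZ q t * elemZ q t) := by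
  have h := qc_ne q
  simp only [elemX_eq, elemY_eq, elemZ_eq, mul_add, add_mul, mul_sub, sub_mul, neg_mul, mul_neg,
    smul_mul_assoc, mul_smul_comm, mul_assoc, α_mul_β, α_mul_γ, γ_mul_β, δ_mul_β, δ_mul_γ, α_mul_δ,
    δ_mul_α, assoc_of_eq (α_mul_β q), assoc_of_eq (α_mul_γ q), assoc_of_eq (γ_mul_β (q := q)),
    assoc_of_eq (δ_mul_β (q := q)), assoc_of_eq (δ_mul_γ (q := q)), assoc_of_eq (α_mul_δ (q := q)),
    assoc_of_eq (δ_mul_α (q := q)), one_mul, mul_one]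
  match_scalars <;> field_simp <;> ring_nf <;> simp only [Complex.I_sq] <;> ring

end Oq

theorem Uq.star_elemB (q : Set.Ioo (0 : ℝ) 1) (t : ℝ) : star (elemB q t) = -elemB q t := by
  have h := qc_ne q
  have h' := qs_ne q
  simp [-Complex.coe_smul, elemB, Uq.k_mul_kinv_mul]
  match_scalars <;> field_simp

/-! ### Commutation of `B_t` with the sphere inside the double. -/

namespace UqSL2C

variable (q : Set.Ioo (0 : ℝ) 1)

/-- The canonical homomorphism `O_q(SU(2)) → U_q(sl(2, ℂ)_ℝ)`. -/
abbrev inA : Oq q →ₐ[ℂ] UqSL2C q := DrinfeldDouble.inA (su2Pairing q)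

/-- The canonical homomorphism `U_q(su(2)) → U_q(sl(2, ℂ)_ℝ)`. -/
abbrev inU : Uq q →ₐ[ℂ] UqSL2C q := DrinfeldDouble.inU (su2Pairing q)

theorem comul_matU (i j : Fin 2) :
    comul (R := ℂ) (matU q i j) = ∑ k, matU q i k ⊗ₜ matU q k j := by
  fin_cases i <;> fin_cases j <;> simp [matU]

/-- The index `s` runs through the pairs `(k, l)` in lexicographic order, the term being `u_{ik} ⊗
u_{kl} ⊗ u_{lj}`. -/
theorem comul₃_matU (i j : Fin 2) : comul₃ (matU q i j) =
    ∑ s : Fin 4, ![matU q i 0, matU q i 0, matU q i 1, matU q i 1] s ⊗ₜ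
      (![matU q 0 0, matU q 0 1, matU q 1 0, matU q 1 1] s ⊗ₜ
        ![matU q 0 j, matU q 1 j, matU q 0 j, matU q 1 j] s) := by
  rw [comul₃, comul_matU]
  simp [comul_matU, Fin.sum_univ_succ, TensorProduct.tmul_add, add_assoc]

theorem τ_matU (i j : Fin 2) (h : Uq q) : (su2Pairing q).τ (matU q i j) h = Uq.spin h i j := by
  fin_cases i <;> fin_cases j <;> simp [matU, su2Pairing]

/-- For the fundamental corepresentation the pairings in the interchange relation are entries of
spin `1/2` matrices, so moving `h` past a generator needs only its iterated coproduct. -/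
theorem inU_mul_inA_matU (i j : Fin 2) (h : Uq q) {n : ℕ} (h₁ h₂ h₃ : Fin n → Uq q)
    (hh : comul₃ h = ∑ r, h₁ r ⊗ₜ (h₂ r ⊗ₜ h₃ r)) :
    inU q h * inA q (matU q i j) = ∑ r, ∑ k, ∑ l,
      (Uq.spin (h₁ r) l j * Uq.spin (antipodeInv (h₃ r)) i k) •
        (inA q (matU q k l) * inU q (h₂ r)) := by
  refine (DrinfeldDouble.inU_mul_inA _ _ _ _ _ _ h₁ h₂ h₃ (comul₃_matU q i j) hh).trans ?_
  rw [Finset.sum_comm]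
  refine Finset.sum_congr rfl fun r _ => ?_
  simp [Fin.sum_univ_succ, τ_matU, add_assoc]

theorem antipodeInv_kinv : antipodeInv (Uq.kinv : Uq q) = Uq.k := by simp [antipodeInv]

theorem spin_antipodeInv_e :
    Uq.spin (antipodeInv (Uq.e : Uq q)) = !![0, -(qs q * qc q); 0, 0] := by
  rw [antipodeInv, Uq.star_e, HopfAlgebra.antipode_mul_antidistrib]
  ext i j
  fin_cases i <;> fin_cases j <;> simp [mul_assoc, Uq.k_mul_kinv_mul, qc_ne]

theorem spin_antipodeInv_f :
    Uq.spin (antipodeInv (Uq.f : Uq q)) = !![0, 0; -((qc q)⁻¹ * (qs q)⁻¹), 0] := by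
  rw [antipodeInv, Uq.star_f, HopfAlgebra.antipode_mul_antidistrib]
  ext i j
  fin_cases i <;> fin_cases j <;> simp [mul_assoc, Uq.kinv_mul_k, qc_ne]

theorem inU_k_mul (i j : Fin 2) : inU q Uq.k * inA q (matU q i j) = ∑ k, ∑ l,
    (!![qc q, 0; 0, (qc q)⁻¹] l j * !![(qc q)⁻¹, 0; 0, qc q] i k) •
      (inA q (matU q k l) * inU q Uq.k) := by
  refine (inU_mul_inA_matU q i j _ ![Uq.k] ![Uq.k] ![Uq.k] (by simp [comul₃])).trans ?_
  simp [antipodeInv]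

theorem inU_kinv_mul (i j : Fin 2) : inU q Uq.kinv * inA q (matU q i j) = ∑ k, ∑ l,
    (!![(qc q)⁻¹, 0; 0, qc q] l j * !![qc q, 0; 0, (qc q)⁻¹] i k) •
      (inA q (matU q k l) * inU q Uq.kinv) := by
  refine (inU_mul_inA_matU q i j _ ![Uq.kinv] ![Uq.kinv] ![Uq.kinv] (by simp [comul₃])).trans ?_
  simp [antipodeInv]

theorem inU_e_mul (i j : Fin 2) : inU q Uq.e * inA q (matU q i j) =
    (∑ l, (!![0, qs q; 0, 0] : Matrix _ _ ℂ) l j • inA q (matU q i l)) +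
    (∑ l, (!![qc q, 0; 0, (qc q)⁻¹] : Matrix _ _ ℂ) l j • (inA q (matU q i l) * inU q Uq.e)) +
    ∑ k, ∑ l, (!![qc q, 0; 0, (qc q)⁻¹] l j * !![0, -(qs q * qc q); 0, 0] i k) •
      (inA q (matU q k l) * inU q Uq.k) := by
  -- The iterated coproduct of `e` is `e ⊗ 1 ⊗ 1 + k ⊗ e ⊗ 1 + k ⊗ k ⊗ e`.
  refine (inU_mul_inA_matU q i j _ ![Uq.e, Uq.k, Uq.k] ![1, Uq.e, Uq.k] ![1, 1, Uq.e] (by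
    simp [comul₃, Fin.sum_univ_succ, TensorProduct.tmul_add, Algebra.TensorProduct.one_def,
      add_assoc])).trans ?_
  fin_cases i <;> fin_cases j <;>
    simp [spin_antipodeInv_e, spin_antipodeInv_f, antipodeInv_one, Fin.sum_univ_succ,
      antipodeInv_kinv, Matrix.mul_apply, Matrix.one_apply, add_assoc]

theorem inU_f_mul (i j : Fin 2) : inU q Uq.f * inA q (matU q i j) =
    (∑ k, ∑ l, (!![0, 0; (qs q)⁻¹, 0] l j * !![qc q, 0; 0, (qc q)⁻¹] i k) •
      (inA q (matU q k l) * inU q Uq.kinv)) +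
    (∑ k, (!![qc q, 0; 0, (qc q)⁻¹] : Matrix _ _ ℂ) i k • (inA q (matU q k j) * inU q Uq.f)) +
    ∑ k, (!![0, 0; -((qc q)⁻¹ * (qs q)⁻¹), 0] : Matrix _ _ ℂ) i k • inA q (matU q k j) := by
  -- The iterated coproduct of `f` is `f ⊗ k⁻¹ ⊗ k⁻¹ + 1 ⊗ f ⊗ k⁻¹ + 1 ⊗ 1 ⊗ f`.
  refine (inU_mul_inA_matU q i j _ ![Uq.f, 1, 1] ![Uq.kinv, Uq.f, 1] ![Uq.kinv, Uq.kinv, Uq.f] (by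
    simp [comul₃, Fin.sum_univ_succ, TensorProduct.tmul_add, Algebra.TensorProduct.one_def,
      add_assoc])).trans ?_
  fin_cases i <;> fin_cases j <;>
    simp [spin_antipodeInv_e, spin_antipodeInv_f, antipodeInv_one, Fin.sum_univ_succ,
      antipodeInv_kinv, Matrix.mul_apply, Matrix.one_apply, add_assoc]

theorem k_mul_α : inU q Uq.k * inA q Oq.α = inA q Oq.α * inU q Uq.k := by
  simpa [matU, qc_ne q] using inU_k_mul q 0 0

theorem k_mul_β : inU q Uq.k * inA q Oq.β = (qc q ^ 2)⁻¹ • (inA q Oq.β * inU q Uq.k) := by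
  simpa [matU, qc_ne q, sq] using inU_k_mul q 0 1

theorem k_mul_γ : inU q Uq.k * inA q Oq.γ = qc q ^ 2 • (inA q Oq.γ * inU q Uq.k) := by
  simpa [matU, qc_ne q, sq] using inU_k_mul q 1 0

theorem k_mul_δ : inU q Uq.k * inA q Oq.δ = inA q Oq.δ * inU q Uq.k := by
  simpa [matU, qc_ne q] using inU_k_mul q 1 1

theorem kinv_mul_α : inU q Uq.kinv * inA q Oq.α = inA q Oq.α * inU q Uq.kinv := by
  simpa [matU, qc_ne q] using inU_kinv_mul q 0 0

theorem kinv_mul_γ :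
    inU q Uq.kinv * inA q Oq.γ = (qc q ^ 2)⁻¹ • (inA q Oq.γ * inU q Uq.kinv) := by
  simpa [matU, qc_ne q, sq] using inU_kinv_mul q 1 0

theorem kinv_mul_δ : inU q Uq.kinv * inA q Oq.δ = inA q Oq.δ * inU q Uq.kinv := by
  simpa [matU, qc_ne q] using inU_kinv_mul q 1 1

theorem e_mul_α : inU q Uq.e * inA q Oq.α = qc q • (inA q Oq.α * inU q Uq.e) -
    (qc q * qs q * qc q) • (inA q Oq.γ * inU q Uq.k) := by
  simpa [matU, sub_eq_add_neg, mul_assoc] using inU_e_mul q 0 0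

theorem e_mul_β : inU q Uq.e * inA q Oq.β = qs q • inA q Oq.α +
    (qc q)⁻¹ • (inA q Oq.β * inU q Uq.e) - qs q • (inA q Oq.δ * inU q Uq.k) := by
  simpa [matU, sub_eq_add_neg, mul_left_comm _ (qs q), qc_ne q] using inU_e_mul q 0 1

theorem e_mul_γ : inU q Uq.e * inA q Oq.γ = qc q • (inA q Oq.γ * inU q Uq.e) := by
  simpa [matU] using inU_e_mul q 1 0

theorem e_mul_δ : inU q Uq.e * inA q Oq.δ = qs q • inA q Oq.γ +
    (qc q)⁻¹ • (inA q Oq.δ * inU q Uq.e) := by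
  simpa [matU] using inU_e_mul q 1 1

theorem f_mul_α : inU q Uq.f * inA q Oq.α = ((qs q)⁻¹ * qc q) • (inA q Oq.β * inU q Uq.kinv) +
    qc q • (inA q Oq.α * inU q Uq.f) := by
  simpa [matU] using inU_f_mul q 0 0

theorem f_mul_β : inU q Uq.f * inA q Oq.β = qc q • (inA q Oq.β * inU q Uq.f) := by
  simpa [matU] using inU_f_mul q 0 1

theorem f_mul_γ : inU q Uq.f * inA q Oq.γ =
    ((qs q)⁻¹ * (qc q)⁻¹) • (inA q Oq.δ * inU q Uq.kinv) +
    (qc q)⁻¹ • (inA q Oq.γ * inU q Uq.f) - ((qc q)⁻¹ * (qs q)⁻¹) • inA q Oq.α := by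
  simpa [matU, sub_eq_add_neg] using inU_f_mul q 1 0

theorem f_mul_δ : inU q Uq.f * inA q Oq.δ =
    (qc q)⁻¹ • (inA q Oq.δ * inU q Uq.f) - ((qc q)⁻¹ * (qs q)⁻¹) • inA q Oq.β := by
  simpa [matU, sub_eq_add_neg] using inU_f_mul q 1 1

theorem kinv_mul_k : inU q Uq.kinv * inU q Uq.k = 1 := by
  rw [← map_mul, Uq.kinv_mul_k, map_one]

theorem α_mul_β : inA q Oq.α * inA q Oq.β = qc q • (inA q Oq.β * inA q Oq.α) := by
  rw [← map_mul, Oq.α_mul_β, map_smul, map_mul]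

theorem α_mul_γ : inA q Oq.α * inA q Oq.γ = qc q • (inA q Oq.γ * inA q Oq.α) := by
  rw [← map_mul, Oq.α_mul_γ, map_smul, map_mul]

theorem γ_mul_β : inA q Oq.γ * inA q Oq.β = inA q Oq.β * inA q Oq.γ := by
  rw [← map_mul, Oq.γ_mul_β, map_mul]

theorem δ_mul_γ : inA q Oq.δ * inA q Oq.γ = (qc q)⁻¹ • (inA q Oq.γ * inA q Oq.δ) := by
  rw [← map_mul, Oq.δ_mul_γ, map_smul, map_mul]

theorem α_mul_δ : inA q Oq.α * inA q Oq.δ = 1 + qc q • (inA q Oq.β * inA q Oq.γ) := by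
  rw [← map_mul, Oq.α_mul_δ, map_add, map_one, map_smul, map_mul]

theorem δ_mul_α : inA q Oq.δ * inA q Oq.α = 1 + (qc q)⁻¹ • (inA q Oq.β * inA q Oq.γ) := by
  rw [← map_mul, Oq.δ_mul_α, map_add, map_one, map_smul, map_mul]

theorem inU_elemB (t : ℝ) : inU q (elemB q t) =
    (qs q)⁻¹ • (inU q Uq.e - inU q Uq.f * inU q Uq.k) -
      (Complex.I * (qc q - (qc q)⁻¹)⁻¹ * (t : ℂ)) • inU q Uq.k := by
  simp only [elemB, map_sub, map_smul, map_mul]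

theorem elemB_mul_elemZ (t : ℝ) : inU q (elemB q t) * inA q (elemZ q t) =
    inA q (elemZ q t) * inU q (elemB q t) - (inA q (elemX q t) + inA q (elemY q t)) := by
  have h := qc_ne q
  have h1 := qs_ne q
  have h2 := Uq.qc_sq_sub_ne (q := q)
  have hq : qs q ^ 2 = qc q := by rw [sq, qs_sq]
  rw [inU_elemB, Oq.elemX_eq, Oq.elemY_eq, Oq.elemZ_eq]
  -- All elements of `U_q(su(2))` are moved to the right of the words in `α, β, γ, δ`, and those
  -- words are put in normal order. The `k⁻¹` created when `f` passes a letter is absorbed by the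
  -- `k` of `fk`.
  simp only [map_add, map_sub, map_smul, map_mul, map_neg, mul_add, add_mul, mul_sub, sub_mul,
    neg_mul, mul_neg, smul_mul_assoc, mul_smul_comm, mul_assoc,
    α_mul_β, α_mul_γ, γ_mul_β, δ_mul_γ, α_mul_δ, δ_mul_α,
    assoc_of_eq (α_mul_β q), assoc_of_eq (α_mul_γ q), assoc_of_eq (γ_mul_β q),
    assoc_of_eq (δ_mul_γ q), assoc_of_eq (α_mul_δ q),
    assoc_of_eq (δ_mul_α q), one_mul, mul_one,
    k_mul_α, k_mul_β, k_mul_γ, k_mul_δ, kinv_mul_α, kinv_mul_γ, kinv_mul_δ,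
    e_mul_α, e_mul_β, e_mul_γ, e_mul_δ, f_mul_α, f_mul_β, f_mul_γ, f_mul_δ, kinv_mul_k,
    assoc_of_eq (k_mul_α q), assoc_of_eq (k_mul_β q), assoc_of_eq (k_mul_γ q),
    assoc_of_eq (k_mul_δ q), assoc_of_eq (kinv_mul_α q),
    assoc_of_eq (kinv_mul_γ q), assoc_of_eq (kinv_mul_δ q), assoc_of_eq (e_mul_α q),
    assoc_of_eq (e_mul_β q), assoc_of_eq (e_mul_γ q), assoc_of_eq (e_mul_δ q),
    assoc_of_eq (f_mul_α q), assoc_of_eq (f_mul_β q), assoc_of_eq (f_mul_γ q),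
    assoc_of_eq (f_mul_δ q)]
  match_scalars <;> field_simp <;> ring_nf <;> simp only [Complex.I_sq, hq] <;> ring

theorem elemB_mul_elemX (t : ℝ) : inU q (elemB q t) * inA q (elemX q t) =
    qc q ^ 2 • (inA q (elemX q t) * inU q (elemB q t)) +
      qc q • ((qc q + (qc q)⁻¹) • inA q (elemZ q t) + algebraMap ℂ _ (t : ℂ)) := by
  have h := qc_ne q
  have h1 := qs_ne q
  have h2 := Uq.qc_sq_sub_ne (q := q)
  have hq : qs q ^ 2 = qc q := by rw [sq, qs_sq]
  rw [inU_elemB, Algebra.algebraMap_eq_smul_one, Oq.elemX_eq, Oq.elemZ_eq]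
  simp only [map_add, map_sub, map_smul, map_mul, map_neg, mul_add, add_mul, mul_sub, sub_mul,
    neg_mul, mul_neg, smul_mul_assoc, mul_smul_comm, mul_assoc,
    α_mul_β, α_mul_γ, γ_mul_β, δ_mul_γ, α_mul_δ, δ_mul_α,
    assoc_of_eq (α_mul_β q), assoc_of_eq (α_mul_γ q), assoc_of_eq (γ_mul_β q),
    assoc_of_eq (δ_mul_γ q), assoc_of_eq (α_mul_δ q),
    assoc_of_eq (δ_mul_α q), one_mul, mul_one,
    k_mul_α, k_mul_β, k_mul_γ, k_mul_δ, kinv_mul_α, kinv_mul_γ, kinv_mul_δ,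
    e_mul_α, e_mul_β, e_mul_γ, e_mul_δ, f_mul_α, f_mul_β, f_mul_γ, f_mul_δ, kinv_mul_k,
    assoc_of_eq (k_mul_α q), assoc_of_eq (k_mul_β q), assoc_of_eq (k_mul_γ q),
    assoc_of_eq (k_mul_δ q), assoc_of_eq (kinv_mul_α q),
    assoc_of_eq (kinv_mul_γ q), assoc_of_eq (kinv_mul_δ q), assoc_of_eq (e_mul_α q),
    assoc_of_eq (e_mul_β q), assoc_of_eq (e_mul_γ q), assoc_of_eq (e_mul_δ q),
    assoc_of_eq (f_mul_α q), assoc_of_eq (f_mul_β q), assoc_of_eq (f_mul_γ q),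
    assoc_of_eq (f_mul_δ q)]
  match_scalars <;> field_simp <;> ring_nf <;> simp only [Complex.I_sq, hq] <;> ring

end UqSL2C

/-! ### Spanning by ordered monomials, from the relations alone. -/

/-- A span stable under left multiplication by generators is a left ideal of the generated algebra's
action; applied to `1` in the span, it shows that the whole algebra lies in the span. -/
theorem mul_mem_span_range_of_mem_adjoin {C ι : Type*} [Ring C] [Algebra ℂ C] {s : Set C}
    {v : ι → C} (hv : ∀ g ∈ s, ∀ i, g * v i ∈ Submodule.span ℂ (Set.range v)) {p : C}
    (hp : p ∈ Algebra.adjoin ℂ s) :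
    ∀ m ∈ Submodule.span ℂ (Set.range v), p * m ∈ Submodule.span ℂ (Set.range v) := by
  induction hp using Algebra.adjoin_induction with
  | mem g hg =>
    intro m hm
    induction hm using Submodule.span_induction with
    | mem m hm => obtain ⟨i, rfl⟩ := hm; exact hv g hg i
    | zero => simp
    | add a b _ _ ha hb => rw [mul_add]; exact add_mem ha hb
    | smul c a _ ha => rw [mul_smul_comm]; exact Submodule.smul_mem _ _ ha
  | algebraMap c =>
    intro m hm
    rw [← Algebra.smul_def]
    exact Submodule.smul_mem _ _ hm
  | add a b _ _ ha hb =>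
    intro m hm
    rw [add_mul]
    exact add_mem (ha m hm) (hb m hm)
  | mul a b _ _ ha hb =>
    intro m hm
    rw [mul_assoc]
    exact ha _ (hb m hm)

namespace SL2RRelations

variable {q t : ℝ} {C : Type*} [Ring C] [Algebra ℂ C] {x y z b : C}

theorem mul_pow_of_mul_eq_smul {x z : C} {c : ℂ} (h : x * z = c • (z * x)) (j : ℕ) :
    x * z ^ j = c ^ j • (z ^ j * x) := by
  induction j with
  | zero => simp
  | succ j ih =>
    rw [pow_succ, ← mul_assoc, ih, smul_mul_assoc, mul_assoc, h, mul_smul_comm, smul_smul,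
      ← pow_succ, mul_assoc]

/-- The span of the elements `z ^ j * x ^ m` and `z ^ j * y ^ m`. -/
abbrev sphereSpan (x y z : C) : Submodule ℂ C :=
  Submodule.span ℂ (Set.range fun i : ℕ × ℤ => z ^ i.1 * signedPow x y i.2)

theorem monomial_mem (x y z : C) (j : ℕ) (m : ℤ) : z ^ j * signedPow x y m ∈ sphereSpan x y z :=
  Submodule.subset_span ⟨(j, m), rfl⟩

/-- The factor in parentheses has the shape of the right-hand sides for `x * y` and `y * x`. -/
theorem pow_mul_quadratic_mem (x y z : C) (a c : ℂ) (j : ℕ) (m : ℤ) :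
    z ^ j * ((1 - a • z - c • z ^ 2) * signedPow x y m) ∈ sphereSpan x y z := by
  have h : z ^ j * ((1 - a • z - c • z ^ 2) * signedPow x y m) = z ^ j * signedPow x y m -
      a • (z ^ (j + 1) * signedPow x y m) - c • (z ^ (j + 2) * signedPow x y m) := by
    simp only [sub_mul, mul_sub, smul_mul_assoc, mul_smul_comm, one_mul, pow_add, mul_assoc,
      pow_one]
  rw [h]
  exact sub_mem (sub_mem (monomial_mem _ _ _ _ _) (Submodule.smul_mem _ _ (monomial_mem _ _ _ _ _)))
    (Submodule.smul_mem _ _ (monomial_mem _ _ _ _ _))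

theorem z_mul_monomial_mem (x y z : C) (i : ℕ × ℤ) :
    z * (z ^ i.1 * signedPow x y i.2) ∈ sphereSpan x y z := by
  rw [← mul_assoc, ← pow_succ']
  exact monomial_mem _ _ _ _ _

/-- The ordered monomials in `x`, `y`, `z`, `b`. -/
abbrev monomial (x y z b : C) (i : (ℕ × ℤ) × ℕ) : C :=
  z ^ i.1.1 * signedPow x y i.1.2 * b ^ i.2

theorem mul_pow_mem_span_monomial (b : C) {a : C} (ha : a ∈ sphereSpan x y z) (n : ℕ) :
    a * b ^ n ∈ Submodule.span ℂ (Set.range (monomial x y z b)) := by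
  induction ha using Submodule.span_induction with
  | mem m hm => obtain ⟨i, rfl⟩ := hm; exact Submodule.subset_span ⟨(i, n), rfl⟩
  | zero => simp
  | add a b _ _ ha hb => rw [add_mul]; exact add_mem ha hb
  | smul c a _ ha => rw [smul_mul_assoc]; exact Submodule.smul_mem _ _ ha

variable [StarRing C]

/-- `x` passes the power of `z` up to a scalar, then either lengthens a power of `x` or cancels one
`y` at the price of a quadratic polynomial in `z`. -/
theorem x_mul_monomial_mem (h : SL2RRelations q t x y z b) (i : ℕ × ℤ) :
    x * (z ^ i.1 * signedPow x y i.2) ∈ sphereSpan x y z := by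
  obtain ⟨j, m⟩ := i
  simp only
  rw [← mul_assoc, mul_pow_of_mul_eq_smul h.x_z, smul_mul_assoc, mul_assoc]
  refine Submodule.smul_mem _ _ ?_
  match m with
  | .ofNat n =>
    have : x * signedPow x y (.ofNat n) = signedPow x y (.ofNat (n + 1)) := (pow_succ' x n).symm
    rw [this]
    exact monomial_mem _ _ _ _ _
  -- This case is `y ^ 1`: cancelling one `y` leaves `1`, which `signedPow` represents by the
  -- nonnegative exponent `0`.
  | .negSucc 0 =>
    have : x * signedPow x y (.negSucc 0) = (x * y) * signedPow x y (.ofNat 0) := by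
      simp [signedPow]
    rw [this, h.x_y]
    exact pow_mul_quadratic_mem _ _ _ _ _ _ _
  | .negSucc (n + 1) =>
    have : x * signedPow x y (.negSucc (n + 1)) = (x * y) * signedPow x y (.negSucc n) := by
      simp only [signedPow]
      rw [pow_succ' y (n + 1), mul_assoc]
    rw [this, h.x_y]
    exact pow_mul_quadratic_mem _ _ _ _ _ _ _

theorem y_mul_monomial_mem (h : SL2RRelations q t x y z b) (i : ℕ × ℤ) :
    y * (z ^ i.1 * signedPow x y i.2) ∈ sphereSpan x y z := by
  obtain ⟨j, m⟩ := i
  simp only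
  rw [← mul_assoc, mul_pow_of_mul_eq_smul h.y_z, smul_mul_assoc, mul_assoc]
  refine Submodule.smul_mem _ _ ?_
  match m with
  | .negSucc n =>
    have : y * signedPow x y (.negSucc n) = signedPow x y (.negSucc (n + 1)) :=
      (pow_succ' y (n + 1)).symm
    rw [this]
    exact monomial_mem _ _ _ _ _
  | .ofNat 0 =>
    have : y * signedPow x y (.ofNat 0) = signedPow x y (.negSucc 0) := by simp [signedPow]
    rw [this]
    exact monomial_mem _ _ _ _ _
  | .ofNat (n + 1) =>
    have : y * signedPow x y (.ofNat (n + 1)) = (y * x) * signedPow x y (.ofNat n) := by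
      simp only [signedPow]
      rw [pow_succ' x n, mul_assoc]
    rw [this, h.y_x]
    exact pow_mul_quadratic_mem _ _ _ _ _ _ _

theorem mem_sphereSpan (h : SL2RRelations q t x y z b) {p : C}
    (hp : p ∈ Algebra.adjoin ℂ {x, y, z}) : p ∈ sphereSpan x y z := by
  have h1 : (1 : C) ∈ sphereSpan x y z := by simpa [signedPow] using monomial_mem x y z 0 (.ofNat 0)
  rw [← mul_one p]
  refine mul_mem_span_range_of_mem_adjoin ?_ hp 1 h1
  rintro g (rfl | rfl | rfl) i
  · exact h.x_mul_monomial_mem i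
  · exact h.y_mul_monomial_mem i
  · exact z_mul_monomial_mem _ _ _ i

/-- The algebra generated by `b` over that of `x, y, z` behaves like an Ore extension: `b` passes
each generator up to a scalar and a remainder free of `b`, and this property is stable under sums
and products. -/
theorem exists_b_mul_eq (h : SL2RRelations q t x y z b) {p : C}
    (hp : p ∈ Algebra.adjoin ℂ {x, y, z}) :
    ∃ p₁ ∈ Algebra.adjoin ℂ {x, y, z}, ∃ p₂ ∈ Algebra.adjoin ℂ {x, y, z},
      b * p = p₁ * b + p₂ := by
  have hx : x ∈ Algebra.adjoin ℂ {x, y, z} := Algebra.subset_adjoin (by simp)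
  have hy : y ∈ Algebra.adjoin ℂ {x, y, z} := Algebra.subset_adjoin (by simp)
  have hz : z ∈ Algebra.adjoin ℂ {x, y, z} := Algebra.subset_adjoin (by simp)
  have hl (c : ℂ) : c • z + algebraMap ℂ C t ∈ Algebra.adjoin ℂ {x, y, z} :=
    add_mem (Subalgebra.smul_mem _ hz c) (Subalgebra.algebraMap_mem _ _)
  induction hp using Algebra.adjoin_induction with
  | mem p hp =>
    obtain rfl | rfl | rfl := hp
    · exact ⟨_, Subalgebra.smul_mem _ hx _, _, Subalgebra.smul_mem _ (hl _) _,
        by rw [h.b_x, smul_mul_assoc]⟩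
    · exact ⟨_, Subalgebra.smul_mem _ hy _, _, Subalgebra.smul_mem _ (hl _) _,
        by rw [h.b_y, smul_mul_assoc]⟩
    · exact ⟨_, hz, _, neg_mem (add_mem hx hy), by rw [h.b_z, sub_eq_add_neg]⟩
  | algebraMap c =>
    exact ⟨_, Subalgebra.algebraMap_mem _ c, 0, zero_mem _, by rw [add_zero, Algebra.commutes]⟩
  | add p p' _ _ hp hp' =>
    obtain ⟨p₁, h₁, p₂, h₂, e⟩ := hp
    obtain ⟨p₁', h₁', p₂', h₂', e'⟩ := hp'
    exact ⟨_, add_mem h₁ h₁', _, add_mem h₂ h₂', by rw [mul_add, e, e', add_mul]; abel⟩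
  | mul p p' _ hpm hp hp' =>
    obtain ⟨p₁, h₁, p₂, h₂, e⟩ := hp
    obtain ⟨p₁', h₁', p₂', h₂', e'⟩ := hp'
    exact ⟨_, mul_mem h₁ h₁', _, add_mem (mul_mem h₁ h₂') (mul_mem h₂ hpm), by
      rw [← mul_assoc, e, add_mul, mul_assoc, e', mul_add, mul_assoc, add_assoc]⟩

theorem mem_span_monomial (h : SL2RRelations q t x y z b) {p : C}
    (hp : p ∈ Algebra.adjoin ℂ {x, y, z, b}) :
    p ∈ Submodule.span ℂ (Set.range (monomial x y z b)) := by
  have h1 : (1 : C) ∈ Submodule.span ℂ (Set.range (monomial x y z b)) :=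
    Submodule.subset_span ⟨((0, .ofNat 0), 0), by
      change z ^ 0 * x ^ 0 * b ^ 0 = 1
      simp⟩
  rw [← mul_one p]
  refine mul_mem_span_range_of_mem_adjoin ?_ hp 1 h1
  have hx : x ∈ Algebra.adjoin ℂ {x, y, z} := Algebra.subset_adjoin (by simp)
  have hy : y ∈ Algebra.adjoin ℂ {x, y, z} := Algebra.subset_adjoin (by simp)
  have hz : z ∈ Algebra.adjoin ℂ {x, y, z} := Algebra.subset_adjoin (by simp)
  have hm (m : ℤ) : signedPow x y m ∈ Algebra.adjoin ℂ {x, y, z} :=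
    match m with
    | .ofNat n => pow_mem hx n
    | .negSucc n => pow_mem hy (n + 1)
  rintro g (rfl | rfl | rfl | rfl) ⟨i, n⟩
  · rw [← mul_assoc]
    exact mul_pow_mem_span_monomial _ (h.x_mul_monomial_mem i) n
  · rw [← mul_assoc]
    exact mul_pow_mem_span_monomial _ (h.y_mul_monomial_mem i) n
  · rw [← mul_assoc]
    exact mul_pow_mem_span_monomial _ (z_mul_monomial_mem _ _ _ i) n
  · obtain ⟨p₁, h₁, p₂, h₂, e⟩ := h.exists_b_mul_eq (mul_mem (pow_mem hz i.1) (hm i.2))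
    rw [← mul_assoc, e, add_mul, mul_assoc, ← pow_succ']
    exact add_mem (mul_pow_mem_span_monomial _ (h.mem_sphereSpan h₁) _)
      (mul_pow_mem_span_monomial _ (h.mem_sphereSpan h₂) _)

theorem mem_span_monomial_of_mem_starAdjoin [StarModule ℂ C] (h : SL2RRelations q t x y z b) {p : C}
    (hp : p ∈ StarAlgebra.adjoin ℂ {x, y, z, b}) :
    p ∈ Submodule.span ℂ (Set.range (monomial x y z b)) := by
  have hy : star y = x := by rw [← h.star_x, star_star]
  -- The star permutes the generators up to sign, so the generated `*`-algebra is already the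
  -- generated algebra.
  refine h.mem_span_monomial (Algebra.adjoin_le (Set.union_subset Algebra.subset_adjoin ?_) hp)
  intro g hg
  rw [← star_star g]
  obtain hg | hg | hg | hg := hg <;> rw [hg]
  · rw [h.star_x]; exact Algebra.subset_adjoin (by simp)
  · rw [hy]; exact Algebra.subset_adjoin (by simp)
  · rw [h.star_z]; exact Algebra.subset_adjoin (by simp)
  · rw [h.star_b]; exact neg_mem (Algebra.subset_adjoin (by simp))

theorem prod {C' : Type*} [Ring C'] [StarRing C'] [Algebra ℂ C'] {x' y' z' b' : C'}
    (h : SL2RRelations q t x y z b) (h' : SL2RRelations q t x' y' z' b') :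
    SL2RRelations q t (x, x') (y, y') (z, z') (b, b') where
  star_b := Prod.ext h.star_b h'.star_b
  star_x := Prod.ext h.star_x h'.star_x
  star_z := Prod.ext h.star_z h'.star_z
  x_z := Prod.ext h.x_z h'.x_z
  y_z := Prod.ext h.y_z h'.y_z
  x_y := Prod.ext h.x_y h'.x_y
  y_x := Prod.ext h.y_x h'.y_x
  b_x := Prod.ext h.b_x h'.b_x
  b_y := Prod.ext h.b_y h'.b_y
  b_z := Prod.ext h.b_z h'.b_z

end SL2RRelations

/-! ### Relations, linear independence and generation in `U_q(sl(2, ℝ)_t)`. -/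

namespace UqSL2R

variable (q : Set.Ioo (0 : ℝ) 1) (t : ℝ)

theorem relations : SL2RRelations (q : ℝ) t (X q t) (Y q t) (Z q t) (B q t) := by
  have star_x : star (X q t) = Y q t := Subtype.ext
    ((DrinfeldDouble.star_inA _ _).trans (congrArg _ (Oq.star_elemX q t)))
  have star_y : star (Y q t) = X q t := by rw [← star_x, star_star]
  have star_z : star (Z q t) = Z q t := Subtype.ext
    ((DrinfeldDouble.star_inA _ _).trans (congrArg _ (Oq.star_elemZ q t)))
  have star_b : star (B q t) = -B q t := Subtype.ext
    ((DrinfeldDouble.star_inU _ _).trans ((congrArg _ (Uq.star_elemB q t)).trans (map_neg _ _)))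
  have x_z : X q t * Z q t = qc q ^ 2 • (Z q t * X q t) := Subtype.ext <| by
    change UqSL2C.inA q _ * UqSL2C.inA q _ = qc q ^ 2 • (UqSL2C.inA q _ * UqSL2C.inA q _)
    rw [← map_mul, Oq.elemX_mul_elemZ, map_smul, map_mul]
  have b_x : B q t * X q t = qc q ^ 2 • (X q t * B q t) +
      qc q • ((qc q + (qc q)⁻¹) • Z q t + algebraMap ℂ _ (t : ℂ)) :=
    Subtype.ext (UqSL2C.elemB_mul_elemX q t)
  have h0 := qc_ne q
  have hs : star (qc q) = qc q := Complex.conj_ofReal _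
  have ht : star (t : ℂ) = t := Complex.conj_ofReal _
  refine ⟨star_b, star_x, star_z, x_z, ?_, ?_, ?_, b_x, ?_, Subtype.ext
    (UqSL2C.elemB_mul_elemZ q t)⟩
  -- The relation for `y` and `z` is the adjoint of the one for `x` and `z`.
  · have h := congrArg star x_z
    rw [star_smul, star_mul, star_mul, star_x, star_z, star_pow, hs] at h
    change _ = (qc q ^ 2)⁻¹ • _
    rw [h, smul_smul, inv_mul_cancel₀ (pow_ne_zero 2 h0), one_smul]
  · refine Subtype.ext ?_
    rw [sq (Z q t)]
    change UqSL2C.inA q _ * UqSL2C.inA q _ = 1 - (qc q * (t : ℂ)) • UqSL2C.inA q _ -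
      qc q ^ 2 • (UqSL2C.inA q _ * UqSL2C.inA q _)
    rw [← map_mul, Oq.elemX_mul_elemY]
    simp only [map_sub, map_smul, map_mul, map_one]
  · refine Subtype.ext ?_
    rw [sq (Z q t)]
    change UqSL2C.inA q _ * UqSL2C.inA q _ = 1 - ((qc q)⁻¹ * (t : ℂ)) • UqSL2C.inA q _ -
      (qc q ^ 2)⁻¹ • (UqSL2C.inA q _ * UqSL2C.inA q _)
    rw [← map_mul, Oq.elemY_mul_elemX]
    simp only [map_sub, map_smul, map_mul, map_one]
  -- The relation for `b` and `y` is the adjoint of the one for `b` and `x`, with `b` skew-adjoint,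
  -- solved for `b * y`.
  · have h := congrArg star b_x
    simp only [star_add, star_smul, star_mul, star_x, star_b, star_z, hs, star_pow, star_inv₀,
      ← algebraMap_star_comm, ht] at h
    change _ = (qc q ^ 2)⁻¹ • (Y q t * B q t) +
      (qc q)⁻¹ • ((qc q + (qc q)⁻¹) • Z q t + algebraMap ℂ _ (t : ℂ))
    have h' : Y q t * B q t = qc q ^ 2 • (B q t * Y q t) -
        qc q • ((qc q + (qc q)⁻¹) • Z q t + algebraMap ℂ _ (t : ℂ)) := by
      rw [mul_neg, neg_mul, smul_neg] at h
      rw [← neg_neg (Y q t * B q t), h]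
      abel
    rw [h', smul_sub, smul_smul, smul_smul, inv_mul_cancel₀ (pow_ne_zero 2 h0), one_smul]
    have : (qc q ^ 2)⁻¹ * qc q = (qc q)⁻¹ := by field_simp
    rw [this, sub_add_cancel]

/-- The linear map to `O_q(SU(2)) ⊗ U_q(su(2))` inverting the multiplication map. -/
def toTensor : UqSL2R q t →ₗ[ℂ] Oq q ⊗[ℂ] Uq q :=
  DrinfeldDouble.toTensor (su2Pairing q) ∘ₗ (UqSL2R q t).subtype.toAlgHom.toLinearMap

theorem toTensor_monomial (i : (ℕ × ℤ) × ℕ) :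
    toTensor q t (SL2RRelations.monomial (X q t) (Y q t) (Z q t) (B q t) i) =
      (elemZ q t ^ i.1.1 * signedPow (elemX q t) (elemY q t) i.1.2) ⊗ₜ (elemB q t ^ i.2) := by
  rw [← DrinfeldDouble.toTensor_inA_mul_inU (su2Pairing q), toTensor, LinearMap.comp_apply]
  congr 1
  rw [AlgHom.toLinearMap_apply, map_mul, map_mul, map_pow, map_pow, map_signedPow, map_mul,
    map_pow, map_pow, map_signedPow]
  rfl

theorem linearIndependent_monomial : LinearIndependent ℂ
    (SL2RRelations.monomial (X q t) (Y q t) (Z q t) (B q t)) := by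
  refine LinearIndependent.of_comp (toTensor q t) ?_
  -- `toTensor` sends the ordered monomials to pure tensors of two independent families, and such
  -- tensors are independent.
  have h := (Oq.linearIndependent_monomials q t).tmul_of_isDomain
    (Uq.linearIndependent_pow_elemB q t)
  exact (funext (toTensor_monomial q t) : toTensor q t ∘ _ = _) ▸ h

/-- The double is generated by the full subalgebras `UqM` and `UqK`; each of these is in turn
generated by the named elements, since the entries of `matE` are affine in `X`, `Y`, `Z`. -/
theorem adjoin_eq_top :
    StarAlgebra.adjoin ℂ {X q t, Y q t, Z q t, B q t} = ⊤ := by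
  -- The inclusion is checked in the ambient double, where both the images of `UqM` and `UqK` and
  -- the generated subalgebra live.
  set T : StarSubalgebra ℂ (UqSL2C q) :=
    (StarAlgebra.adjoin ℂ {X q t, Y q t, Z q t, B q t}).map (UqSL2R q t).subtype
  have hX : UqSL2C.inA q (elemX q t) ∈ T := ⟨X q t, StarAlgebra.subset_adjoin _ _ (by simp), rfl⟩
  have hY : UqSL2C.inA q (elemY q t) ∈ T := ⟨Y q t, StarAlgebra.subset_adjoin _ _ (by simp), rfl⟩
  have hZ : UqSL2C.inA q (elemZ q t) ∈ T := ⟨Z q t, StarAlgebra.subset_adjoin _ _ (by simp), rfl⟩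
  have hB : UqSL2C.inU q (elemB q t) ∈ T := ⟨B q t, StarAlgebra.subset_adjoin _ _ (by simp), rfl⟩
  have hA (a : Oq q) (ha : a ∈ UqM q t) : UqSL2C.inA q a ∈ T := by
    induction ha using StarAlgebra.adjoin_induction with
    | mem a ha =>
      obtain ⟨⟨i, j⟩, rfl⟩ := ha
      rw [matE_eq]
      fin_cases i <;> fin_cases j
      · simpa using SMulMemClass.smul_mem (qc q)⁻¹ hZ
      · simpa using hY
      · simpa using hX
      · simpa using sub_mem (neg_mem (algebraMap_mem T (t : ℂ))) (SMulMemClass.smul_mem (qc q) hZ)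
    | algebraMap c => rw [AlgHom.commutes]; exact algebraMap_mem T c
    | add a b _ _ ha hb => rw [map_add]; exact add_mem ha hb
    | mul a b _ _ ha hb => rw [map_mul]; exact mul_mem ha hb
    | star a _ ha => rw [← DrinfeldDouble.star_inA]; exact star_mem ha
  have hU (h : Uq q) (hh : h ∈ UqK q t) : UqSL2C.inU q h ∈ T := by
    induction hh using StarAlgebra.adjoin_induction with
    | mem a ha => rw [ha]; exact hB
    | algebraMap c => rw [AlgHom.commutes]; exact algebraMap_mem T c
    | add a b _ _ ha hb => rw [map_add]; exact add_mem ha hb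
    | mul a b _ _ ha hb => rw [map_mul]; exact mul_mem ha hb
    | star a _ ha => rw [← DrinfeldDouble.star_inU]; exact star_mem ha
  have hT : UqSL2R q t ≤ T := by
    refine StarAlgebra.adjoin_le ?_
    rintro _ (⟨a, ha, rfl⟩ | ⟨a, ha, rfl⟩)
    · exact hA a ha
    · exact hU a ha
  refine eq_top_iff.2 fun p _ => ?_
  obtain ⟨p', hp', e⟩ := hT p.2
  rwa [Subtype.ext (show (p : UqSL2C q) = p' from e.symm)]

end UqSL2R

/-! ### The universal property. -/

/-- The homomorphism is built as a graph: `S` is generated by the pairs of corresponding generators,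
and the projections `f` and `g` of `S` give the map as `g` composed with the inverse of `f`. -/
theorem SL2RRelations.existsUnique_starAlgHom {q : Set.Ioo (0 : ℝ) 1} {t : ℝ} {C : Type*} [Ring C]
    [StarRing C] [Algebra ℂ C] [StarModule ℂ C] {x y z b : C}
    (h : SL2RRelations (q : ℝ) t x y z b) :
    ∃! φ : UqSL2R q t →⋆ₐ[ℂ] C, φ (UqSL2R.X q t) = x ∧ φ (UqSL2R.Y q t) = y ∧
      φ (UqSL2R.Z q t) = z ∧ φ (UqSL2R.B q t) = b := by
  have hp := (UqSL2R.relations q t).prod h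
  set s : Set (UqSL2R q t × C) :=
    {(UqSL2R.X q t, x), (UqSL2R.Y q t, y), (UqSL2R.Z q t, z), (UqSL2R.B q t, b)} with hs
  let S : StarSubalgebra ℂ (UqSL2R q t × C) := StarAlgebra.adjoin ℂ s
  let f : S →⋆ₐ[ℂ] UqSL2R q t := (StarAlgHom.fst ℂ (UqSL2R q t) C).comp S.subtype
  let g : S →⋆ₐ[ℂ] C := (StarAlgHom.snd ℂ (UqSL2R q t) C).comp S.subtype
  have hinj : Function.Injective f := by
    refine (injective_iff_map_eq_zero f).2 fun p hp0 => ?_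
    -- The pairs satisfy the relations, so an element of `S` is a combination of ordered monomials
    -- in them. Its first component is the same combination of independent monomials, so if that
    -- vanishes then all coefficients do.
    have hspan := hp.mem_span_monomial_of_mem_starAdjoin p.2
    obtain ⟨c, hc⟩ := Finsupp.mem_span_range_iff_exists_finsupp.1 hspan
    have hc' := congrArg (AlgHom.fst ℂ (UqSL2R q t) C) hc
    have hmon (i : (ℕ × ℤ) × ℕ) : AlgHom.fst ℂ (UqSL2R q t) C
        (monomial (UqSL2R.X q t, x) (UqSL2R.Y q t, y) (UqSL2R.Z q t, z) (UqSL2R.B q t, b) i) =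
        monomial (UqSL2R.X q t) (UqSL2R.Y q t) (UqSL2R.Z q t) (UqSL2R.B q t) i := by
      rw [map_mul, map_mul, map_pow, map_pow, map_signedPow]
      rfl
    simp only [Finsupp.sum, map_sum, map_smul, hmon] at hc'
    have hc0 : c = 0 := linearIndependent_iff.1 (UqSL2R.linearIndependent_monomial q t) c
      (hc'.trans hp0)
    refine Subtype.ext ?_
    rw [← hc, hc0, Finsupp.sum_zero_index]
    rfl
  have hsurj : Function.Surjective f := by
    intro p
    have hle : StarAlgebra.adjoin ℂ {UqSL2R.X q t, UqSL2R.Y q t, UqSL2R.Z q t, UqSL2R.B q t} ≤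
        f.range := by
      refine StarAlgebra.adjoin_le ?_
      rintro _ (rfl | rfl | rfl | rfl)
      · exact ⟨⟨(UqSL2R.X q t, x), StarAlgebra.subset_adjoin ℂ s (by simp [hs])⟩, rfl⟩
      · exact ⟨⟨(UqSL2R.Y q t, y), StarAlgebra.subset_adjoin ℂ s (by simp [hs])⟩, rfl⟩
      · exact ⟨⟨(UqSL2R.Z q t, z), StarAlgebra.subset_adjoin ℂ s (by simp [hs])⟩, rfl⟩
      · exact ⟨⟨(UqSL2R.B q t, b), StarAlgebra.subset_adjoin ℂ s (by simp [hs])⟩, rfl⟩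
    rw [UqSL2R.adjoin_eq_top] at hle
    exact hle (StarSubalgebra.mem_top (x := p))
  let e : S ≃⋆ₐ[ℂ] UqSL2R q t := StarAlgEquiv.ofBijective f ⟨hinj, hsurj⟩
  have he {u : UqSL2R q t} {v : C} (huv : (u, v) ∈ s) : g (e.symm u) = v := by
    have : e.symm u = ⟨(u, v), StarAlgebra.subset_adjoin ℂ s huv⟩ :=
      -- Both elements of `S` have first component `u`, and the first projection is injective on
      -- `S`.
      e.injective (e.apply_symm_apply u)
    rw [this]
    rfl
  refine ⟨g.comp (e.symm : UqSL2R q t →⋆ₐ[ℂ] S), ⟨he (by simp [hs]), he (by simp [hs]),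
    he (by simp [hs]), he (by simp [hs])⟩, ?_⟩
  rintro ψ ⟨h₁, h₂, h₃, h₄⟩
  refine StarAlgHom.ext_of_adjoin_eq_top (UqSL2R.adjoin_eq_top q t) ?_
  rintro _ (rfl | rfl | rfl | rfl)
  · exact h₁.trans (he (by simp [hs])).symm
  · exact h₂.trans (he (by simp [hs])).symm
  · exact h₃.trans (he (by simp [hs])).symm
  · exact h₄.trans (he (by simp [hs])).symm

end QSL2

end

open QSL2

theorem mainTheorem3 (q : Set.Ioo (0 : ℝ) 1) (t : ℝ) :
    SL2RRelations (q : ℝ) t (UqSL2R.X q t) (UqSL2R.Y q t) (UqSL2R.Z q t) (UqSL2R.B q t) ∧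
    ∀ (C : Type*) [Ring C] [StarRing C] [Algebra ℂ C] [StarModule ℂ C] (x y z b : C),
      SL2RRelations (q : ℝ) t x y z b →
      ∃! φ : UqSL2R q t →⋆ₐ[ℂ] C, φ (UqSL2R.X q t) = x ∧ φ (UqSL2R.Y q t) = y ∧
        φ (UqSL2R.Z q t) = z ∧ φ (UqSL2R.B q t) = b :=
  ⟨UqSL2R.relations q t, fun _ _ _ _ _ _ _ _ _ h => h.existsUnique_starAlgHom⟩
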